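/- **Theorem (asymptotic representation of the de-biased estimator of the first canonical direction).** *Model.* For every $n$ let $(X_1,Y_1),\dots,(X_n,Y_n)$ be i.i.d. with the law of a pair $(X,Y)$ in $\mathbb R^{p}\times\mathbb R^{q}$, where the law and $p=p_n$, $q=q_n$ may depend on $n$. $X$ and $Y$ are centered and sub-Gaussian with sub-Gaussian parameters bounded uniformly in $n$. Let $\Sigma_x,\Sigma_y,\Sigma_{xy}=\Sigma_{yx}^T$ be the blocks of the covariance matrix of $(X,Y)$, and $\widehat\Sigma_x=\frac1n\sum_i X_iX_i^T$, $\widehat\Sigma_y=\frac1n\sum_i Y_iY_i^T$, $\widehat\Sigma_{xy}=\widehat\Sigma_{yx}^T=\frac1n\sum_i X_iY_i^T$. Let $\rho_0=\max\{\alpha^T\Sigma_{xy}\beta:\alpha^T\Sigma_x\alpha=\beta^T\Sigma_y\beta=1\}$ and let $(\alpha_0,\beta_0)$ be a maximizer. Let $\Sigma_{xy}$ have fixed rank $r\ge1$ and write $\Sigma_{xy}=\Sigma_xU\Lambda V^T\Sigma_y$ with $U\in\mathbb R^{p\times r}$, $V\in\mathbb R^{q\times r}$, $U^T\Sigma_xU=V^T\Sigma_yV=I_r$,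 and $\Lambda$ diagonal with $\Lambda_1\ge\dots\ge\Lambda_r>0$; put $\Lambda_2=0$ if $r=1$. Let $s_U,s_V$ be the numbers of nonzero rows of $U,V$, $s=s_U+s_V$, and $\lambda=(\log(p\vee q)/n)^{1/2}$. Put $x^0=\rho_0^{1/2}\alpha_0$, $y^0=\rho_0^{1/2}\beta_0$, $\Phi^0=(H^0)^{-1}$, $$H^0=2\rho_0\begin{bmatrix}\Sigma_x+2\Sigma_x\alpha_0\alpha_0^T\Sigma_x&-\Sigma_{xy}/\rho_0\\-\Sigma_{yx}/\rho_0&\Sigma_y+2\Sigma_y\beta_0\beta_0^T\Sigma_y\end{bmatrix}.$$ *Assumptions.* 1. (Eigengap) There is $\varepsilon_0\in(0,1)$ with $\rho_0-\Lambda_2>\varepsilon_0$ for all $n$. 2. (Bounded eigenvalues) There is $M>0$ such that all eigenvalues of $\Sigma_x,\Sigma_y$ lie in $[M^{-1},M]$ for all $n$. 3. (Sparsity) $s_U=o(p)$, $s_V=o(q)$ and $s^{2\kappa}\lambda^2=o(n^{-1/2})$, for a fixed $\kappa\in[1/2,1]$. 4. (Preliminary estimators) The random vectors $\widehat\alpha,\widehat\beta$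 satisfy $$\inf_{w\in\{\pm1\}}\|w\widehat\alpha-\alpha_0\|_2+\inf_{w\in\{\pm1\}}\|w\widehat\beta-\beta_0\|_2=O_p(s^{\kappa}\lambda),$$ $$\inf_{w\in\{\pm1\}}\|w\widehat\alpha-\alpha_0\|_1+\inf_{w\in\{\pm1\}}\|w\widehat\beta-\beta_0\|_1=O_p(s^{\kappa+1/2}\lambda).$$ 5. (Inverse Hessian) The random matrix $\widehat\Phi$ satisfies, for columns $j=1,\dots,p+q$, $$\max_j\|\widehat\Phi_j-\Phi^0_j\|_1=O_p(s^{\kappa+1/2}\lambda),\qquad \max_j\|\widehat\Phi_j-\Phi^0_j\|_2=O_p(s^{\kappa}\lambda).$$ 6. (Sign convention) With $\widehat\rho=\widehat\alpha^T\widehat\Sigma_{xy}\widehat\beta/\{(\widehat\alpha^T\widehat\Sigma_x\widehat\alpha)^{1/2}(\widehat\beta^T\widehat\Sigma_y\widehat\beta)^{1/2}\}$, $\widehat x=|\widehat\rho|^{1/2}\widehat\alpha$ and $\widehat y=|\widehat\rho|^{1/2}\widehat\beta$, one has $\widehat x^T\widehat\Sigma_{xy}\widehat y\ge0$ with probability tending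 to one (otherwise replace $\widehat\alpha$ by $-\widehat\alpha$). *Conclusion.* Let $\widehat x^{db}$ be the first $p$ coordinates of $$\begin{bmatrix}\widehat x\\ \widehat y\end{bmatrix}-\widehat\Phi^T\begin{bmatrix}2(\widehat x^T\widehat\Sigma_x\widehat x)\widehat\Sigma_x\widehat x-2\widehat\Sigma_{xy}\widehat y\\2(\widehat y^T\widehat\Sigma_y\widehat y)\widehat\Sigma_y\widehat y-2\widehat\Sigma_{yx}\widehat x\end{bmatrix},$$ and let $\mathcal L_{(1)}$ be the first $p$ coordinates of $$\mathcal L=2\Phi^0\begin{bmatrix}\rho_0(\widehat\Sigma_x-\Sigma_x)x^0-(\widehat\Sigma_{xy}-\Sigma_{xy})y^0+\{(x^0)^T(\widehat\Sigma_x-\Sigma_x)x^0\}\Sigma_xx^0\\\rho_0(\widehat\Sigma_y-\Sigma_y)y^0-(\widehat\Sigma_{yx}-\Sigma_{yx})x^0+\{(y^0)^T(\widehat\Sigma_y-\Sigma_y)y^0\}\Sigma_yy^0\end{bmatrix}.$$ Then there are random signs $\widehat w=\widehat w_n\in\{1,-1\}$ such that $$\widehat x^{db}=\widehat w\,(x^0-\mathcal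 L_{(1)})+\mathrm{rem},\qquad \|\mathrm{rem}\|_\infty=O_p(s^{2\kappa}\lambda^2),$$ and in particular $\|\mathrm{rem}\|_\infty=o_p(n^{-1/2})$. That is, either $\widehat x^{db}=x^0-\mathcal L_{(1)}+\mathrm{rem}$, or $\widehat x^{db}=-x^0-\mathcal L_{(1)}^-+\mathrm{rem}$ where $\mathcal L^-=-\mathcal L$ is the functional $\mathcal L$ formed with the equivalent pair $(-x^0,-y^0)$. -/

import Mathlib

open MeasureTheory ProbabilityTheory Filter Asymptotics
open scoped Matrix NNReal ENNReal Topology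

noncomputable section

namespace SCCA

/-! ### Norms and stochastic order symbols -/

/-- The `ℓ¹` norm of a vector. -/
def l1Norm {ι : Type*} [Fintype ι] (v : ι → ℝ) : ℝ := ‖WithLp.toLp 1 v‖

/-- The `ℓ²` (Euclidean) norm of a vector. -/
def l2Norm {ι : Type*} [Fintype ι] (v : ι → ℝ) : ℝ := ‖WithLp.toLp 2 v‖

/-- The `ℓ^∞` norm of a vector (the norm of the finite product). -/
def supNorm {ι : Type*} [Fintype ι] (v : ι → ℝ) : ℝ := ‖v‖

/-- `inf_{w ∈ {1, -1}} N (w a - α)`. -/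
def signDist {ι : Type*} (N : (ι → ℝ) → ℝ) (a α : ι → ℝ) : ℝ :=
  min (N (a - α)) (N (-a - α))

/-- `Z_n = O_p(a_n)`, where `Z_n` is a function on the `n`-th probability space. -/
def IsBigOInProb {Ω : ℕ → Type*} [∀ n, MeasurableSpace (Ω n)] (P : ∀ n, Measure (Ω n))
    (Z : ∀ n, Ω n → ℝ) (a : ℕ → ℝ) : Prop :=
  ∀ ε : ℝ, 0 < ε → ∃ C : ℝ, 0 < C ∧
    ∀ᶠ n in atTop, P n {ω | C * a n < |Z n ω|} ≤ ENNReal.ofReal ε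

/-- `Z_n = o_p(a_n)`. -/
def IsLittleOInProb {Ω : ℕ → Type*} [∀ n, MeasurableSpace (Ω n)] (P : ∀ n, Measure (Ω n))
    (Z : ∀ n, Ω n → ℝ) (a : ℕ → ℝ) : Prop :=
  ∀ ε : ℝ, 0 < ε → Tendsto (fun n => P n {ω | ε * a n < |Z n ω|}) atTop (𝓝 0)

/-! ### Sampling model -/

/-- The distribution `ν` on `ℝ^d` is centered sub-Gaussian with variance proxy `K`: every
one-dimensional projection `⟨u, X⟩` in a unit direction satisfies
`E exp (t ⟨u, X⟩) ≤ exp (K t² / 2)` for all `t`. -/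
def IsSubGaussianVector {d : ℕ} (ν : Measure (Fin d → ℝ)) (K : ℝ≥0) : Prop :=
  (∀ j, ∫ x, x j ∂ν = 0) ∧
    ∀ u : Fin d → ℝ, l2Norm u = 1 → HasSubgaussianMGF (fun x => u ⬝ᵥ x) K ν

/-- `Z_1, …, Z_n` are i.i.d. random elements with law `μ`. -/
structure IsIIDSample {Ω E : Type*} [MeasurableSpace Ω] [MeasurableSpace E]
    (P : Measure Ω) (μ : Measure E) {n : ℕ} (Z : Fin n → Ω → E) : Prop where
  measurable : ∀ i, Measurable (Z i)
  law : ∀ i, P.map (Z i) = μ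
  indep : iIndepFun Z P

/-- The blocks `Σ_x`, `Σ_y`, `Σ_xy` of a (population or sample) joint covariance matrix;
`Σ_yx` is the transpose of `Σ_xy`. -/
structure CovBlocks (p q : ℕ) where
  xx : Matrix (Fin p) (Fin p) ℝ
  yy : Matrix (Fin q) (Fin q) ℝ
  xy : Matrix (Fin p) (Fin q) ℝ

/-- The population covariance of `(X, Y) ∼ μ`. -/
def populationCov {p q : ℕ} (μ : Measure ((Fin p → ℝ) × (Fin q → ℝ))) : CovBlocks p q where
  xx := Matrix.of fun j k => covariance (fun z => z.1 j) (fun z => z.1 k) μ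
  yy := Matrix.of fun j k => covariance (fun z => z.2 j) (fun z => z.2 k) μ
  xy := Matrix.of fun j k => covariance (fun z => z.1 j) (fun z => z.2 k) μ

/-- The empirical covariance of centered data: `n⁻¹ ∑ X_i X_iᵀ`, `n⁻¹ ∑ Y_i Y_iᵀ`,
`n⁻¹ ∑ X_i Y_iᵀ`. -/
def sampleCov {p q n : ℕ} (z : Fin n → (Fin p → ℝ) × (Fin q → ℝ)) : CovBlocks p q where
  xx := (n : ℝ)⁻¹ • ∑ i, Matrix.vecMulVec (z i).1 (z i).1
  yy := (n : ℝ)⁻¹ • ∑ i, Matrix.vecMulVec (z i).2 (z i).2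
  xy := (n : ℝ)⁻¹ • ∑ i, Matrix.vecMulVec (z i).1 (z i).2

/-! ### Canonical correlation analysis -/

/-- Feasibility in the first canonical correlation problem: `αᵀ Σ_x α = βᵀ Σ_y β = 1`. -/
def IsFeasible {p q : ℕ} (S : CovBlocks p q) (α : Fin p → ℝ) (β : Fin q → ℝ) : Prop :=
  α ⬝ᵥ (S.xx *ᵥ α) = 1 ∧ β ⬝ᵥ (S.yy *ᵥ β) = 1

/-- The first canonical correlation `ρ₀ = max {αᵀ Σ_xy β : αᵀ Σ_x α = βᵀ Σ_y β = 1}`. -/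
def rho0 {p q : ℕ} (S : CovBlocks p q) : ℝ :=
  sSup {t | ∃ α β, IsFeasible S α β ∧ t = α ⬝ᵥ (S.xy *ᵥ β)}

/-- `(α₀, β₀)` is a pair of first canonical directions: a solution of the maximization problem. -/
def IsLeadingPair {p q : ℕ} (S : CovBlocks p q) (α₀ : Fin p → ℝ) (β₀ : Fin q → ℝ) : Prop :=
  IsFeasible S α₀ β₀ ∧
    ∀ α β, IsFeasible S α β → α ⬝ᵥ (S.xy *ᵥ β) ≤ α₀ ⬝ᵥ (S.xy *ᵥ β₀)

/-- The decomposition `Σ_xy = Σ_x U Λ Vᵀ Σ_y` with `Uᵀ Σ_x U = I_r`, `Vᵀ Σ_y V = I_r` and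
canonical correlations `Λ_1 ≥ … ≥ Λ_r > 0`; it forces `Σ_xy` to have rank `r` when `Σ_x` and
`Σ_y` are invertible. -/
structure IsCanonicalDecomposition {p q r : ℕ} (S : CovBlocks p q)
    (U : Matrix (Fin p) (Fin r) ℝ) (V : Matrix (Fin q) (Fin r) ℝ) (Λ : Fin r → ℝ) : Prop where
  decomposition : S.xy = S.xx * U * Matrix.diagonal Λ * Vᵀ * S.yy
  orthU : Uᵀ * S.xx * U = 1
  orthV : Vᵀ * S.yy * V = 1
  antitone : Antitone Λ
  pos : ∀ k, 0 < Λ k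

/-- The second canonical correlation `Λ_2`, which is `0` if `r = 1`. -/
def secondCorr {r : ℕ} (Λ : Fin r → ℝ) : ℝ := if h : 1 < r then Λ ⟨1, h⟩ else 0

/-- All eigenvalues of `A` lie in `[M⁻¹, M]`. -/
def EigenvaluesBounded {d : ℕ} (A : Matrix (Fin d) (Fin d) ℝ) (M : ℝ) : Prop :=
  ∀ t ∈ spectrum ℝ A, M⁻¹ ≤ t ∧ t ≤ M

/-- The number of nonzero rows of a matrix. -/
def rowSparsity {d r : ℕ} (U : Matrix (Fin d) (Fin r) ℝ) : ℕ := {i | U i ≠ 0}.ncard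

/-- `λ = (log (p ∨ q) / n)^{1/2}`. -/
def lam (p q n : ℕ) : ℝ := √(Real.log ((max p q : ℕ) : ℝ) / (n : ℝ))

/-! ### The Hessian and its inverse -/

/-- The Hessian
`H⁰ = 2 ρ₀ [Σ_x + 2 Σ_x α₀ α₀ᵀ Σ_x, -Σ_xy/ρ₀; -Σ_yx/ρ₀, Σ_y + 2 Σ_y β₀ β₀ᵀ Σ_y]`
at `ρ₀^{1/2} (α₀, β₀)` of
`h (x, y) = (xᵀ Σ_x x)² / 2 + (yᵀ Σ_y y)² / 2 - 2 xᵀ Σ_xy y`. -/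
def hessian0 {p q : ℕ} (S : CovBlocks p q) (α₀ : Fin p → ℝ) (β₀ : Fin q → ℝ) :
    Matrix (Fin p ⊕ Fin q) (Fin p ⊕ Fin q) ℝ :=
  (2 * rho0 S) • Matrix.fromBlocks
    (S.xx + (2 : ℝ) • (S.xx * Matrix.vecMulVec α₀ α₀ * S.xx)) (-((rho0 S)⁻¹ • S.xy))
    (-((rho0 S)⁻¹ • S.xyᵀ)) (S.yy + (2 : ℝ) • (S.yy * Matrix.vecMulVec β₀ β₀ * S.yy))

/-- `Φ⁰`, the inverse of `H⁰`. -/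
def Phi0 {p q : ℕ} (S : CovBlocks p q) (α₀ : Fin p → ℝ) (β₀ : Fin q → ℝ) :
    Matrix (Fin p ⊕ Fin q) (Fin p ⊕ Fin q) ℝ :=
  (hessian0 S α₀ β₀)⁻¹

/-- The target `x⁰ = ρ₀^{1/2} α₀` (and, applied to `β₀`, `y⁰ = ρ₀^{1/2} β₀`). -/
def target {p q d : ℕ} (S : CovBlocks p q) (α₀ : Fin d → ℝ) : Fin d → ℝ :=
  √(rho0 S) • α₀

/-- `max_j N (A_j - B_j)` over the columns of two matrices. -/
def maxColDist {ι : Type*} [Fintype ι] (N : (ι → ℝ) → ℝ) (A B : Matrix ι ι ℝ) : ℝ :=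
  ⨆ j, N (fun k => A k j - B k j)

/-! ### The de-biased estimator -/

/-- `ρ̂ = α̂ᵀ Σ̂_xy β̂ / ((α̂ᵀ Σ̂_x α̂)^{1/2} (β̂ᵀ Σ̂_y β̂)^{1/2})`. -/
def rhoHat {p q : ℕ} (S : CovBlocks p q) (a : Fin p → ℝ) (b : Fin q → ℝ) : ℝ :=
  (a ⬝ᵥ (S.xy *ᵥ b)) / (√(a ⬝ᵥ (S.xx *ᵥ a)) * √(b ⬝ᵥ (S.yy *ᵥ b)))

/-- `x̂ = |ρ̂|^{1/2} α̂`. -/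
def xHat {p q : ℕ} (S : CovBlocks p q) (a : Fin p → ℝ) (b : Fin q → ℝ) : Fin p → ℝ :=
  √|rhoHat S a b| • a

/-- `ŷ = |ρ̂|^{1/2} β̂`. -/
def yHat {p q : ℕ} (S : CovBlocks p q) (a : Fin p → ℝ) (b : Fin q → ℝ) : Fin q → ℝ :=
  √|rhoHat S a b| • b

/-- The gradient `(2 (xᵀ Σ_x x) Σ_x x - 2 Σ_xy y, 2 (yᵀ Σ_y y) Σ_y y - 2 Σ_yx x)`. -/
def gradH {p q : ℕ} (S : CovBlocks p q) (x : Fin p → ℝ) (y : Fin q → ℝ) :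
    Fin p ⊕ Fin q → ℝ :=
  Sum.elim
    ((2 * (x ⬝ᵥ (S.xx *ᵥ x))) • (S.xx *ᵥ x) - (2 : ℝ) • (S.xy *ᵥ y))
    ((2 * (y ⬝ᵥ (S.yy *ᵥ y))) • (S.yy *ᵥ y) - (2 : ℝ) • (S.xyᵀ *ᵥ x))

/-- The one-step de-biased estimator `(x̂, ŷ) - Φ̂ᵀ ∇ĥ(x̂, ŷ)`, with `S` the sample
covariance. -/
def debiased {p q : ℕ} (S : CovBlocks p q) (a : Fin p → ℝ) (b : Fin q → ℝ)
    (Φ : Matrix (Fin p ⊕ Fin q) (Fin p ⊕ Fin q) ℝ) : Fin p ⊕ Fin q → ℝ :=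
  Sum.elim (xHat S a b) (yHat S a b) - Φᵀ *ᵥ gradH S (xHat S a b) (yHat S a b)

/-- The first `p` coordinates of the de-biased estimator. -/
def xDebiased {p q : ℕ} (S : CovBlocks p q) (a : Fin p → ℝ) (b : Fin q → ℝ)
    (Φ : Matrix (Fin p ⊕ Fin q) (Fin p ⊕ Fin q) ℝ) : Fin p → ℝ :=
  fun i => debiased S a b Φ (Sum.inl i)

/-! ### The leading term -/

/-- The vector `𝓛`, a linear functional of the deviations `Ŝ - S` of the sample covariance
blocks from the population ones. -/
def calL {p q : ℕ} (S Shat : CovBlocks p q) (α₀ : Fin p → ℝ) (β₀ : Fin q → ℝ) :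
    Fin p ⊕ Fin q → ℝ :=
  let x₀ := target S α₀
  let y₀ := target S β₀
  (2 : ℝ) • (Phi0 S α₀ β₀ *ᵥ Sum.elim
    (rho0 S • ((Shat.xx - S.xx) *ᵥ x₀) - (Shat.xy - S.xy) *ᵥ y₀
      + (x₀ ⬝ᵥ ((Shat.xx - S.xx) *ᵥ x₀)) • (S.xx *ᵥ x₀))
    (rho0 S • ((Shat.yy - S.yy) *ᵥ y₀) - (Shat.xy - S.xy)ᵀ *ᵥ x₀
      + (y₀ ⬝ᵥ ((Shat.yy - S.yy) *ᵥ y₀)) • (S.yy *ᵥ y₀)))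

/-- `𝓛_(1)`, the first `p` coordinates of `𝓛`. -/
def calL1 {p q : ℕ} (S Shat : CovBlocks p q) (α₀ : Fin p → ℝ) (β₀ : Fin q → ℝ) :
    Fin p → ℝ :=
  fun i => calL S Shat α₀ β₀ (Sum.inl i)

end SCCA

end

open SCCA

/-! The pair `(x⁰, y⁰)` is a stationary point of `h(x, y) = (xᵀΣ_x x)²/2 + (yᵀΣ_y y)²/2 - 2 xᵀΣ_xy
y`, and de-biasing is one Newton step for the empirical version of `h`. Up to a common sign the
estimators are `(x⁰ + δ, y⁰ + ε)`; write a column of `Φ̂` as `Φ⁰_j + Δ` and pair it with the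
empirical gradient there. The constant term vanishes by stationarity, and so does the population
term weighted by `Δ`. The part linear in `(δ, ε)` is `Φ⁰_j · H⁰(δ, ε) = δ_j`, which cancels the
estimation error; the part linear in the sampling error is `𝓛_j`. Everything else is of second order
(`IsRegime.gradient_block_expansion`, `debiased_expansion`).

With `a = s^κ λ` and `b = s^(κ+1/2) λ`, products of two errors in the population form are `O(a²)`
because that form is bounded. The sampling error is `O(λ)` entrywise, so by Hölder it costs `λ b`
against one error and `λ b²` against two. Both are `O(a²)`: the first since `κ ≥ 1/2`, the second
since `s λ ≤ 1` eventually (`rate_conditions`). The directions `Φ⁰_j`, `α₀`, `β₀` are not small in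
`ℓ¹`, but there are only `O(p ∨ q)` of them, so Bernstein's inequality and a union bound control the
sampling error along them too (`exists_uniform_concentration`).

On the population side (`isRegularPopulation`), the eigengap makes the leading pair unique up to
sign, so that it inherits the row supports of `U` and `V`; it also makes `H⁰` coercive, which bounds
the columns of `Φ⁰`.

Each preliminary estimator has its own unknown sign. The sign convention forces the two to agree,
because `ρ₀` stays away from zero (`rhoHat_consistency`), and the gradient is odd, so the common
sign factors out. -/

namespace SCCA

/-! ### Vector norms, sparsity and sign ambiguity. -/

section Norms
variable {ι κ : Type*} [Fintype ι] [Fintype κ]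

lemma l2Norm_nonneg (v : ι → ℝ) : 0 ≤ l2Norm v := norm_nonneg _

lemma l1Norm_nonneg (v : ι → ℝ) : 0 ≤ l1Norm v := norm_nonneg _

lemma l2Norm_sq (v : ι → ℝ) : l2Norm v ^ 2 = v ⬝ᵥ v := by
  simp only [l2Norm, PiLp.norm_sq_eq_of_L2, dotProduct, Real.norm_eq_abs, sq_abs]
  exact Finset.sum_congr rfl fun i _ => sq (v i)

lemma l2Norm_eq_sqrt (v : ι → ℝ) : l2Norm v = √(v ⬝ᵥ v) := by
  rw [← l2Norm_sq, Real.sqrt_sq (l2Norm_nonneg v)]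

lemma l1Norm_eq_sum (v : ι → ℝ) : l1Norm v = ∑ i, |v i| := by
  simp [l1Norm, PiLp.norm_eq_of_L1]

lemma l2Norm_add_le (u v : ι → ℝ) : l2Norm (u + v) ≤ l2Norm u + l2Norm v := by
  simpa [l2Norm] using norm_add_le (WithLp.toLp 2 u) (WithLp.toLp 2 v)

lemma l1Norm_add_le (u v : ι → ℝ) : l1Norm (u + v) ≤ l1Norm u + l1Norm v := by
  simpa [l1Norm] using norm_add_le (WithLp.toLp 1 u) (WithLp.toLp 1 v)

lemma l2Norm_smul (c : ℝ) (v : ι → ℝ) : l2Norm (c • v) = |c| * l2Norm v := by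
  simpa [l2Norm] using norm_smul c (WithLp.toLp 2 v)

lemma l1Norm_smul (c : ℝ) (v : ι → ℝ) : l1Norm (c • v) = |c| * l1Norm v := by
  simpa [l1Norm] using norm_smul c (WithLp.toLp 1 v)

lemma l2Norm_eq_zero {v : ι → ℝ} : l2Norm v = 0 ↔ v = 0 := by
  rw [← sq_eq_zero_iff, l2Norm_sq, dotProduct_self_eq_zero]

lemma l2Norm_elim_sq (u : ι → ℝ) (v : κ → ℝ) :
    l2Norm (Sum.elim u v) ^ 2 = l2Norm u ^ 2 + l2Norm v ^ 2 := by
  simp [l2Norm_sq, dotProduct]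

lemma l2Norm_elim_zero (u : ι → ℝ) : l2Norm (Sum.elim u (0 : κ → ℝ)) = l2Norm u := by
  simp [l2Norm_eq_sqrt, dotProduct]

lemma l2Norm_zero_elim (v : κ → ℝ) : l2Norm (Sum.elim (0 : ι → ℝ) v) = l2Norm v := by
  simp [l2Norm_eq_sqrt, dotProduct]

lemma l1Norm_elim (u : ι → ℝ) (v : κ → ℝ) :
    l1Norm (Sum.elim u v) = l1Norm u + l1Norm v := by
  simp [l1Norm_eq_sum]

lemma l1Norm_zero : l1Norm (0 : ι → ℝ) = 0 := by simp [l1Norm_eq_sum]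

lemma abs_dotProduct_le_l2Norm (u v : ι → ℝ) : |u ⬝ᵥ v| ≤ l2Norm u * l2Norm v := by
  refine abs_le_of_sq_le_sq ?_ (mul_nonneg (l2Norm_nonneg u) (l2Norm_nonneg v))
  rw [mul_pow, l2Norm_sq, l2Norm_sq]
  simpa [dotProduct, sq] using Finset.sum_mul_sq_le_sq_mul_sq Finset.univ u v

lemma abs_le_l2Norm (v : ι → ℝ) (i : ι) : |v i| ≤ l2Norm v := by
  classical
  have h := abs_dotProduct_le_l2Norm (Pi.single i 1) v
  have h1 : l2Norm (Pi.single i (1 : ℝ)) = 1 := by simp [l2Norm_eq_sqrt]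
  simpa [h1] using h

lemma abs_dotProduct_le_l1Norm {c : ℝ} (u v : ι → ℝ) (h : ∀ i, |u i| ≤ c) :
    |u ⬝ᵥ v| ≤ c * l1Norm v := by
  rw [l1Norm_eq_sum, Finset.mul_sum]
  refine (Finset.abs_sum_le_sum_abs _ _).trans (Finset.sum_le_sum fun i _ => ?_)
  rw [abs_mul]
  exact mul_le_mul_of_nonneg_right (h i) (abs_nonneg _)

/-- A vector supported on `s` has `ℓ¹` norm at most `√|s|` times its `ℓ²` norm. -/
lemma l1Norm_le_of_support (s : Finset ι) (v : ι → ℝ) (h : ∀ i, i ∉ s → v i = 0) :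
    l1Norm v ≤ √(s.card : ℝ) * l2Norm v := by
  have h1 : l1Norm v = ∑ i ∈ s, |v i| * 1 := by
    rw [l1Norm_eq_sum]
    simp only [mul_one]
    exact (Finset.sum_subset (Finset.subset_univ s) fun i _ hi => by simp [h i hi]).symm
  refine le_of_sq_le_sq ?_ (mul_nonneg (Real.sqrt_nonneg _) (l2Norm_nonneg v))
  rw [mul_pow, Real.sq_sqrt (Nat.cast_nonneg _), h1, mul_comm]
  refine (Finset.sum_mul_sq_le_sq_mul_sq s _ _).trans ?_
  simp only [sq_abs, one_pow, Finset.sum_const, nsmul_eq_mul, mul_one]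
  refine mul_le_mul_of_nonneg_right ?_ (Nat.cast_nonneg _)
  rw [l2Norm_sq, dotProduct]
  simp only [← sq]
  exact Finset.sum_le_sum_of_subset_of_nonneg (Finset.subset_univ s) fun i _ _ => sq_nonneg _

/-- Two approximations of `±α`, one in `ℓ²` and one in `ℓ¹`, with possibly different signs: for a
sparse `α` the sign that is right for `ℓ²` is also right for `ℓ¹`. -/
lemma l1Norm_sub_le_of_signDist (s : Finset ι) (α a : ι → ℝ) (hα : ∀ i, i ∉ s → α i = 0)
    {w : ℝ} (hw : w = 1 ∨ w = -1) (h2 : signDist l2Norm a α = l2Norm (w • a - α)) :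
    l1Norm (w • a - α) ≤
      3 * signDist l1Norm a α + 2 * (√(s.card : ℝ) * signDist l2Norm a α) := by
  classical
  have hneg : l1Norm (w • a - α) ≤ signDist l1Norm a α ∨
      l1Norm (-(w • a) - α) ≤ signDist l1Norm a α := by
    unfold signDist
    rcases hw with rfl | rfl <;>
      rcases min_choice (l1Norm (a - α)) (l1Norm (-a - α)) with h | h <;> rw [h] <;> simp
  have h0 : 0 ≤ signDist l1Norm a α := le_min (l1Norm_nonneg _) (l1Norm_nonneg _)
  have h0' : 0 ≤ signDist l2Norm a α := le_min (l2Norm_nonneg _) (l2Norm_nonneg _)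
  rcases hneg with h | h
  · have := mul_nonneg (Real.sqrt_nonneg (s.card : ℝ)) h0'
    linarith
  · set u := w • a - α with hu
    set v := -(w • a) - α with hv
    let us : ι → ℝ := fun i => if i ∈ s then u i else 0
    have hus : l1Norm us ≤ √(s.card : ℝ) * l2Norm u := by
      refine (l1Norm_le_of_support s us fun i hi => by simp [us, hi]).trans ?_
      refine mul_le_mul_of_nonneg_left ?_ (Real.sqrt_nonneg _)
      rw [l2Norm_eq_sqrt, l2Norm_eq_sqrt]
      refine Real.sqrt_le_sqrt (Finset.sum_le_sum fun i _ => ?_)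
      by_cases hi : i ∈ s
      · simp [us, hi]
      · simp [us, hi, mul_self_nonneg]
    rw [h2]
    -- Off `s` the vector `α` vanishes, so `u = -v` there and the sign is irrelevant to `ℓ¹`; on `s`
    -- the `ℓ²` bound takes over through `us`. The constants are not sharp.
    have h3 : l1Norm u ≤ 3 * l1Norm v + 2 * l1Norm us := by
      simp only [l1Norm_eq_sum, Finset.mul_sum, ← Finset.sum_add_distrib]
      refine Finset.sum_le_sum fun i _ => ?_
      by_cases hi : i ∈ s
      · simp only [us, hi, if_true]
        linarith [abs_nonneg (u i), abs_nonneg (v i)]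
      · have : u i = -v i := by simp [hu, hv, hα i hi]
        simp only [us, hi, if_false, this, abs_neg, abs_zero]
        linarith [abs_nonneg (v i)]
    linarith

end Norms

/-! ### The joint covariance as a single bilinear form. -/

section Joint
variable {p q : ℕ}

/-- The covariance matrix of the stacked vector `(X, Y)`. -/
def joint (S : CovBlocks p q) : Matrix (Fin p ⊕ Fin q) (Fin p ⊕ Fin q) ℝ :=
  Matrix.fromBlocks S.xx S.xy S.xyᵀ S.yy

/-- The bilinear form of the covariance matrix of the stacked vector `(X, Y)`. -/
noncomputable def bil (S : CovBlocks p q) : LinearMap.BilinForm ℝ (Fin p ⊕ Fin q → ℝ) :=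
  Matrix.toBilin' (joint S)

/-- A vector of the first block, padded with zeros. -/
def inX (q : ℕ) (u : Fin p → ℝ) : Fin p ⊕ Fin q → ℝ := Sum.elim u 0

/-- A vector of the second block, padded with zeros. -/
def inY (p : ℕ) (v : Fin q → ℝ) : Fin p ⊕ Fin q → ℝ := Sum.elim 0 v

lemma bil_apply (S : CovBlocks p q) (u v : Fin p ⊕ Fin q → ℝ) :
    bil S u v = u ⬝ᵥ (joint S *ᵥ v) := Matrix.toBilin'_apply' _ _ _

lemma elim_eq_inX_add_inY (u : Fin p → ℝ) (v : Fin q → ℝ) :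
    Sum.elim u v = inX q u + inY p v := by
  ext (i | i) <;> simp [inX, inY]

lemma inX_add (u v : Fin p → ℝ) : inX q (u + v) = inX q u + inX q v := by
  ext (i | i) <;> simp [inX]

lemma inY_add (u v : Fin q → ℝ) : inY p (u + v) = inY p u + inY p v := by
  ext (i | i) <;> simp [inY]

lemma inX_smul (c : ℝ) (v : Fin p → ℝ) : inX q (c • v) = c • inX q v := by
  ext (i | i) <;> simp [inX]

lemma inY_smul (c : ℝ) (v : Fin q → ℝ) : inY p (c • v) = c • inY p v := by
  ext (i | i) <;> simp [inY]

lemma bil_inX_inX (S : CovBlocks p q) (u v : Fin p → ℝ) :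
    bil S (inX q u) (inX q v) = u ⬝ᵥ (S.xx *ᵥ v) := by
  simp [bil_apply, joint, inX, Matrix.fromBlocks_mulVec, dotProduct]

lemma bil_inX_inY (S : CovBlocks p q) (u : Fin p → ℝ) (v : Fin q → ℝ) :
    bil S (inX q u) (inY p v) = u ⬝ᵥ (S.xy *ᵥ v) := by
  simp [bil_apply, joint, inX, inY, Matrix.fromBlocks_mulVec, dotProduct]

lemma bil_inY_inX (S : CovBlocks p q) (u : Fin p → ℝ) (v : Fin q → ℝ) :
    bil S (inY p v) (inX q u) = v ⬝ᵥ (S.xyᵀ *ᵥ u) := by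
  simp [bil_apply, joint, inX, inY, Matrix.fromBlocks_mulVec, dotProduct]

lemma bil_inY_inY (S : CovBlocks p q) (u v : Fin q → ℝ) :
    bil S (inY p u) (inY p v) = u ⬝ᵥ (S.yy *ᵥ v) := by
  simp [bil_apply, joint, inY, Matrix.fromBlocks_mulVec, dotProduct]

/-- Entrywise control of a bilinear form against a fixed vector gives `ℓ¹` control. -/
lemma abs_bilin_le_l1Norm {ι : Type*} [Fintype ι] [DecidableEq ι]
    (E : LinearMap.BilinForm ℝ (ι → ℝ)) (f v : ι → ℝ) {c : ℝ}
    (h : ∀ k, |E f (Pi.single k 1)| ≤ c) : |E f v| ≤ c * l1Norm v := by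
  have h1 : E f v = (fun k => E f (Pi.single k 1)) ⬝ᵥ v := by
    conv_lhs => rw [pi_eq_sum_univ' v]
    simp [dotProduct, mul_comm]
  rw [h1]
  exact abs_dotProduct_le_l1Norm _ _ h

lemma abs_bilin_le_l1Norm_mul {ι : Type*} [Fintype ι] [DecidableEq ι]
    (E : LinearMap.BilinForm ℝ (ι → ℝ)) (hE : E.IsSymm) (u v : ι → ℝ) {c : ℝ}
    (h : ∀ k l, |E (Pi.single k 1) (Pi.single l 1)| ≤ c) :
    |E u v| ≤ c * l1Norm u * l1Norm v := by
  refine abs_bilin_le_l1Norm E u v fun k => ?_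
  rw [hE.eq u]
  exact abs_bilin_le_l1Norm E _ u fun l => h k l

end Joint

/-! ### Population canonical directions and coercivity of the Hessian. -/

section Population

lemma dotProduct_self_nonneg {ι : Type*} [Fintype ι] (v : ι → ℝ) : 0 ≤ v ⬝ᵥ v := by
  rw [← l2Norm_sq]
  positivity

/-- Shifting or reflecting the spectrum makes `A - M⁻¹` and `M - A` symmetric with nonnegative
spectrum, hence positive semidefinite. -/
lemma EigenvaluesBounded.quadratic_bounds {d : ℕ} {A : Matrix (Fin d) (Fin d) ℝ} {M : ℝ}
    (h : EigenvaluesBounded A M) (hA : Aᵀ = A) (u : Fin d → ℝ) :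
    M⁻¹ * (u ⬝ᵥ u) ≤ u ⬝ᵥ (A *ᵥ u) ∧ u ⬝ᵥ (A *ᵥ u) ≤ M * (u ⬝ᵥ u) := by
  have hH : A.IsHermitian := by
    simpa [Matrix.IsHermitian, Matrix.conjTranspose_eq_transpose_of_trivial] using hA
  have h1 : (A - algebraMap ℝ _ M⁻¹).PosSemidef := by
    rw [Matrix.posSemidef_iff_isHermitian_and_spectrum_nonneg]
    refine ⟨hH.sub (by simp [Matrix.IsHermitian, Matrix.algebraMap_eq_diagonal]), fun t ht => ?_⟩
    have : M⁻¹ + t ∈ spectrum ℝ A := by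
      have := spectrum.add_mem_add_iff (R := ℝ) (a := A - algebraMap ℝ _ M⁻¹) (r := t) (s := M⁻¹)
      simp only [add_sub_cancel] at this
      rw [add_comm]
      exact this.2 ht
    have := (h _ this).1
    simpa using this
  have h2 : (algebraMap ℝ _ M - A).PosSemidef := by
    rw [Matrix.posSemidef_iff_isHermitian_and_spectrum_nonneg]
    refine ⟨Matrix.IsHermitian.sub (by simp [Matrix.IsHermitian, Matrix.algebraMap_eq_diagonal]) hH,
      fun t ht => ?_⟩
    have : M - t ∈ spectrum ℝ A := by
      rw [← spectrum.singleton_sub_eq] at ht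
      obtain ⟨x, hx, y, hy, rfl⟩ := ht
      simp only [Set.mem_singleton_iff] at hx
      subst hx
      simpa using hy
    have := (h _ this).2
    simp only [tsub_le_iff_right, le_add_iff_nonneg_right] at this
    exact this
  have e1 := h1.dotProduct_mulVec_nonneg u
  have e2 := h2.dotProduct_mulVec_nonneg u
  simp [Matrix.sub_mulVec, Algebra.algebraMap_eq_smul_one, Matrix.smul_mulVec] at e1 e2
  exact ⟨e1, e2⟩

/-- Pythagoras for the projection onto `A`-orthonormal columns. -/
lemma projection_pythagoras {d r : ℕ} {A : Matrix (Fin d) (Fin d) ℝ} (hA : Aᵀ = A)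
    {U : Matrix (Fin d) (Fin r) ℝ} (hU : Uᵀ * A * U = 1) (u : Fin d → ℝ) :
    (u - U *ᵥ (Uᵀ *ᵥ (A *ᵥ u))) ⬝ᵥ (A *ᵥ (u - U *ᵥ (Uᵀ *ᵥ (A *ᵥ u)))) =
      u ⬝ᵥ (A *ᵥ u) - (Uᵀ *ᵥ (A *ᵥ u)) ⬝ᵥ (Uᵀ *ᵥ (A *ᵥ u)) := by
  set c := Uᵀ *ᵥ (A *ᵥ u) with hc
  have h1 : (U *ᵥ c) ⬝ᵥ (A *ᵥ u) = c ⬝ᵥ c := by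
    rw [dotProduct_comm, Matrix.dotProduct_mulVec, ← Matrix.mulVec_transpose, ← hc]
  have h2 : u ⬝ᵥ (A *ᵥ (U *ᵥ c)) = c ⬝ᵥ c := by
    rw [Matrix.dotProduct_mulVec, ← Matrix.mulVec_transpose, hA, dotProduct_comm, h1]
  have h3 : (U *ᵥ c) ⬝ᵥ (A *ᵥ (U *ᵥ c)) = c ⬝ᵥ c := by
    rw [dotProduct_comm, Matrix.dotProduct_mulVec, ← Matrix.mulVec_transpose,
      Matrix.mulVec_mulVec, Matrix.mulVec_mulVec, hU, Matrix.one_mulVec]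
  rw [Matrix.mulVec_sub, sub_dotProduct, dotProduct_sub, dotProduct_sub, h1, h2, h3]
  ring

/-- If `∑ Λ_k a_k b_k` reaches a value above all of `Λ_k`, `k ≠ k₀`, and at least `Λ_{k₀}`, on
vectors of norm at most one, then `a = b = ± e_{k₀}`. -/
lemma eq_of_weighted_sum_maximal {ι : Type*} [Fintype ι] {Λ a b : ι → ℝ} {k₀ : ι} {ρ L : ℝ}
    (hΛ : ∀ k, 0 ≤ Λ k) (ha : a ⬝ᵥ a ≤ 1) (hb : b ⬝ᵥ b ≤ 1) (hρ : ρ = ∑ k, Λ k * a k * b k)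
    (hle : Λ k₀ ≤ ρ) (hL : ∀ k, k ≠ k₀ → Λ k ≤ L) (hL0 : 0 ≤ L) (hLρ : L < ρ) :
    a = b ∧ (∀ k, k ≠ k₀ → a k = 0) ∧ a k₀ ^ 2 = 1 ∧ ρ = Λ k₀ := by
  classical
  have split : ∀ f : ι → ℝ, ∑ k, f k = f k₀ + ∑ k ∈ Finset.univ.erase k₀, f k := fun f =>
    (Finset.add_sum_erase _ f (Finset.mem_univ k₀)).symm
  have rest : ∀ c : ι → ℝ, c ⬝ᵥ c ≤ 1 →
      ∑ k ∈ Finset.univ.erase k₀, c k ^ 2 ≤ 1 - c k₀ ^ 2 := by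
    intro c hc
    have := split fun k => c k ^ 2
    have h2 : c ⬝ᵥ c = ∑ k, c k ^ 2 := by simp [dotProduct, sq]
    linarith
  have ra := rest a ha
  have rb := rest b hb
  have nn : ∀ c : ι → ℝ, 0 ≤ ∑ k ∈ Finset.univ.erase k₀, c k ^ 2 := fun c =>
    Finset.sum_nonneg fun k _ => sq_nonneg _
  have hcross : ∑ k ∈ Finset.univ.erase k₀, Λ k * a k * b k ≤
      L * ((∑ k ∈ Finset.univ.erase k₀, a k ^ 2 + ∑ k ∈ Finset.univ.erase k₀, b k ^ 2) / 2) := by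
    rw [← Finset.sum_add_distrib, Finset.sum_div, Finset.mul_sum]
    refine Finset.sum_le_sum fun k hk => ?_
    have h1 := hL k (Finset.ne_of_mem_erase hk)
    have h2 : a k * b k ≤ (a k ^ 2 + b k ^ 2) / 2 := by linarith [two_mul_le_add_sq (a k) (b k)]
    calc Λ k * a k * b k = Λ k * (a k * b k) := by ring
      _ ≤ Λ k * ((a k ^ 2 + b k ^ 2) / 2) := mul_le_mul_of_nonneg_left h2 (hΛ k)
      _ ≤ _ := mul_le_mul_of_nonneg_right h1 (by positivity)
  have hsplit := split fun k => Λ k * a k * b k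
  rw [← hρ] at hsplit
  set A := (a k₀ ^ 2 + b k₀ ^ 2) / 2 with hA
  have hA0 : 0 ≤ A := by positivity
  have hab : Λ k₀ * a k₀ * b k₀ ≤ Λ k₀ * A := by
    rw [mul_assoc]
    exact mul_le_mul_of_nonneg_left (by linarith [two_mul_le_add_sq (a k₀) (b k₀)]) (hΛ k₀)
  -- `A` is the average mass of `a` and `b` on `k₀`, so `ρ` is at most a convex combination of `Λ
  -- k₀` and `L`. As `L < ρ` and `Λ k₀ ≤ ρ`, this forces `Λ k₀ > L` and then `A = 1`.
  have hub : ρ ≤ Λ k₀ * A + L * (1 - A) := by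
    have : L * ((∑ k ∈ Finset.univ.erase k₀, a k ^ 2 + ∑ k ∈ Finset.univ.erase k₀, b k ^ 2) / 2)
        ≤ L * (1 - A) := mul_le_mul_of_nonneg_left (by linarith) hL0
    linarith
  have hA1 : A ≤ 1 := by linarith [nn a, nn b]
  have hgap : 0 < Λ k₀ - L := by
    by_contra hcon
    nlinarith [mul_nonneg hA0 (sub_nonneg.2 (not_lt.1 hcon))]
  have hA2 : A = 1 := by
    refine le_antisymm hA1 ?_
    by_contra hcon
    nlinarith [mul_pos hgap (sub_pos.2 (not_le.1 hcon))]
  have ea : a k₀ ^ 2 = 1 := by linarith [nn a, nn b]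
  have eb : b k₀ ^ 2 = 1 := by linarith [nn a, nn b]
  have za : ∀ k, k ≠ k₀ → a k = 0 := fun k hk => by
    have h0 : ∑ k ∈ Finset.univ.erase k₀, a k ^ 2 = 0 := le_antisymm (by linarith) (nn a)
    have := (Finset.sum_eq_zero_iff_of_nonneg fun k _ => sq_nonneg (a k)).1 h0 k (by simp [hk])
    exact pow_eq_zero_iff (two_ne_zero) |>.1 this
  have zb : ∀ k, k ≠ k₀ → b k = 0 := fun k hk => by
    have h0 : ∑ k ∈ Finset.univ.erase k₀, b k ^ 2 = 0 := le_antisymm (by linarith) (nn b)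
    have := (Finset.sum_eq_zero_iff_of_nonneg fun k _ => sq_nonneg (b k)).1 h0 k (by simp [hk])
    exact pow_eq_zero_iff (two_ne_zero) |>.1 this
  have hr0 : ∑ k ∈ Finset.univ.erase k₀, Λ k * a k * b k = 0 :=
    Finset.sum_eq_zero fun k hk => by simp [za k (Finset.ne_of_mem_erase hk)]
  have hΛ0 : 0 < Λ k₀ := by linarith
  have hprod : 1 ≤ a k₀ * b k₀ := by
    by_contra hcon
    nlinarith [mul_pos hΛ0 (sub_pos.2 (not_le.1 hcon))]
  have heq : a k₀ = b k₀ := by nlinarith [sq_nonneg (a k₀ - b k₀)]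
  refine ⟨funext fun k => ?_, za, ea, ?_⟩
  · by_cases hk : k = k₀
    · rw [hk, heq]
    · rw [za k hk, zb k hk]
  · rw [hsplit, hr0, add_zero, mul_assoc, ← heq, ← sq, ea, mul_one]

lemma secondCorr_nonneg {r : ℕ} {Λ : Fin r → ℝ} (h : ∀ k, 0 < Λ k) : 0 ≤ secondCorr Λ := by
  unfold secondCorr
  split_ifs with h1
  · exact (h _).le
  · exact le_rfl

lemma le_secondCorr {r : ℕ} (hr : 1 ≤ r) {Λ : Fin r → ℝ} (h : Antitone Λ) (k : Fin r)
    (hk : k ≠ ⟨0, hr⟩) : Λ k ≤ secondCorr Λ := by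
  have h0 : (k : ℕ) ≠ 0 := fun h => hk (Fin.ext h)
  have h1 : 1 < r := by have := k.2; omega
  rw [secondCorr, dif_pos h1]
  exact h (Fin.le_def.2 (by simp; omega))

variable {p q r : ℕ} {S : CovBlocks p q}

lemma IsLeadingPair.rho0_eq {α₀ : Fin p → ℝ} {β₀ : Fin q → ℝ} (h : IsLeadingPair S α₀ β₀) :
    rho0 S = α₀ ⬝ᵥ (S.xy *ᵥ β₀) := by
  refine IsGreatest.csSup_eq ⟨⟨α₀, β₀, h.1, rfl⟩, ?_⟩
  rintro t ⟨α, β, hf, rfl⟩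
  exact h.2 α β hf

lemma IsCanonicalDecomposition.xy_mulVec {U : Matrix (Fin p) (Fin r) ℝ}
    {V : Matrix (Fin q) (Fin r) ℝ} {Λ : Fin r → ℝ} (h : IsCanonicalDecomposition S U V Λ)
    (v : Fin q → ℝ) :
    S.xy *ᵥ v = S.xx *ᵥ (U *ᵥ fun k => Λ k * (Vᵀ *ᵥ (S.yy *ᵥ v)) k) := by
  have : (fun k => Λ k * (Vᵀ *ᵥ (S.yy *ᵥ v)) k) = Matrix.diagonal Λ *ᵥ (Vᵀ *ᵥ (S.yy *ᵥ v)) := by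
    ext k; rw [Matrix.mulVec_diagonal]
  rw [this, h.decomposition]
  simp only [Matrix.mulVec_mulVec, Matrix.mul_assoc]

lemma IsCanonicalDecomposition.yx_mulVec {U : Matrix (Fin p) (Fin r) ℝ}
    {V : Matrix (Fin q) (Fin r) ℝ} {Λ : Fin r → ℝ} (h : IsCanonicalDecomposition S U V Λ)
    (hx : S.xxᵀ = S.xx) (hy : S.yyᵀ = S.yy) (v : Fin p → ℝ) :
    S.xyᵀ *ᵥ v = S.yy *ᵥ (V *ᵥ fun k => Λ k * (Uᵀ *ᵥ (S.xx *ᵥ v)) k) := by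
  have : (fun k => Λ k * (Uᵀ *ᵥ (S.xx *ᵥ v)) k) = Matrix.diagonal Λ *ᵥ (Uᵀ *ᵥ (S.xx *ᵥ v)) := by
    ext k; rw [Matrix.mulVec_diagonal]
  rw [this, h.decomposition]
  simp only [Matrix.transpose_mul, Matrix.mulVec_mulVec, Matrix.mul_assoc, hx, hy,
    Matrix.diagonal_transpose, Matrix.transpose_transpose]

lemma IsCanonicalDecomposition.dotProduct_xy {U : Matrix (Fin p) (Fin r) ℝ}
    {V : Matrix (Fin q) (Fin r) ℝ} {Λ : Fin r → ℝ} (h : IsCanonicalDecomposition S U V Λ)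
    (hx : S.xxᵀ = S.xx) (u : Fin p → ℝ) (v : Fin q → ℝ) :
    u ⬝ᵥ (S.xy *ᵥ v) = ∑ k, Λ k * (Uᵀ *ᵥ (S.xx *ᵥ u)) k * (Vᵀ *ᵥ (S.yy *ᵥ v)) k := by
  rw [h.xy_mulVec, Matrix.dotProduct_mulVec, ← Matrix.mulVec_transpose, hx,
    Matrix.dotProduct_mulVec, ← Matrix.mulVec_transpose, dotProduct]
  exact Finset.sum_congr rfl fun k _ => by ring

/-- What the assumptions on the population say about the first canonical directions and the
Hessian. -/
structure IsRegularPopulation (S : CovBlocks p q) (U : Matrix (Fin p) (Fin r) ℝ)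
    (V : Matrix (Fin q) (Fin r) ℝ) (α₀ : Fin p → ℝ) (β₀ : Fin q → ℝ) (ε₀ M : ℝ) : Prop where
  symX : S.xxᵀ = S.xx
  symY : S.yyᵀ = S.yy
  feasible : IsFeasible S α₀ β₀
  rho_gt : ε₀ < rho0 S
  rho_le : rho0 S ≤ 1
  supportX : ∀ i, U i = 0 → α₀ i = 0
  supportY : ∀ i, V i = 0 → β₀ i = 0
  eigenX : S.xy *ᵥ β₀ = rho0 S • (S.xx *ᵥ α₀)
  eigenY : S.xyᵀ *ᵥ α₀ = rho0 S • (S.yy *ᵥ β₀)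
  l2X : l2Norm α₀ ^ 2 ≤ M
  l2Y : l2Norm β₀ ^ 2 ≤ M
  mul_Phi0 : hessian0 S α₀ β₀ * Phi0 S α₀ β₀ = 1
  Phi0_symm : (Phi0 S α₀ β₀)ᵀ = Phi0 S α₀ β₀
  l2Phi0 : ∀ j, l2Norm (fun k => Phi0 S α₀ β₀ k j) ≤ M / (2 * ε₀)

/-- Reduces the Hessian to scalar forms, in which coercivity becomes an inequality between numbers;
`ρ₀ ≠ 0` lets the prefactor cancel the `ρ₀⁻¹` of the off-diagonal blocks. -/
lemma dotProduct_hessian0 (α₀ : Fin p → ℝ)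
    (β₀ : Fin q → ℝ) (hρ : rho0 S ≠ 0) (u u' : Fin p → ℝ) (v v' : Fin q → ℝ) :
    Sum.elim u v ⬝ᵥ (hessian0 S α₀ β₀ *ᵥ Sum.elim u' v') =
      2 * (rho0 S * (u ⬝ᵥ (S.xx *ᵥ u')
          + 2 * ((u ⬝ᵥ (S.xx *ᵥ α₀)) * (α₀ ⬝ᵥ (S.xx *ᵥ u')))) - u ⬝ᵥ (S.xy *ᵥ v'))
      + 2 * (rho0 S * (v ⬝ᵥ (S.yy *ᵥ v')
          + 2 * ((v ⬝ᵥ (S.yy *ᵥ β₀)) * (β₀ ⬝ᵥ (S.yy *ᵥ v')))) - v ⬝ᵥ (S.xyᵀ *ᵥ u')) := by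
  have key : ∀ {d : ℕ} (A : Matrix (Fin d) (Fin d) ℝ) (a w w' : Fin d → ℝ),
      w ⬝ᵥ ((A * Matrix.vecMulVec a a * A) *ᵥ w') = (w ⬝ᵥ (A *ᵥ a)) * (a ⬝ᵥ (A *ᵥ w')) := by
    intro d A a w w'
    rw [← Matrix.mulVec_mulVec, ← Matrix.mulVec_mulVec, Matrix.vecMulVec_mulVec]
    simp [Matrix.mulVec_smul, mul_comm]
  rw [hessian0, Matrix.smul_mulVec, dotProduct_smul, Matrix.fromBlocks_mulVec]
  simp only [Matrix.add_mulVec, Matrix.smul_mulVec, Matrix.neg_mulVec, Function.comp_def,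
    Sum.elim_inl, Sum.elim_inr, sumElim_dotProduct_sumElim, dotProduct_add, dotProduct_smul,
    dotProduct_neg, key, smul_eq_mul]
  field_simp
  ring

/-- In the coordinates `a = UᵀΣ_x α₀`, `b = VᵀΣ_y β₀` the criterion is `∑ Λ_k a_k b_k` under
Bessel's inequality, and the gap puts all the mass on the first coordinate. Equality in Bessel then
gives `α₀ = U a`, `β₀ = V b`, from which supports and eigen-equations follow. -/
theorem isRegularPopulation (hr : 1 ≤ r) {U : Matrix (Fin p) (Fin r) ℝ}
    {V : Matrix (Fin q) (Fin r) ℝ} {Λ : Fin r → ℝ} {α₀ : Fin p → ℝ} {β₀ : Fin q → ℝ} {ε₀ M : ℝ}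
    (hx : S.xxᵀ = S.xx) (hy : S.yyᵀ = S.yy) (hpsd : ∀ w, 0 ≤ bil S w w)
    (hUV : IsCanonicalDecomposition S U V Λ) (hαβ : IsLeadingPair S α₀ β₀)
    (hε₀ : 0 < ε₀) (hgap : ε₀ < rho0 S - secondCorr Λ) (hM : 0 < M)
    (hMx : EigenvaluesBounded S.xx M) (hMy : EigenvaluesBounded S.yy M) :
    IsRegularPopulation S U V α₀ β₀ ε₀ M := by
  have qx := fun u => (hMx.quadratic_bounds hx u).1
  have qy := fun u => (hMy.quadratic_bounds hy u).1
  have hMi : 0 < M⁻¹ := inv_pos.2 hM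
  have besselX : ∀ u, (Uᵀ *ᵥ (S.xx *ᵥ u)) ⬝ᵥ (Uᵀ *ᵥ (S.xx *ᵥ u)) ≤ u ⬝ᵥ (S.xx *ᵥ u) := fun u => by
    have h1 := projection_pythagoras hx hUV.orthU u
    have h2 := qx (u - U *ᵥ (Uᵀ *ᵥ (S.xx *ᵥ u)))
    have h3 := mul_nonneg hMi.le (dotProduct_self_nonneg (u - U *ᵥ (Uᵀ *ᵥ (S.xx *ᵥ u))))
    linarith
  have besselY : ∀ u, (Vᵀ *ᵥ (S.yy *ᵥ u)) ⬝ᵥ (Vᵀ *ᵥ (S.yy *ᵥ u)) ≤ u ⬝ᵥ (S.yy *ᵥ u) := fun u => by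
    have h1 := projection_pythagoras hy hUV.orthV u
    have h2 := qy (u - V *ᵥ (Vᵀ *ᵥ (S.yy *ᵥ u)))
    have h3 := mul_nonneg hMi.le (dotProduct_self_nonneg (u - V *ᵥ (Vᵀ *ᵥ (S.yy *ᵥ u))))
    linarith
  obtain ⟨fα, fβ⟩ := hαβ.1
  have hL0 := secondCorr_nonneg hUV.pos
  set k₀ : Fin r := ⟨0, hr⟩ with hk₀
  set a := Uᵀ *ᵥ (S.xx *ᵥ α₀) with ha
  set b := Vᵀ *ᵥ (S.yy *ᵥ β₀) with hb
  have ha1 : a ⬝ᵥ a ≤ 1 := fα ▸ besselX α₀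
  have hb1 : b ⬝ᵥ b ≤ 1 := fβ ▸ besselY β₀
  have hρ : rho0 S = ∑ k, Λ k * a k * b k := by rw [hαβ.rho0_eq, hUV.dotProduct_xy hx]
  -- The first columns of `U` and `V` form a feasible competitor with value `Λ k₀`.
  have hle : Λ k₀ ≤ rho0 S := by
    have e1 : ∀ {d : ℕ} (A : Matrix (Fin d) (Fin d) ℝ) (W : Matrix (Fin d) (Fin r) ℝ),
        Wᵀ * A * W = 1 → Wᵀ *ᵥ (A *ᵥ (W *ᵥ Pi.single k₀ 1)) = Pi.single k₀ 1 := by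
      intro d A W h
      rw [Matrix.mulVec_mulVec, Matrix.mulVec_mulVec, h, Matrix.one_mulVec]
    have e2 : ∀ {d : ℕ} (A : Matrix (Fin d) (Fin d) ℝ) (W : Matrix (Fin d) (Fin r) ℝ),
        Wᵀ * A * W = 1 → (W *ᵥ Pi.single k₀ 1) ⬝ᵥ (A *ᵥ (W *ᵥ Pi.single k₀ 1)) = 1 := by
      intro d A W h
      rw [dotProduct_comm, Matrix.dotProduct_mulVec, ← Matrix.mulVec_transpose, e1 A W h]
      simp
    have h1 := hαβ.2 (U *ᵥ Pi.single k₀ 1) (V *ᵥ Pi.single k₀ 1)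
      ⟨e2 _ _ hUV.orthU, e2 _ _ hUV.orthV⟩
    rw [← hαβ.rho0_eq, hUV.dotProduct_xy hx, e1 _ _ hUV.orthU, e1 _ _ hUV.orthV] at h1
    refine le_trans (le_of_eq ?_) h1
    rw [Finset.sum_eq_single k₀] <;> simp +contextual
  obtain ⟨hab, hzero, hone, hρΛ⟩ := eq_of_weighted_sum_maximal (fun k => (hUV.pos k).le) ha1 hb1 hρ
    hle (le_secondCorr hr hUV.antitone) hL0 (by linarith)
  have haa : a ⬝ᵥ a = 1 := by
    rw [dotProduct, Finset.sum_eq_single k₀, ← sq, hone]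
    · intro k _ hk; simp [hzero k hk]
    · simp
  have hα : α₀ = U *ᵥ a := by
    have h1 := projection_pythagoras hx hUV.orthU α₀
    rw [← ha, fα, haa, sub_self] at h1
    have h2 := qx (α₀ - U *ᵥ a)
    rw [h1] at h2
    have h3 : (α₀ - U *ᵥ a) ⬝ᵥ (α₀ - U *ᵥ a) = 0 :=
      le_antisymm (nonpos_of_mul_nonpos_right h2 hMi) (dotProduct_self_nonneg _)
    exact sub_eq_zero.1 (dotProduct_self_eq_zero.1 h3)
  have hβ : β₀ = V *ᵥ b := by
    have h1 := projection_pythagoras hy hUV.orthV β₀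
    rw [← hb, fβ, ← hab, haa, sub_self] at h1
    have h2 := qy (β₀ - V *ᵥ a)
    rw [h1] at h2
    have h3 : (β₀ - V *ᵥ a) ⬝ᵥ (β₀ - V *ᵥ a) = 0 :=
      le_antisymm (nonpos_of_mul_nonpos_right h2 hMi) (dotProduct_self_nonneg _)
    rw [← hab]
    exact sub_eq_zero.1 (dotProduct_self_eq_zero.1 h3)
  have hΛa : (fun k => Λ k * a k) = rho0 S • a := by
    ext k
    by_cases hk : k = k₀
    · simp [hk, hρΛ]
    · simp [hzero k hk]
  have heX : S.xy *ᵥ β₀ = rho0 S • (S.xx *ᵥ α₀) := by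
    rw [hUV.xy_mulVec, ← hb, ← hab, hΛa, Matrix.mulVec_smul, Matrix.mulVec_smul, ← hα]
  have heY : S.xyᵀ *ᵥ α₀ = rho0 S • (S.yy *ᵥ β₀) := by
    rw [hUV.yx_mulVec hx hy, ← ha, hΛa, Matrix.mulVec_smul, Matrix.mulVec_smul, hab, ← hβ]
  have hρ0 : 0 < rho0 S := by linarith
  -- The cross term is at most `Λ₂` times the quadratic forms, except in the leading coordinates `c
  -- k₀`, `d k₀`, where it exceeds this by the factor `ρ₀ - Λ₂`. The rank-one terms of `H⁰` see
  -- exactly these coordinates and absorb the excess, leaving `2(ρ₀ - Λ₂)` times the quadratic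
  -- forms.
  have hcoer : ∀ w, 2 * ε₀ * M⁻¹ * (w ⬝ᵥ w) ≤ w ⬝ᵥ (hessian0 S α₀ β₀ *ᵥ w) := by
    intro w
    obtain ⟨u, v, rfl⟩ : ∃ u v, w = Sum.elim u v := ⟨_, _, (Sum.elim_comp_inl_inr w).symm⟩
    rw [dotProduct_hessian0 α₀ β₀ hρ0.ne', sumElim_dotProduct_sumElim]
    set c := Uᵀ *ᵥ (S.xx *ᵥ u) with hc
    set d := Vᵀ *ᵥ (S.yy *ᵥ v) with hd
    have h1 : α₀ ⬝ᵥ (S.xx *ᵥ u) = a k₀ * c k₀ := by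
      rw [hα, dotProduct_comm, Matrix.dotProduct_mulVec, ← Matrix.mulVec_transpose, ← hc,
        dotProduct, Finset.sum_eq_single k₀, mul_comm]
      · intro k _ hk; simp [hzero k hk]
      · simp
    have h1' : u ⬝ᵥ (S.xx *ᵥ α₀) = α₀ ⬝ᵥ (S.xx *ᵥ u) := by
      rw [Matrix.dotProduct_mulVec, ← Matrix.mulVec_transpose, hx, dotProduct_comm]
    have h2 : β₀ ⬝ᵥ (S.yy *ᵥ v) = b k₀ * d k₀ := by
      rw [hβ, dotProduct_comm, Matrix.dotProduct_mulVec, ← Matrix.mulVec_transpose, ← hd,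
        dotProduct, Finset.sum_eq_single k₀, mul_comm]
      · intro k _ hk; simp [← hab, hzero k hk]
      · simp
    have h2' : v ⬝ᵥ (S.yy *ᵥ β₀) = β₀ ⬝ᵥ (S.yy *ᵥ v) := by
      rw [Matrix.dotProduct_mulVec, ← Matrix.mulVec_transpose, hy, dotProduct_comm]
    have h3 : v ⬝ᵥ (S.xyᵀ *ᵥ u) = u ⬝ᵥ (S.xy *ᵥ v) := by
      rw [Matrix.dotProduct_mulVec, ← Matrix.mulVec_transpose, Matrix.transpose_transpose,
        dotProduct_comm]
    have h4 : 2 * (u ⬝ᵥ (S.xy *ᵥ v)) ≤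
        secondCorr Λ * (c ⬝ᵥ c + d ⬝ᵥ d)
          + (rho0 S - secondCorr Λ) * (c k₀ ^ 2 + d k₀ ^ 2) := by
      have e : (rho0 S - secondCorr Λ) * (c k₀ ^ 2 + d k₀ ^ 2) =
          ∑ k, if k = k₀ then (rho0 S - secondCorr Λ) * (c k ^ 2 + d k ^ 2) else 0 := by
        simp
      rw [hUV.dotProduct_xy hx, ← hc, ← hd, e, dotProduct, dotProduct, ← Finset.sum_add_distrib,
        Finset.mul_sum, Finset.mul_sum, ← Finset.sum_add_distrib]
      refine Finset.sum_le_sum fun k _ => ?_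
      have h5 : 2 * (Λ k * c k * d k) ≤ Λ k * (c k ^ 2 + d k ^ 2) := by
        have := mul_le_mul_of_nonneg_left (two_mul_le_add_sq (c k) (d k)) (hUV.pos k).le
        linarith
      split_ifs with hk
      · rw [hk, ← hρΛ] at h5
        rw [hk, ← hρΛ]
        linarith
      · have := mul_le_mul_of_nonneg_right (le_secondCorr hr hUV.antitone k hk)
          (add_nonneg (sq_nonneg (c k)) (sq_nonneg (d k)))
        linarith
    have h6 := besselX u
    have h7 := besselY v
    rw [← hc] at h6
    rw [← hd] at h7
    have h8 : secondCorr Λ * (c ⬝ᵥ c + d ⬝ᵥ d)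
        ≤ secondCorr Λ * (u ⬝ᵥ (S.xx *ᵥ u) + v ⬝ᵥ (S.yy *ᵥ v)) :=
      mul_le_mul_of_nonneg_left (by linarith) hL0
    have h9 : 0 ≤ (rho0 S + secondCorr Λ) * (c k₀ ^ 2 + d k₀ ^ 2) := by positivity
    have h10 := qx u
    have h11 := qy v
    have h12 : 0 ≤ M⁻¹ * (u ⬝ᵥ u + v ⬝ᵥ v) :=
      mul_nonneg hMi.le (add_nonneg (dotProduct_self_nonneg _) (dotProduct_self_nonneg _))
    have h13 : ε₀ * (M⁻¹ * (u ⬝ᵥ u + v ⬝ᵥ v)) ≤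
        (rho0 S - secondCorr Λ) * (u ⬝ᵥ (S.xx *ᵥ u) + v ⬝ᵥ (S.yy *ᵥ v)) :=
      mul_le_mul hgap.le (by linarith) h12 (by linarith)
    rw [h1', h2', h1, h2, h3]
    have e1 : a k₀ * c k₀ * (a k₀ * c k₀) = c k₀ ^ 2 := by
      calc _ = a k₀ ^ 2 * c k₀ ^ 2 := by ring
        _ = _ := by rw [hone, one_mul]
    have e2 : b k₀ * d k₀ * (b k₀ * d k₀) = d k₀ ^ 2 := by
      calc _ = b k₀ ^ 2 * d k₀ ^ 2 := by ring
        _ = _ := by rw [← hab, hone, one_mul]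
    rw [e1, e2]
    linarith
  have hcpos : 0 < 2 * ε₀ * M⁻¹ := by positivity
  have hunit : IsUnit (hessian0 S α₀ β₀) := by
    rw [← Matrix.mulVec_injective_iff_isUnit]
    refine (injective_iff_map_eq_zero (Matrix.mulVecLin (hessian0 S α₀ β₀))).2 fun w hw => ?_
    have h1 := hcoer w
    rw [Matrix.mulVecLin_apply] at hw
    rw [hw, dotProduct_zero] at h1
    exact dotProduct_self_eq_zero.1 (le_antisymm (nonpos_of_mul_nonpos_right h1 hcpos)
      (dotProduct_self_nonneg _))
  have hinv : hessian0 S α₀ β₀ * Phi0 S α₀ β₀ = 1 :=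
    Matrix.mul_nonsing_inv _ ((Matrix.isUnit_iff_isUnit_det _).1 hunit)
  refine ⟨hx, hy, hαβ.1, by linarith, ?_, ?_, ?_, heX, heY, ?_, ?_, hinv, ?_, ?_⟩
  -- The variance of `α₀ᵀX - β₀ᵀY` is `2 - 2ρ₀`, which gives `ρ₀ ≤ 1`.
  · have h1 := hpsd (inX q α₀ - inY p β₀)
    simp only [map_sub, LinearMap.sub_apply, bil_inX_inX, bil_inX_inY, bil_inY_inX,
      bil_inY_inY, fα, fβ, heX, heY, dotProduct_smul, smul_eq_mul, mul_one] at h1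
    linarith
  · intro i hi
    rw [hα, Matrix.mulVec, hi]
    exact zero_dotProduct _
  · intro i hi
    rw [hβ, Matrix.mulVec, hi]
    exact zero_dotProduct _
  · have h1 := qx α₀
    rw [fα, ← l2Norm_sq] at h1
    rwa [inv_mul_le_iff₀ hM, mul_one] at h1
  · have h1 := qy β₀
    rw [fβ, ← l2Norm_sq] at h1
    rwa [inv_mul_le_iff₀ hM, mul_one] at h1
  · rw [Phi0, Matrix.transpose_nonsing_inv]
    congr 1
    rw [hessian0, Matrix.transpose_smul, Matrix.fromBlocks_transpose]
    simp only [Matrix.transpose_add, Matrix.transpose_smul, Matrix.transpose_mul,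
      Matrix.transpose_neg, Matrix.transpose_transpose, hx, hy, Matrix.transpose_vecMulVec,
      Matrix.mul_assoc]
  · intro j
    set φ : Fin p ⊕ Fin q → ℝ := fun k => Phi0 S α₀ β₀ k j with hφ
    have h1 : hessian0 S α₀ β₀ *ᵥ φ = Pi.single j 1 := by
      have : φ = Phi0 S α₀ β₀ *ᵥ Pi.single j 1 := by ext k; simp [hφ]
      rw [this, Matrix.mulVec_mulVec, hinv, Matrix.one_mulVec]
    -- Since `H⁰φ = e_j`, coercivity bounds `‖φ‖₂²` by a multiple of `φ_j ≤ ‖φ‖₂`; one factor then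
    -- cancels.
    have h2 := hcoer φ
    rw [h1, ← l2Norm_sq] at h2
    have h3 : φ ⬝ᵥ Pi.single j 1 ≤ l2Norm φ := by
      rw [dotProduct_single, mul_one]
      exact (le_abs_self _).trans (abs_le_l2Norm φ j)
    rcases (l2Norm_nonneg φ).eq_or_lt with h0 | h0
    · rw [← h0]; positivity
    · have h4 : 2 * ε₀ * M⁻¹ * l2Norm φ ≤ 1 := by
        refine le_of_mul_le_mul_right ?_ h0
        linarith
      rw [le_div_iff₀ (by positivity)]
      calc l2Norm φ * (2 * ε₀) = M * (2 * ε₀ * M⁻¹ * l2Norm φ) := by field_simp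
        _ ≤ M * 1 := mul_le_mul_of_nonneg_left h4 hM.le
        _ = M := mul_one M

end Population

/-! ### Products of sub-Gaussian variables and Bernstein's inequality. -/

section SubGaussian
variable {Ω : Type*} [MeasurableSpace Ω] {μ : Measure Ω}

lemma hasSubgaussianMGF_mono {X : Ω → ℝ} {c c' : ℝ≥0} (h : HasSubgaussianMGF X c μ)
    (hc : c ≤ c') : HasSubgaussianMGF X c' μ where
  integrable_exp_mul := h.integrable_exp_mul
  mgf_le t := (h.mgf_le t).trans <| Real.exp_le_exp.2 <| by
    have : (c : ℝ) ≤ c' := hc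
    gcongr

/-- The exact value is `√2`. It is the Gaussian end of the linearization of `exp(X²/(4c))` used for
general sub-Gaussian `X`. -/
lemma lintegral_exp_sq_div_four_gaussian :
    ∫⁻ g, ENNReal.ofReal (Real.exp (g ^ 2 / 4)) ∂(gaussianReal 0 1) ≤ 2 := by
  rw [gaussianReal_of_var_ne_zero _ one_ne_zero,
    lintegral_withDensity_eq_lintegral_mul _ (measurable_gaussianPDF _ _) (by fun_prop)]
  have h : ∀ g : ℝ, (gaussianPDF 0 1 * fun g => ENNReal.ofReal (Real.exp (g ^ 2 / 4))) g =
      ENNReal.ofReal ((√(2 * Real.pi))⁻¹ * Real.exp (-(1 / 4) * g ^ 2)) := by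
    intro g
    rw [Pi.mul_apply, gaussianPDF, ← ENNReal.ofReal_mul (gaussianPDFReal_nonneg _ _ _),
      gaussianPDFReal, mul_assoc, ← Real.exp_add]
    congr 2
    · simp
    · congr 1
      simp
      ring
  simp_rw [h]
  rw [← ofReal_integral_eq_lintegral_ofReal]
  · rw [integral_const_mul, integral_gaussian]
    rw [show (2 : ℝ≥0∞) = ENNReal.ofReal 2 by simp]
    refine ENNReal.ofReal_le_ofReal ?_
    rw [← Real.sqrt_inv, ← Real.sqrt_mul (by positivity)]
    refine Real.sqrt_le_iff.2 ⟨by norm_num, ?_⟩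
    have := Real.pi_pos
    field_simp
    norm_num
  · exact (integrable_exp_neg_mul_sq (by norm_num)).const_mul _
  · exact ae_of_all _ fun g => by positivity

/-- The square of a sub-Gaussian variable has an exponential moment. -/
lemma lintegral_exp_sq_le {X : Ω → ℝ} {c : ℝ≥0} [SFinite μ] (hX : HasSubgaussianMGF X c μ)
    (hm : Measurable X) (hc : 0 < c) :
    ∫⁻ ω, ENNReal.ofReal (Real.exp (X ω ^ 2 / (4 * c))) ∂μ ≤ 2 := by
  have hc' : (0 : ℝ) < c := hc
  -- Chosen so that averaging `exp(s X g)` over a standard Gaussian `g` gives `exp(X²/(4c))`. After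
  -- Tonelli, the sub-Gaussian bound at `s g` gives `exp(c s² g²/2) = exp(g²/4)`.
  set s : ℝ := (√(2 * c))⁻¹ with hs
  have hs2 : s ^ 2 = 1 / (2 * c) := by
    rw [hs, inv_pow, Real.sq_sqrt (by positivity), one_div]
  have h1 : ∀ ω, ENNReal.ofReal (Real.exp (X ω ^ 2 / (4 * c))) =
      ∫⁻ g, ENNReal.ofReal (Real.exp (s * X ω * g)) ∂(gaussianReal 0 1) := by
    intro ω
    have h2 : ∫ g, Real.exp (s * X ω * g) ∂(gaussianReal 0 1) =
        Real.exp (X ω ^ 2 / (4 * c)) := by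
      have := congrFun (mgf_fun_id_gaussianReal (μ := 0) (v := 1)) (s * X ω)
      rw [mgf] at this
      rw [this]
      congr 1
      simp only [zero_mul, NNReal.coe_one, one_mul, zero_add, mul_pow, hs2]
      field_simp
      ring
    rw [← h2, ofReal_integral_eq_lintegral_ofReal (integrable_exp_mul_gaussianReal _)
      (ae_of_all _ fun g => (Real.exp_pos _).le)]
  simp_rw [h1]
  rw [lintegral_lintegral_swap (by fun_prop)]
  refine le_trans (lintegral_mono fun g => ?_) lintegral_exp_sq_div_four_gaussian
  have h3 : ∀ ω, s * X ω * g = (s * g) * X ω := fun ω => by ring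
  simp_rw [h3]
  rw [← ofReal_integral_eq_lintegral_ofReal (hX.integrable_exp_mul _)
    (ae_of_all _ fun g => (Real.exp_pos _).le)]
  refine ENNReal.ofReal_le_ofReal ((hX.mgf_le _).trans (Real.exp_le_exp.2 (le_of_eq ?_)))
  rw [mul_pow, hs2]
  field_simp
  ring

/-- The product of two sub-Gaussian variables is sub-exponential. -/
lemma integrable_exp_abs_mul {X Y : Ω → ℝ} {c : ℝ≥0} [SFinite μ] (hX : HasSubgaussianMGF X c μ)
    (hY : HasSubgaussianMGF Y c μ) (hmX : Measurable X) (hmY : Measurable Y) (hc : 0 < c) :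
    Integrable (fun ω => Real.exp ((4 * (c : ℝ))⁻¹ * |X ω * Y ω|)) μ ∧
      ∫ ω, Real.exp ((4 * (c : ℝ))⁻¹ * |X ω * Y ω|) ∂μ ≤ 2 := by
  have hc' : (0 : ℝ) < c := hc
  have hle : ∫⁻ ω, ENNReal.ofReal (Real.exp ((4 * (c : ℝ))⁻¹ * |X ω * Y ω|)) ∂μ ≤ 2 := by
    have h1 : ∀ ω, ENNReal.ofReal (Real.exp ((4 * (c : ℝ))⁻¹ * |X ω * Y ω|)) ≤
        2⁻¹ * (ENNReal.ofReal (Real.exp (X ω ^ 2 / (4 * c))) +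
          ENNReal.ofReal (Real.exp (Y ω ^ 2 / (4 * c)))) := by
      intro ω
      rw [← ENNReal.ofReal_add (Real.exp_pos _).le (Real.exp_pos _).le,
        show (2⁻¹ : ℝ≥0∞) = ENNReal.ofReal (2⁻¹) by
          rw [ENNReal.ofReal_inv_of_pos two_pos]; simp,
        ← ENNReal.ofReal_mul (by norm_num)]
      refine ENNReal.ofReal_le_ofReal ?_
      -- The inequality `2|XY| ≤ X² + Y²` bounds the exponential by `x y`, and `2xy ≤ x² + y²`
      -- separates the two variables.
      set x := Real.exp (X ω ^ 2 / (8 * c))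
      set y := Real.exp (Y ω ^ 2 / (8 * c))
      have hx : Real.exp (X ω ^ 2 / (4 * c)) = x ^ 2 := by
        rw [← Real.exp_nat_mul]; congr 1; push_cast; field_simp; ring
      have hy : Real.exp (Y ω ^ 2 / (4 * c)) = y ^ 2 := by
        rw [← Real.exp_nat_mul]; congr 1; push_cast; field_simp; ring
      have hxy : Real.exp ((4 * (c : ℝ))⁻¹ * |X ω * Y ω|) ≤ x * y := by
        rw [← Real.exp_add]
        refine Real.exp_le_exp.2 ?_
        have h2 : |X ω * Y ω| ≤ (X ω ^ 2 + Y ω ^ 2) / 2 := by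
          rw [abs_mul, ← sq_abs (X ω), ← sq_abs (Y ω)]
          linarith [two_mul_le_add_sq |X ω| |Y ω|]
        calc (4 * (c : ℝ))⁻¹ * |X ω * Y ω| ≤ (4 * (c : ℝ))⁻¹ * ((X ω ^ 2 + Y ω ^ 2) / 2) :=
              mul_le_mul_of_nonneg_left h2 (by positivity)
          _ = _ := by field_simp; ring
      rw [hx, hy]
      linarith [two_mul_le_add_sq x y]
    calc _ ≤ ∫⁻ ω, 2⁻¹ * (ENNReal.ofReal (Real.exp (X ω ^ 2 / (4 * c))) +
          ENNReal.ofReal (Real.exp (Y ω ^ 2 / (4 * c)))) ∂μ := lintegral_mono h1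
      _ = 2⁻¹ * (∫⁻ ω, ENNReal.ofReal (Real.exp (X ω ^ 2 / (4 * c))) ∂μ +
          ∫⁻ ω, ENNReal.ofReal (Real.exp (Y ω ^ 2 / (4 * c))) ∂μ) := by
        rw [lintegral_const_mul _ (by fun_prop), lintegral_add_left (by fun_prop)]
      _ ≤ 2⁻¹ * (2 + 2) := by
        gcongr
        · exact lintegral_exp_sq_le hX hmX hc
        · exact lintegral_exp_sq_le hY hmY hc
      _ = 2 := by
        rw [← two_mul, ← mul_assoc, ENNReal.inv_mul_cancel (by simp) (by simp), one_mul]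
  have hmeas : Measurable fun ω => Real.exp ((4 * (c : ℝ))⁻¹ * |X ω * Y ω|) := by fun_prop
  refine ⟨⟨hmeas.aestronglyMeasurable, ?_⟩, ?_⟩
  · rw [hasFiniteIntegral_iff_ofReal (ae_of_all _ fun ω => (Real.exp_pos _).le)]
    exact hle.trans_lt (by simp)
  · rw [integral_eq_lintegral_of_nonneg_ae (ae_of_all _ fun ω => (Real.exp_pos _).le)
      hmeas.aestronglyMeasurable]
    exact ENNReal.toReal_le_of_le_ofReal (by norm_num) (by simpa using hle)

/-- The linear term is kept exactly, so integration produces the mean and a quadratic error; the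
bound is the Taylor remainder of the complex exponential on the real line. -/
lemma exp_le_one_add_add_sq_mul_exp (x : ℝ) : Real.exp x ≤ 1 + x + x ^ 2 * Real.exp |x| := by
  have h := Complex.norm_exp_sub_sum_le_norm_mul_exp (x : ℂ) 2
  simp only [Finset.sum_range_succ, Finset.sum_range_zero, pow_zero, pow_one, Nat.factorial,
    Nat.cast_one, div_one, zero_add, Nat.mul_one, Complex.norm_real, Real.norm_eq_abs] at h
  have h2 : Complex.exp x - (1 + (x : ℂ)) = ((Real.exp x - (1 + x) : ℝ) : ℂ) := by push_cast; rfl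
  rw [h2, Complex.norm_real, Real.norm_eq_abs, sq_abs] at h
  linarith [le_abs_self (Real.exp x - (1 + x))]

/-- The Bernstein bound on the moment generating function of a sub-exponential variable. -/
lemma mgf_le_of_subexponential [IsProbabilityMeasure μ] {W : Ω → ℝ} {τ t : ℝ} (hτ : 0 < τ)
    (hW : Measurable W) (hint : Integrable (fun ω => Real.exp (τ * |W ω|)) μ)
    (hle : ∫ ω, Real.exp (τ * |W ω|) ∂μ ≤ 2) (ht : |t| ≤ τ / 2) :
    Integrable W μ ∧ Integrable (fun ω => Real.exp (t * W ω)) μ ∧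
      mgf W μ t ≤ Real.exp (t * ∫ ω, W ω ∂μ + 16 / τ ^ 2 * t ^ 2) := by
  have hWint : Integrable W μ := by
    refine (hint.const_mul τ⁻¹).mono' hW.aestronglyMeasurable (ae_of_all _ fun ω => ?_)
    rw [Real.norm_eq_abs]
    have := Real.add_one_le_exp (τ * |W ω|)
    calc |W ω| = τ⁻¹ * (τ * |W ω|) := by field_simp
      _ ≤ _ := mul_le_mul_of_nonneg_left (by linarith) (by positivity)
  have hexp : Integrable (fun ω => Real.exp (t * W ω)) μ := by
    refine hint.mono' (by fun_prop) (ae_of_all _ fun ω => ?_)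
    rw [Real.norm_eq_abs, abs_of_pos (Real.exp_pos _)]
    refine Real.exp_le_exp.2 ((le_abs_self _).trans ?_)
    rw [abs_mul]
    exact mul_le_mul_of_nonneg_right (by linarith) (abs_nonneg _)
  refine ⟨hWint, hexp, ?_⟩
  -- Half of `exp(τ|W|)` pays for `W²`, through `y²/2 ≤ exp y`, and the other half for `exp|tW|`;
  -- hence the condition `|t| ≤ τ/2`. Integration doubles the constant `8`.
  have hpt : ∀ ω, Real.exp (t * W ω) ≤
      1 + t * W ω + 8 / τ ^ 2 * t ^ 2 * Real.exp (τ * |W ω|) := by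
    intro ω
    refine (exp_le_one_add_add_sq_mul_exp _).trans ?_
    refine add_le_add_right ?_ _
    have h1 : (τ / 2 * |W ω|) ^ 2 / 2 ≤ Real.exp (τ / 2 * |W ω|) := by
      have := Real.quadratic_le_exp_of_nonneg (x := τ / 2 * |W ω|) (by positivity)
      have h0 : 0 ≤ τ / 2 * |W ω| := by positivity
      linarith
    have h2 : Real.exp |t * W ω| ≤ Real.exp (τ / 2 * |W ω|) := by
      rw [abs_mul]
      exact Real.exp_le_exp.2 (mul_le_mul_of_nonneg_right ht (abs_nonneg _))
    have h3 : W ω ^ 2 ≤ 8 / τ ^ 2 * Real.exp (τ / 2 * |W ω|) := by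
      have : W ω ^ 2 = 8 / τ ^ 2 * ((τ / 2 * |W ω|) ^ 2 / 2) := by
        rw [mul_pow, sq_abs]; field_simp; norm_num
      rw [this]
      exact mul_le_mul_of_nonneg_left h1 (by positivity)
    calc (t * W ω) ^ 2 * Real.exp |t * W ω|
        = t ^ 2 * (W ω ^ 2 * Real.exp |t * W ω|) := by ring
      _ ≤ t ^ 2 * ((8 / τ ^ 2 * Real.exp (τ / 2 * |W ω|)) * Real.exp (τ / 2 * |W ω|)) := by
        gcongr
      _ = 8 / τ ^ 2 * t ^ 2 * (Real.exp (τ / 2 * |W ω|) * Real.exp (τ / 2 * |W ω|)) := by ring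
      _ = _ := by rw [← Real.exp_add]; congr 2; ring
  have i1 : Integrable (fun ω => 1 + t * W ω) μ := (integrable_const 1).add (hWint.const_mul t)
  calc mgf W μ t ≤ ∫ ω, (1 + t * W ω + 8 / τ ^ 2 * t ^ 2 * Real.exp (τ * |W ω|)) ∂μ :=
        integral_mono hexp (i1.add (hint.const_mul _)) hpt
    _ = 1 + t * ∫ ω, W ω ∂μ + 8 / τ ^ 2 * t ^ 2 * ∫ ω, Real.exp (τ * |W ω|) ∂μ := by
      rw [integral_add i1 (hint.const_mul _), integral_add (integrable_const 1)
        (hWint.const_mul t), integral_const_mul, integral_const_mul]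
      simp
    _ ≤ 1 + t * ∫ ω, W ω ∂μ + 8 / τ ^ 2 * t ^ 2 * 2 := by gcongr
    _ = (t * ∫ ω, W ω ∂μ + 16 / τ ^ 2 * t ^ 2) + 1 := by ring
    _ ≤ _ := Real.add_one_le_exp _

/-- One-sided Bernstein inequality for sample means of a sub-exponential statistic. -/
lemma measureReal_mean_ge_le {E : Type*} [MeasurableSpace E] {ν : Measure E}
    [IsProbabilityMeasure ν] [IsProbabilityMeasure μ] {n : ℕ} {Z : Fin n → Ω → E}
    (hZ : IsIIDSample μ ν Z) {W : E → ℝ} {τ t x : ℝ} (hτ : 0 < τ) (hW : Measurable W)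
    (hint : Integrable (fun e => Real.exp (τ * |W e|)) ν)
    (hle : ∫ e, Real.exp (τ * |W e|) ∂ν ≤ 2) (ht : |t| ≤ τ / 2) :
    μ.real {ω | n * x ≤ t * (∑ i, W (Z i ω) - n * ∫ e, W e ∂ν)} ≤
      Real.exp (-(n * x) + n * (16 / τ ^ 2 * t ^ 2)) := by
  obtain ⟨hWi, hei, hmgf⟩ := mgf_le_of_subexponential hτ hW hint hle ht
  have hind : iIndepFun (fun i ω => W (Z i ω)) μ := hZ.indep.comp (fun _ => W) fun _ => hW
  have hmeas : ∀ i, Measurable fun ω => W (Z i ω) := fun i => hW.comp (hZ.measurable i)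
  have hmap : ∀ i, mgf (fun ω => W (Z i ω)) μ t = mgf W ν t := fun i => by
    rw [← hZ.law i, mgf_map (hZ.measurable i).aemeasurable]
    · rfl
    · rw [hZ.law i]; exact hei.aestronglyMeasurable
  have hsum : mgf (∑ i, fun ω => W (Z i ω)) μ t = mgf W ν t ^ n := by
    rw [hind.mgf_sum hmeas]
    simp [hmap]
  have hinti : ∀ i ∈ Finset.univ, Integrable (fun ω => Real.exp (t * W (Z i ω))) μ := fun i _ => by
    have : Integrable (fun e => Real.exp (t * W e)) (μ.map (Z i)) := by rwa [hZ.law i]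
    exact this.comp_measurable (hZ.measurable i)
  have hIs := hind.integrable_exp_mul_sum hmeas hinti
  set m := ∫ e, W e ∂ν
  have hset : {ω | n * x ≤ t * (∑ i, W (Z i ω) - n * m)} =
      {ω | n * x + t * (n * m) ≤ (fun ω => t * (∑ i, fun ω => W (Z i ω)) ω) ω} := by
    ext ω
    simp only [Set.mem_ofPred_eq, Finset.sum_apply, mul_sub, le_sub_iff_add_le]
  rw [hset]
  -- Chernoff with parameter `1`: the factor `t`, of either sign, already sits inside the variable,
  -- so one bound serves both tails.
  have hch := measure_ge_le_exp_mul_mgf (μ := μ)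
    (X := fun ω => t * (∑ i, fun ω => W (Z i ω)) ω) (t := 1) (n * x + t * (n * m)) zero_le_one
    (by simpa using hIs)
  refine hch.trans ?_
  rw [mgf_const_mul, mul_one, hsum]
  calc Real.exp (-1 * (n * x + t * (n * m))) * mgf W ν t ^ n
      ≤ Real.exp (-1 * (n * x + t * (n * m))) * Real.exp (t * m + 16 / τ ^ 2 * t ^ 2) ^ n := by
        gcongr
        exact mgf_nonneg
    _ = _ := by
      rw [← Real.exp_nat_mul, ← Real.exp_add]
      congr 1
      ring

/-- Two-sided Bernstein inequality for sample means of a sub-exponential statistic, in the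
Gaussian range of deviations. -/
lemma measure_abs_mean_sub_gt_le {E : Type*} [MeasurableSpace E] {ν : Measure E}
    [IsProbabilityMeasure ν] [IsProbabilityMeasure μ] {n : ℕ} {Z : Fin n → Ω → E}
    (hZ : IsIIDSample μ ν Z) {W : E → ℝ} {τ x : ℝ} (hτ : 0 < τ) (hW : Measurable W)
    (hint : Integrable (fun e => Real.exp (τ * |W e|)) ν)
    (hle : ∫ e, Real.exp (τ * |W e|) ∂ν ≤ 2) (hn : 0 < n) (hx : 0 ≤ x) (hxτ : x ≤ 16 / τ) :
    μ {ω | x < |(n : ℝ)⁻¹ * ∑ i, W (Z i ω) - ∫ e, W e ∂ν|} ≤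
      ENNReal.ofReal (2 * Real.exp (-(n * (τ ^ 2 * x ^ 2 / 64)))) := by
  have hn' : (0 : ℝ) < n := Nat.cast_pos.2 hn
  -- The minimizer of `-t x + 16 t²/τ²`, with value `-τ² x²/64`; the restriction `x ≤ 16/τ` is `t ≤
  -- τ/2`.
  set t := τ ^ 2 * x / 32 with ht
  have ht0 : 0 ≤ t := by positivity
  have htle : t ≤ τ / 2 := by
    calc t ≤ τ ^ 2 * (16 / τ) / 32 := by rw [ht]; gcongr
      _ = τ / 2 := by field_simp; norm_num
  have h1 := measureReal_mean_ge_le hZ (x := t * x) hτ hW hint hle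
    (t := t) (by rwa [abs_of_nonneg ht0])
  have h2 := measureReal_mean_ge_le hZ (x := t * x) hτ hW hint hle
    (t := -t) (by rwa [abs_neg, abs_of_nonneg ht0])
  have he : -((n : ℝ) * (t * x)) + n * (16 / τ ^ 2 * t ^ 2) = -(n * (τ ^ 2 * x ^ 2 / 64)) := by
    rw [ht]; field_simp; ring
  rw [neg_sq, he] at h2
  rw [he] at h1
  have hsub : {ω | x < |(n : ℝ)⁻¹ * ∑ i, W (Z i ω) - ∫ e, W e ∂ν|} ⊆
      {ω | n * (t * x) ≤ t * (∑ i, W (Z i ω) - n * ∫ e, W e ∂ν)} ∪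
      {ω | n * (t * x) ≤ -t * (∑ i, W (Z i ω) - n * ∫ e, W e ∂ν)} := by
    intro ω hω
    simp only [Set.mem_ofPred_eq, Set.mem_union] at hω ⊢
    set A := ∑ i, W (Z i ω) - n * ∫ e, W e ∂ν with hA
    have hdiv : (n : ℝ)⁻¹ * ∑ i, W (Z i ω) - ∫ e, W e ∂ν = (n : ℝ)⁻¹ * A := by
      rw [hA]; field_simp
    rw [hdiv, abs_mul, abs_of_pos (inv_pos.2 hn'), lt_inv_mul_iff₀ hn'] at hω
    rcases le_total 0 A with h | h
    · left
      rw [abs_of_nonneg h] at hω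
      calc (n : ℝ) * (t * x) = t * (n * x) := by ring
        _ ≤ t * A := mul_le_mul_of_nonneg_left hω.le ht0
    · right
      rw [abs_of_nonpos h] at hω
      calc (n : ℝ) * (t * x) = t * (n * x) := by ring
        _ ≤ t * (-A) := mul_le_mul_of_nonneg_left hω.le ht0
        _ = -t * A := by ring
  rw [two_mul, ENNReal.ofReal_add (Real.exp_pos _).le (Real.exp_pos _).le]
  refine (measure_mono hsub).trans ((measure_union_le _ _).trans (add_le_add ?_ ?_))
  · exact (ENNReal.le_ofReal_iff_toReal_le (measure_ne_top _ _) (Real.exp_pos _).le).2 h1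
  · exact (ENNReal.le_ofReal_iff_toReal_le (measure_ne_top _ _) (Real.exp_pos _).le).2 h2

end SubGaussian

/-! ### Covariance forms as moments of linear forms. -/

section Moments
variable {p q : ℕ}

/-- The linear form `⟨u, (X, Y)⟩`. -/
def linForm (u : Fin p ⊕ Fin q → ℝ) (z : (Fin p → ℝ) × (Fin q → ℝ)) : ℝ :=
  u ⬝ᵥ Sum.elim z.1 z.2

lemma linForm_eq (u : Fin p ⊕ Fin q → ℝ) (z : (Fin p → ℝ) × (Fin q → ℝ)) :
    linForm u z = (u ∘ Sum.inl) ⬝ᵥ z.1 + (u ∘ Sum.inr) ⬝ᵥ z.2 := by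
  simp [linForm, dotProduct]

lemma measurable_linForm (u : Fin p ⊕ Fin q → ℝ) : Measurable (linForm u) := by
  simp only [funext (linForm_eq u), dotProduct]
  fun_prop

lemma IsSubGaussianVector.hasSubgaussianMGF {d : ℕ} {ν : Measure (Fin d → ℝ)}
    [IsProbabilityMeasure ν] {K R : ℝ≥0} (h : IsSubGaussianVector ν K) (u : Fin d → ℝ)
    (hu : l2Norm u ≤ R) : HasSubgaussianMGF (fun x => u ⬝ᵥ x) (R ^ 2 * K) ν := by
  by_cases h0 : l2Norm u = 0
  · rw [l2Norm_eq_zero] at h0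
    subst h0
    simp only [zero_dotProduct]
    exact hasSubgaussianMGF_mono HasSubgaussianMGF.fun_zero zero_le
  · have h1 : l2Norm ((l2Norm u)⁻¹ • u) = 1 := by
      rw [l2Norm_smul, abs_of_nonneg (inv_nonneg.2 (l2Norm_nonneg u)), inv_mul_cancel₀ h0]
    have h2 := (h.2 _ h1).const_mul (l2Norm u)
    simp only [smul_dotProduct, smul_eq_mul, mul_inv_cancel_left₀ h0] at h2
    refine hasSubgaussianMGF_mono h2 ?_
    refine mul_le_mul_left ?_ K
    change l2Norm u ^ 2 ≤ ((R ^ 2 : ℝ≥0) : ℝ)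
    rw [NNReal.coe_pow]
    exact pow_le_pow_left₀ (l2Norm_nonneg u) hu 2

lemma joint_populationCov_apply {μ : Measure ((Fin p → ℝ) × (Fin q → ℝ))} (i j : Fin p ⊕ Fin q) :
    joint (populationCov μ) i j =
      covariance (fun z => Sum.elim z.1 z.2 i) (fun z => Sum.elim z.1 z.2 j) μ := by
  rcases i with i | i <;> rcases j with j | j <;>
    simp [joint, populationCov, covariance_comm]

variable {μ : Measure ((Fin p → ℝ) × (Fin q → ℝ))} [IsProbabilityMeasure μ] {K : ℝ≥0}

/-- `X` and `Y` may be dependent, so the square roots of the parameters add, whence the factor `4`.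
Replacing `K` by `K + 1` keeps the parameter positive, as needed for division later. -/
lemma hasSubgaussianMGF_linForm (hX : IsSubGaussianVector (μ.map Prod.fst) K)
    (hY : IsSubGaussianVector (μ.map Prod.snd) K) {R : ℝ≥0} (u : Fin p ⊕ Fin q → ℝ)
    (hu : l2Norm u ≤ R) : HasSubgaussianMGF (linForm u) (4 * R ^ 2 * (K + 1)) μ := by
  have hsq := l2Norm_elim_sq (u ∘ Sum.inl) (u ∘ Sum.inr)
  rw [Sum.elim_comp_inl_inr] at hsq
  have hl : l2Norm (u ∘ Sum.inl) ≤ R := le_trans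
    (le_of_sq_le_sq (by linarith [sq_nonneg (l2Norm (u ∘ Sum.inr))]) (l2Norm_nonneg u)) hu
  have hr : l2Norm (u ∘ Sum.inr) ≤ R := le_trans
    (le_of_sq_le_sq (by linarith [sq_nonneg (l2Norm (u ∘ Sum.inl))]) (l2Norm_nonneg u)) hu
  have := Measure.isProbabilityMeasure_map (μ := μ) (f := Prod.fst) measurable_fst.aemeasurable
  have := Measure.isProbabilityMeasure_map (μ := μ) (f := Prod.snd) measurable_snd.aemeasurable
  have h1 := HasSubgaussianMGF.of_map measurable_fst.aemeasurable (hX.hasSubgaussianMGF _ hl)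
  have h2 := HasSubgaussianMGF.of_map measurable_snd.aemeasurable (hY.hasSubgaussianMGF _ hr)
  rw [funext (linForm_eq u)]
  refine hasSubgaussianMGF_mono (h1.add h2) ?_
  rw [← two_mul, mul_pow, NNReal.sq_sqrt]
  calc (2 : ℝ≥0) ^ 2 * (R ^ 2 * K) = 4 * R ^ 2 * K := by ring
    _ ≤ 4 * R ^ 2 * (K + 1) := by gcongr; exact le_self_add

lemma memLp_linForm (hX : IsSubGaussianVector (μ.map Prod.fst) K)
    (hY : IsSubGaussianVector (μ.map Prod.snd) K) (u : Fin p ⊕ Fin q → ℝ) :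
    MemLp (linForm u) 2 μ :=
  (hasSubgaussianMGF_linForm hX hY (R := ⟨l2Norm u, l2Norm_nonneg u⟩) u le_rfl).memLp 2

/-- Centering turns covariances into second moments, so the population and sample forms become a
mean and an empirical mean of the same product. -/
lemma bil_populationCov (hX : IsSubGaussianVector (μ.map Prod.fst) K)
    (hY : IsSubGaussianVector (μ.map Prod.snd) K) (u v : Fin p ⊕ Fin q → ℝ) :
    bil (populationCov μ) u v = ∫ z, linForm u z * linForm v z ∂μ := by
  have hcoord : ∀ i : Fin p ⊕ Fin q, MemLp (fun z : (Fin p → ℝ) × (Fin q → ℝ) =>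
      Sum.elim z.1 z.2 i) 2 μ := fun i => by
    have := memLp_linForm hX hY (Pi.single i 1)
    rwa [show linForm (Pi.single i 1) = fun z : (Fin p → ℝ) × (Fin q → ℝ) => Sum.elim z.1 z.2 i
      from funext fun z => by simp [linForm]] at this
  have hmean : ∀ i : Fin p ⊕ Fin q, ∫ z, Sum.elim z.1 z.2 i ∂μ = 0 := by
    rintro (i | i)
    · have := hX.1 i
      rwa [integral_map (f := fun x : Fin p → ℝ => x i) measurable_fst.aemeasurable
        (measurable_pi_apply i).aestronglyMeasurable] at this
    · have := hY.1 i
      rwa [integral_map (f := fun x : Fin q → ℝ => x i) measurable_snd.aemeasurable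
        (measurable_pi_apply i).aestronglyMeasurable] at this
  have hmeanu : ∫ z, linForm u z ∂μ = 0 := by
    simp only [linForm, dotProduct]
    rw [integral_finsetSum _ fun i _ => ((hcoord i).integrable (by norm_num)).const_mul _]
    simp [integral_const_mul, hmean]
  have hcov := covariance_eq_sub (memLp_linForm hX hY u) (memLp_linForm hX hY v)
  rw [hmeanu, zero_mul, sub_zero] at hcov
  have hR : ∫ z, linForm u z * linForm v z ∂μ = covariance (linForm u) (linForm v) μ := hcov.symm
  rw [hR, bil_apply]
  have hl : ∀ w : Fin p ⊕ Fin q → ℝ, linForm w =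
      fun z : (Fin p → ℝ) × (Fin q → ℝ) => ∑ i, w i * Sum.elim z.1 z.2 i := fun w => rfl
  rw [hl u, hl v, covariance_fun_sum_fun_sum (fun i => (hcoord i).const_mul _)
    (fun i => (hcoord i).const_mul _)]
  simp only [dotProduct, Matrix.mulVec, joint_populationCov_apply, covariance_const_mul_left,
    covariance_const_mul_right, Finset.mul_sum]
  exact Finset.sum_congr rfl fun i _ => Finset.sum_congr rfl fun j _ => by ring

lemma joint_sampleCov {n : ℕ} (z : Fin n → (Fin p → ℝ) × (Fin q → ℝ)) :
    joint (sampleCov z) = (n : ℝ)⁻¹ •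
      ∑ i, Matrix.vecMulVec (Sum.elim (z i).1 (z i).2) (Sum.elim (z i).1 (z i).2) := by
  ext (i | i) (j | j) <;>
    simp [joint, sampleCov, Matrix.sum_apply, Matrix.vecMulVec_apply, mul_comm]

lemma bil_sampleCov {n : ℕ} (z : Fin n → (Fin p → ℝ) × (Fin q → ℝ))
    (u v : Fin p ⊕ Fin q → ℝ) :
    bil (sampleCov z) u v = (n : ℝ)⁻¹ * ∑ i, linForm u (z i) * linForm v (z i) := by
  rw [bil_apply, joint_sampleCov, Matrix.smul_mulVec, dotProduct_smul, smul_eq_mul,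
    Matrix.sum_mulVec, dotProduct_sum]
  congr 1
  refine Finset.sum_congr rfl fun i _ => ?_
  rw [Matrix.vecMulVec_mulVec, linForm, linForm, dotProduct_comm v]
  simp [mul_comm]

lemma bil_populationCov_self_nonneg (hX : IsSubGaussianVector (μ.map Prod.fst) K)
    (hY : IsSubGaussianVector (μ.map Prod.snd) K) (u : Fin p ⊕ Fin q → ℝ) :
    0 ≤ bil (populationCov μ) u u := by
  rw [bil_populationCov hX hY]
  exact integral_nonneg fun z => mul_self_nonneg _

end Moments

/-! ### Concentration of the sample covariance over many directions. -/

section Concentration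

/-- Bernstein's inequality for the sample covariance in two fixed directions. -/
lemma measure_abs_bil_sub_gt_le {p q n : ℕ} {Ω : Type*} [MeasurableSpace Ω] {P : Measure Ω}
    [IsProbabilityMeasure P] {μ : Measure ((Fin p → ℝ) × (Fin q → ℝ))} [IsProbabilityMeasure μ]
    {Z : Fin n → Ω → (Fin p → ℝ) × (Fin q → ℝ)} (hZ : IsIIDSample P μ Z) {K R : ℝ≥0}
    (hX : IsSubGaussianVector (μ.map Prod.fst) K) (hY : IsSubGaussianVector (μ.map Prod.snd) K)
    (hR : 0 < R) (hn : 0 < n) {u v : Fin p ⊕ Fin q → ℝ} (hu : l2Norm u ≤ R) (hv : l2Norm v ≤ R)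
    {τ x : ℝ} (hτ : τ = (4 * ((4 * R ^ 2 * (K + 1) : ℝ≥0) : ℝ))⁻¹) (hx : 0 ≤ x)
    (hxτ : x ≤ 16 / τ) :
    P {ω | x < |bil (sampleCov fun i => Z i ω) u v - bil (populationCov μ) u v|} ≤
      ENNReal.ofReal (2 * Real.exp (-(n * (τ ^ 2 * x ^ 2 / 64)))) := by
  have hc : 0 < 4 * R ^ 2 * (K + 1) := by positivity
  obtain ⟨h1, h2⟩ := integrable_exp_abs_mul (hasSubgaussianMGF_linForm hX hY u hu)
    (hasSubgaussianMGF_linForm hX hY v hv) (measurable_linForm u) (measurable_linForm v) hc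
  rw [← hτ] at h1 h2
  have hτ0 : 0 < τ := by
    rw [hτ]
    exact inv_pos.2 (mul_pos (by norm_num) (NNReal.coe_pos.2 hc))
  have h3 := measure_abs_mean_sub_gt_le hZ hτ0
    ((measurable_linForm u).mul (measurable_linForm v)) h1 h2 hn hx hxτ
  simpa only [bil_sampleCov, bil_populationCov hX hY, Pi.mul_apply] using h3

/-- Uniform concentration of the sample covariance over `O(p ∨ q)` bounded directions. -/
theorem exists_uniform_concentration {p q : ℕ → ℕ} {Ω : ℕ → Type*} [∀ n, MeasurableSpace (Ω n)]
    {P : ∀ n, Measure (Ω n)} [∀ n, IsProbabilityMeasure (P n)]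
    {μ : ∀ n, Measure ((Fin (p n) → ℝ) × (Fin (q n) → ℝ))} [∀ n, IsProbabilityMeasure (μ n)]
    {Z : ∀ n, Fin n → Ω n → (Fin (p n) → ℝ) × (Fin (q n) → ℝ)}
    (hZ : ∀ n, IsIIDSample (P n) (μ n) (Z n)) {K R : ℝ≥0} (hR : 0 < R)
    (hX : ∀ n, IsSubGaussianVector ((μ n).map Prod.fst) K)
    (hY : ∀ n, IsSubGaussianVector ((μ n).map Prod.snd) K)
    (hm : Tendsto (fun n => max (p n) (q n)) atTop atTop)
    (hlam : Tendsto (fun n => lam (p n) (q n) n) atTop (𝓝 0))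
    {J : ℕ → Type*} [∀ n, Fintype (J n)] (A : ℕ)
    (hJ : ∀ᶠ n in atTop, Fintype.card (J n) ≤ A * max (p n) (q n))
    (dir : ∀ n, J n → Fin (p n) ⊕ Fin (q n) → ℝ) (hdir : ∀ n j, l2Norm (dir n j) ≤ R) :
    ∃ C : ℝ, 0 < C ∧ Tendsto (fun n => P n {ω | ∃ j k, C * lam (p n) (q n) n <
      |bil (sampleCov fun i => Z n i ω) (dir n j) (dir n k) -
        bil (populationCov (μ n)) (dir n j) (dir n k)|}) atTop (𝓝 0) := by
  set τ : ℝ := (4 * ((4 * R ^ 2 * (K + 1) : ℝ≥0) : ℝ))⁻¹ with hτ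
  have hτ0 : 0 < τ := inv_pos.2 (mul_pos (by norm_num) (NNReal.coe_pos.2 (by positivity)))
  -- At deviation `C λ` the Bernstein exponent is `4 log(p ∨ q)`, so each pair has probability at
  -- most `2 (p ∨ q)⁻⁴` against `O((p ∨ q)²)` pairs. Also `C λ` stays in the Gaussian range once `λ
  -- ≤ 1`.
  set C : ℝ := 16 / τ with hC
  have hC0 : 0 < C := by positivity
  refine ⟨C, hC0, ?_⟩
  have hbound : ∀ᶠ n in atTop, P n {ω | ∃ j k, C * lam (p n) (q n) n <
      |bil (sampleCov fun i => Z n i ω) (dir n j) (dir n k) -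
        bil (populationCov (μ n)) (dir n j) (dir n k)|} ≤
      ENNReal.ofReal (2 * A ^ 2 * (((max (p n) (q n) : ℕ) : ℝ))⁻¹ ^ 2) := by
    filter_upwards [hJ, hm.eventually_ge_atTop 1, eventually_gt_atTop 0,
      hlam.eventually_le_const zero_lt_one] with n hJn hmn hn hln
    set m : ℝ := ((max (p n) (q n) : ℕ) : ℝ) with hmdef
    have hm0 : 0 < m := Nat.cast_pos.2 (by omega)
    have hl0 : 0 ≤ lam (p n) (q n) n := Real.sqrt_nonneg _
    have hlsq : n * lam (p n) (q n) n ^ 2 = Real.log m := by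
      have hlog : 0 ≤ Real.log m := Real.log_nonneg (by rw [hmdef]; exact_mod_cast hmn)
      rw [lam, Real.sq_sqrt (by positivity), ← hmdef]
      field_simp
    have hone : ∀ j k, P n {ω | C * lam (p n) (q n) n <
      |bil (sampleCov fun i => Z n i ω) (dir n j) (dir n k) -
        bil (populationCov (μ n)) (dir n j) (dir n k)|} ≤ ENNReal.ofReal (2 * m⁻¹ ^ 4) := by
      intro j k
      refine (measure_abs_bil_sub_gt_le (hZ n) (hX n) (hY n) hR hn (hdir n j) (hdir n k) hτ
        (by positivity) ?_).trans (ENNReal.ofReal_le_ofReal (le_of_eq ?_))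
      · calc C * lam (p n) (q n) n ≤ C * 1 := mul_le_mul_of_nonneg_left hln hC0.le
          _ = 16 / τ := mul_one _
      · congr 1
        have : (n : ℝ) * (τ ^ 2 * (C * lam (p n) (q n) n) ^ 2 / 64) = 4 * Real.log m := by
          rw [← hlsq, hC]
          field_simp
          ring
        rw [this, Real.exp_neg, mul_comm, Real.exp_mul, Real.exp_log hm0, inv_pow]
        norm_cast
    have hset : {ω | ∃ j k, C * lam (p n) (q n) n <
      |bil (sampleCov fun i => Z n i ω) (dir n j) (dir n k) -
        bil (populationCov (μ n)) (dir n j) (dir n k)|} = ⋃ jk : J n × J n,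
        {ω | C * lam (p n) (q n) n <
      |bil (sampleCov fun i => Z n i ω) (dir n jk.1) (dir n jk.2) -
        bil (populationCov (μ n)) (dir n jk.1) (dir n jk.2)|} := by
      ext ω
      simp
    rw [hset]
    refine (measure_iUnion_fintype_le _ _).trans ?_
    refine (Finset.sum_le_sum fun jk _ => hone jk.1 jk.2).trans ?_
    rw [Finset.sum_const, Finset.card_univ, Fintype.card_prod, nsmul_eq_mul,
      ← ENNReal.ofReal_natCast, ← ENNReal.ofReal_mul (Nat.cast_nonneg _)]
    refine ENNReal.ofReal_le_ofReal ?_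
    have hJr : (Fintype.card (J n) : ℝ) ≤ A * m := by rw [hmdef]; exact_mod_cast hJn
    rw [Nat.cast_mul]
    calc (Fintype.card (J n) : ℝ) * Fintype.card (J n) * (2 * m⁻¹ ^ 4)
        ≤ (A * m) * (A * m) * (2 * m⁻¹ ^ 4) := by gcongr
      _ = 2 * A ^ 2 * m⁻¹ ^ 2 := by field_simp
  refine tendsto_of_tendsto_of_tendsto_of_le_of_le' tendsto_const_nhds ?_
    (Eventually.of_forall fun n => zero_le) hbound
  rw [← ENNReal.ofReal_zero]
  refine ENNReal.tendsto_ofReal ?_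
  have h1 : Tendsto (fun n => (((max (p n) (q n) : ℕ) : ℝ))⁻¹) atTop (𝓝 0) :=
    tendsto_inv_atTop_zero.comp (tendsto_natCast_atTop_atTop.comp hm)
  simpa using (h1.pow 2).const_mul (2 * (A : ℝ) ^ 2)

end Concentration

/-! ### Deterministic second-order expansion of the estimating equation. -/

section Expansion
variable {I : Type*} {l : Filter I}

/-- Second-order expansion of `2 b₁ b₂ - 2 b₃` around `b₁ = ρ`, `b₂ = p₀`, `b₃ = ρ p₀`. -/
lemma isBigO_product_expansion {a ρ p₀ e₁ e₂ e₃ d₁ d₂ d₃ t b₁ b₂ b₃ : I → ℝ}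
    (ha : a =O[l] fun _ => (1 : ℝ)) (hρ : ρ =O[l] fun _ => (1 : ℝ))
    (hp : p₀ =O[l] fun _ => (1 : ℝ)) (he₁ : e₁ =O[l] a) (he₂ : e₂ =O[l] a) (hd₁ : d₁ =O[l] a)
    (hd₂ : d₂ =O[l] a) (ht : t =O[l] a)
    (h₁ : (fun i => b₁ i - (ρ i + e₁ i + 2 * d₁ i)) =O[l] fun i => a i ^ 2)
    (h₂ : (fun i => b₂ i - (p₀ i + e₂ i + d₂ i + t i)) =O[l] fun i => a i ^ 2)
    (h₃ : (fun i => b₃ i - (ρ i * p₀ i + e₃ i + d₃ i + ρ i * t i)) =O[l] fun i => a i ^ 2) :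
    (fun i => 2 * b₁ i * b₂ i - 2 * b₃ i
      - (2 * (ρ i * d₂ i + 2 * (p₀ i * d₁ i) - d₃ i)
        + 2 * (ρ i * e₂ i - e₃ i + e₁ i * p₀ i))) =O[l] fun i => a i ^ 2 := by
  have hA₁ : (fun i => e₁ i + 2 * d₁ i) =O[l] a := he₁.add (hd₁.const_mul_left 2)
  have hA₂ : (fun i => e₂ i + d₂ i + t i) =O[l] a := (he₂.add hd₂).add ht
  have hsq : (fun i => a i ^ 2) =O[l] fun _ => (1 : ℝ) := by simpa using ha.pow 2
  have hb₁ : b₁ =O[l] fun _ => (1 : ℝ) := by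
    refine (((hρ.add (hA₁.trans ha)).add (h₁.trans hsq))).congr_left fun i => ?_
    ring
  have hA₁₂ : (fun i => (e₁ i + 2 * d₁ i) * (e₂ i + d₂ i + t i)) =O[l] fun i => a i ^ 2 := by
    simpa only [← sq] using hA₁.mul hA₂
  have hr₁ := h₁.mul (hp.add (hA₂.trans ha))
  have hr₂ := hb₁.mul h₂
  simp only [mul_one] at hr₁
  simp only [one_mul] at hr₂
  -- The first-order term `ρ t` occurs in both `b₁ b₂` and `b₃` and cancels; only products of two
  -- errors and the remainders are left.
  refine ((((hA₁₂.add hr₁).add hr₂).sub h₃).const_mul_left 2).congr_left fun i => ?_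
  ring

variable {p q : I → ℕ} {S Shat : ∀ i, CovBlocks (p i) (q i)} {a b lam : I → ℝ}

/-- The sampling error of the covariance form. -/
noncomputable def covErr {p q : ℕ} (S Shat : CovBlocks p q) :
    LinearMap.BilinForm ℝ (Fin p ⊕ Fin q → ℝ) := bil Shat - bil S

lemma bil_eq_add_covErr {p q : ℕ} (S Shat : CovBlocks p q) (u v : Fin p ⊕ Fin q → ℝ) :
    bil Shat u v = bil S u v + covErr S Shat u v := by
  simp [covErr]

/-- The asymptotic regime: a bounded population form, a sampling error that is entrywise of order
`lam`, and rates `a` (for `ℓ²` norms) and `b` (for `ℓ¹` norms). -/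
structure IsRegime (l : Filter I) (S Shat : ∀ i, CovBlocks (p i) (q i)) (a b lam : I → ℝ) :
    Prop where
  symS : ∀ i, (bil (S i)).IsSymm
  symShat : ∀ i, (bil (Shat i)).IsSymm
  bound : ∃ C : ℝ, 0 ≤ C ∧ ∀ i u v, |bil (S i) u v| ≤ C * (l2Norm u * l2Norm v)
  entry : ∃ C : ℝ, ∀ᶠ i in l, ∀ k m,
    |covErr (S i) (Shat i) (Pi.single k 1) (Pi.single m 1)| ≤ C * lam i
  tendsto_a : Tendsto a l (𝓝 0)
  lam_a : lam =O[l] a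
  lam_b : (fun i => lam i * b i) =O[l] fun i => a i ^ 2
  lam_b_sq : (fun i => lam i * b i ^ 2) =O[l] fun i => a i ^ 2

/-- A random vector of order `a` in `ℓ²` and of order `b` in `ℓ¹`. -/
structure IsSmall (l : Filter I) (a b : I → ℝ) (v : ∀ i, Fin (p i) ⊕ Fin (q i) → ℝ) : Prop where
  l2 : (fun i => l2Norm (v i)) =O[l] a
  l1 : (fun i => l1Norm (v i)) =O[l] b

/-- A bounded direction along which the sampling error is of order `lam` in every coordinate. -/
structure IsTame (l : Filter I) (S Shat : ∀ i, CovBlocks (p i) (q i)) (lam : I → ℝ)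
    (f : ∀ i, Fin (p i) ⊕ Fin (q i) → ℝ) : Prop where
  l2 : (fun i => l2Norm (f i)) =O[l] fun _ => (1 : ℝ)
  entry : ∃ C : ℝ, ∀ᶠ i in l, ∀ k, |covErr (S i) (Shat i) (f i) (Pi.single k 1)| ≤ C * lam i

namespace IsRegime

variable (h : IsRegime l S Shat a b lam)
include h

lemma a_bounded : a =O[l] fun _ => (1 : ℝ) := h.tendsto_a.isBigO_one ℝ

lemma covErr_symm (i : I) : (covErr (S i) (Shat i)).IsSymm := (h.symShat i).sub (h.symS i)

lemma bil_isBigO {c d : I → ℝ} {u v : ∀ i, Fin (p i) ⊕ Fin (q i) → ℝ}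
    (hu : (fun i => l2Norm (u i)) =O[l] c) (hv : (fun i => l2Norm (v i)) =O[l] d) :
    (fun i => bil (S i) (u i) (v i)) =O[l] fun i => c i * d i := by
  obtain ⟨C, hC, hb⟩ := h.bound
  refine IsBigO.trans (IsBigO.of_bound C (Eventually.of_forall fun i => ?_)) (hu.mul hv)
  rw [Real.norm_eq_abs, Real.norm_eq_abs,
    abs_of_nonneg (mul_nonneg (l2Norm_nonneg _) (l2Norm_nonneg _))]
  exact hb i _ _

lemma bil_tame_tame {f g : ∀ i, Fin (p i) ⊕ Fin (q i) → ℝ} (hf : IsTame l S Shat lam f)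
    (hg : IsTame l S Shat lam g) :
    (fun i => bil (S i) (f i) (g i)) =O[l] fun _ => (1 : ℝ) := by
  simpa using h.bil_isBigO hf.l2 hg.l2

lemma bil_tame_small {f v : ∀ i, Fin (p i) ⊕ Fin (q i) → ℝ} (hf : IsTame l S Shat lam f)
    (hv : IsSmall l a b v) : (fun i => bil (S i) (f i) (v i)) =O[l] a := by
  simpa using h.bil_isBigO hf.l2 hv.l2

lemma bil_small_small {u v : ∀ i, Fin (p i) ⊕ Fin (q i) → ℝ} (hu : IsSmall l a b u)
    (hv : IsSmall l a b v) : (fun i => bil (S i) (u i) (v i)) =O[l] fun i => a i ^ 2 := by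
  simpa only [sq] using h.bil_isBigO hu.l2 hv.l2

/-- Hölder: entrywise order `lam` times an `ℓ¹` norm of order `b`. An operator-norm bound on the
sampling error is thereby avoided. -/
lemma covErr_tame_small {f v : ∀ i, Fin (p i) ⊕ Fin (q i) → ℝ} (hf : IsTame l S Shat lam f)
    (hv : IsSmall l a b v) :
    (fun i => covErr (S i) (Shat i) (f i) (v i)) =O[l] fun i => a i ^ 2 := by
  obtain ⟨C, hC⟩ := hf.entry
  refine IsBigO.trans (IsBigO.of_bound |C| ?_) (((isBigO_refl lam l).mul hv.l1).trans h.lam_b)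
  filter_upwards [hC] with i hi
  refine (abs_bilin_le_l1Norm _ _ _ hi).trans ((le_abs_self _).trans (le_of_eq ?_))
  rw [Real.norm_eq_abs, ← abs_mul, mul_assoc]

lemma covErr_small_small {u v : ∀ i, Fin (p i) ⊕ Fin (q i) → ℝ} (hu : IsSmall l a b u)
    (hv : IsSmall l a b v) :
    (fun i => covErr (S i) (Shat i) (u i) (v i)) =O[l] fun i => a i ^ 2 := by
  obtain ⟨C, hC⟩ := h.entry
  have h1 : (fun i => lam i * (l1Norm (u i) * l1Norm (v i))) =O[l] fun i => a i ^ 2 := by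
    refine ((isBigO_refl lam l).mul (hu.l1.mul hv.l1)).trans ?_
    simpa only [sq] using h.lam_b_sq
  refine IsBigO.trans (IsBigO.of_bound |C| ?_) h1
  filter_upwards [hC] with i hi
  refine (abs_bilin_le_l1Norm_mul _ (h.covErr_symm i) _ _ hi).trans
    ((le_abs_self _).trans (le_of_eq ?_))
  rw [Real.norm_eq_abs, ← abs_mul]
  congr 1
  ring

/-- Expansion of the sample form around two tame directions. -/
lemma bil_hat_expansion {f g u v : ∀ i, Fin (p i) ⊕ Fin (q i) → ℝ} (hf : IsTame l S Shat lam f)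
    (hg : IsTame l S Shat lam g) (hu : IsSmall l a b u) (hv : IsSmall l a b v) :
    (fun i => bil (Shat i) (f i + u i) (g i + v i) - (bil (S i) (f i) (g i)
      + covErr (S i) (Shat i) (f i) (g i) + bil (S i) (f i) (v i) + bil (S i) (u i) (g i)))
      =O[l] fun i => a i ^ 2 := by
  refine ((((h.covErr_tame_small hf hv).add (h.covErr_tame_small hg hu)).add
    (h.covErr_small_small hu hv)).add (h.bil_small_small hu hv)).congr_left fun i => ?_
  have e : covErr (S i) (Shat i) (g i) (u i) = covErr (S i) (Shat i) (u i) (g i) :=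
    (h.covErr_symm i).eq _ _
  rw [bil_eq_add_covErr (S i) (Shat i), e]
  simp only [map_add, LinearMap.add_apply]
  ring

/-- Expansion of one block of the estimating equation. -/
lemma gradient_block_expansion {φ Δ x₀ δ y₀ ε : ∀ i, Fin (p i) ⊕ Fin (q i) → ℝ} {ρ : I → ℝ}
    (hρ : ρ =O[l] fun _ => (1 : ℝ))
    (hφ : IsTame l S Shat lam φ) (hx₀ : IsTame l S Shat lam x₀) (hy₀ : IsTame l S Shat lam y₀)
    (hΔ : IsSmall l a b Δ) (hδ : IsSmall l a b δ) (hε : IsSmall l a b ε)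
    (hφx : (fun i => covErr (S i) (Shat i) (φ i) (x₀ i)) =O[l] lam)
    (hxx : (fun i => covErr (S i) (Shat i) (x₀ i) (x₀ i)) =O[l] lam)
    (hρx : ∀ i, bil (S i) (x₀ i) (x₀ i) = ρ i)
    (hφy : ∀ i, bil (S i) (φ i) (y₀ i) = ρ i * bil (S i) (φ i) (x₀ i))
    (hΔy : ∀ i, bil (S i) (Δ i) (y₀ i) = ρ i * bil (S i) (Δ i) (x₀ i)) :
    (fun i => 2 * bil (Shat i) (x₀ i + δ i) (x₀ i + δ i) * bil (Shat i) (φ i + Δ i) (x₀ i + δ i)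
        - 2 * bil (Shat i) (φ i + Δ i) (y₀ i + ε i)
      - (2 * (ρ i * bil (S i) (φ i) (δ i)
          + 2 * (bil (S i) (φ i) (x₀ i) * bil (S i) (x₀ i) (δ i)) - bil (S i) (φ i) (ε i))
        + 2 * (ρ i * covErr (S i) (Shat i) (φ i) (x₀ i) - covErr (S i) (Shat i) (φ i) (y₀ i)
          + covErr (S i) (Shat i) (x₀ i) (x₀ i) * bil (S i) (φ i) (x₀ i))))
      =O[l] fun i => a i ^ 2 := by
  -- The term `t` carries the first-order effect of the error `Δ` in the inverse Hessian. By
  -- stationarity of the population criterion it enters both products with the same coefficient, so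
  -- it disappears.
  refine isBigO_product_expansion (t := fun i => bil (S i) (Δ i) (x₀ i)) h.a_bounded hρ
    (h.bil_tame_tame hφ hx₀) (hxx.trans h.lam_a) (hφx.trans h.lam_a) (h.bil_tame_small hx₀ hδ)
    (h.bil_tame_small hφ hδ) ?_ ?_ ?_ ?_
  · refine (h.bil_tame_small hx₀ hΔ).congr_left fun i => ?_
    exact (h.symS i).eq _ _
  · refine (h.bil_hat_expansion hx₀ hx₀ hδ hδ).congr_left fun i => ?_
    have e : bil (S i) (δ i) (x₀ i) = bil (S i) (x₀ i) (δ i) := (h.symS i).eq _ _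
    rw [hρx, e]
    ring
  · exact h.bil_hat_expansion hφ hx₀ hΔ hδ
  · refine (h.bil_hat_expansion hφ hy₀ hΔ hε).congr_left fun i => ?_
    rw [hφy, hΔy]

end IsRegime
end Expansion

/-! ### Scalar forms of the gradient, Hessian and leading term; the controlled directions. -/

section Identities
variable {p q : ℕ}

lemma dotProduct_gradH (S : CovBlocks p q) (φx x : Fin p → ℝ) (φy y : Fin q → ℝ) :
    Sum.elim φx φy ⬝ᵥ gradH S x y =
      (2 * bil S (inX q x) (inX q x) * bil S (inX q φx) (inX q x)
        - 2 * bil S (inX q φx) (inY p y))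
      + (2 * bil S (inY p y) (inY p y) * bil S (inY p φy) (inY p y)
        - 2 * bil S (inY p φy) (inX q x)) := by
  simp only [gradH, sumElim_dotProduct_sumElim, dotProduct_sub, dotProduct_smul, smul_eq_mul,
    bil_inX_inX, bil_inX_inY, bil_inY_inX, bil_inY_inY]

/-- The gradient is a sum of cubic and linear terms, hence odd: a sign shared by both estimators
factors out. -/
lemma gradH_smul (S : CovBlocks p q) (x : Fin p → ℝ) (y : Fin q → ℝ) {w : ℝ}
    (hw : w = 1 ∨ w = -1) : gradH S (w • x) (w • y) = w • gradH S x y := by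
  rcases hw with rfl | rfl
  · simp
  · ext (i | i) <;> simp [gradH, Matrix.mulVec_neg] <;> ring

/-- The factor `ρ₀` before the rank-one terms is split as `√ρ₀ · √ρ₀` between two copies of the
canonical direction, matching the shape of the gradient expansion. -/
lemma dotProduct_hessian0_target (S : CovBlocks p q) (α₀ : Fin p → ℝ) (β₀ : Fin q → ℝ)
    (hρ : 0 < rho0 S) (φx δ : Fin p → ℝ) (φy ε : Fin q → ℝ) :
    Sum.elim φx φy ⬝ᵥ (hessian0 S α₀ β₀ *ᵥ Sum.elim δ ε) =
      2 * (rho0 S * bil S (inX q φx) (inX q δ)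
        + 2 * (bil S (inX q φx) (inX q (target S α₀)) * bil S (inX q (target S α₀)) (inX q δ))
        - bil S (inX q φx) (inY p ε))
      + 2 * (rho0 S * bil S (inY p φy) (inY p ε)
        + 2 * (bil S (inY p φy) (inY p (target S β₀)) * bil S (inY p (target S β₀)) (inY p ε))
        - bil S (inY p φy) (inX q δ)) := by
  have hsq : √(rho0 S) * √(rho0 S) = rho0 S := Real.mul_self_sqrt hρ.le
  rw [dotProduct_hessian0 α₀ β₀ hρ.ne']
  simp only [target, bil_inX_inX, bil_inX_inY, bil_inY_inX, bil_inY_inY, Matrix.mulVec_smul,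
    dotProduct_smul, smul_dotProduct, smul_eq_mul]
  linear_combination
    (-4 * ((φx ⬝ᵥ (S.xx *ᵥ α₀)) * (α₀ ⬝ᵥ (S.xx *ᵥ δ)))
      - 4 * ((φy ⬝ᵥ (S.yy *ᵥ β₀)) * (β₀ ⬝ᵥ (S.yy *ᵥ ε)))) * hsq

/-- Symmetry of `Φ⁰` replaces its row by its column, the direction that occurs in the expansion of
the Newton correction. -/
lemma calL_apply (S Shat : CovBlocks p q) (α₀ : Fin p → ℝ) (β₀ : Fin q → ℝ)
    (hΦ : (Phi0 S α₀ β₀)ᵀ = Phi0 S α₀ β₀) (j : Fin p ⊕ Fin q) :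
    calL S Shat α₀ β₀ j =
      2 * (rho0 S * covErr S Shat (inX q fun k => Phi0 S α₀ β₀ (Sum.inl k) j)
            (inX q (target S α₀))
          - covErr S Shat (inX q fun k => Phi0 S α₀ β₀ (Sum.inl k) j) (inY p (target S β₀))
          + covErr S Shat (inX q (target S α₀)) (inX q (target S α₀))
            * bil S (inX q fun k => Phi0 S α₀ β₀ (Sum.inl k) j) (inX q (target S α₀)))
      + 2 * (rho0 S * covErr S Shat (inY p fun k => Phi0 S α₀ β₀ (Sum.inr k) j)
            (inY p (target S β₀))
          - covErr S Shat (inY p fun k => Phi0 S α₀ β₀ (Sum.inr k) j) (inX q (target S α₀))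
          + covErr S Shat (inY p (target S β₀)) (inY p (target S β₀))
            * bil S (inY p fun k => Phi0 S α₀ β₀ (Sum.inr k) j) (inY p (target S β₀))) := by
  have hcol : ∀ v : Fin p ⊕ Fin q → ℝ, (Phi0 S α₀ β₀ *ᵥ v) j =
      Sum.elim (fun k => Phi0 S α₀ β₀ (Sum.inl k) j) (fun k => Phi0 S α₀ β₀ (Sum.inr k) j)
        ⬝ᵥ v := by
    intro v
    conv_lhs => rw [← hΦ]
    simp [Matrix.mulVec, dotProduct]
  rw [calL]
  simp only [Pi.smul_apply, smul_eq_mul, hcol, sumElim_dotProduct_sumElim, covErr,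
    LinearMap.sub_apply, bil_inX_inX, bil_inX_inY, bil_inY_inX, bil_inY_inY, dotProduct_add,
    dotProduct_sub, dotProduct_smul, Matrix.sub_mulVec, Matrix.transpose_sub]
  ring

lemma isSymm_bil {S : CovBlocks p q} (hx : S.xxᵀ = S.xx) (hy : S.yyᵀ = S.yy) :
    (bil S).IsSymm := by
  refine ⟨fun u v => ?_⟩
  have hT : (joint S)ᵀ = joint S := by
    rw [joint, Matrix.fromBlocks_transpose, hx, hy, Matrix.transpose_transpose]
  rw [bil_apply, bil_apply, Matrix.dotProduct_mulVec, ← Matrix.mulVec_transpose,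
    hT, dotProduct_comm]

/-- The index set of the directions along which the sample covariance is controlled. -/
abbrev DirIndex (p q : ℕ) : Type :=
  ((Fin p ⊕ Fin q) ⊕ (Fin p ⊕ Fin q)) ⊕ ((Fin p ⊕ Fin q) ⊕ Bool)

/-- The directions along which the sample covariance is controlled: the coordinate vectors, the
blocks of the columns of `Φ⁰`, and the first canonical directions. -/
noncomputable def direction (S : CovBlocks p q) (α₀ : Fin p → ℝ) (β₀ : Fin q → ℝ) :
    DirIndex p q → Fin p ⊕ Fin q → ℝ
  | Sum.inl (Sum.inl k) => Pi.single k 1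
  | Sum.inl (Sum.inr k) => inX q fun i => Phi0 S α₀ β₀ (Sum.inl i) k
  | Sum.inr (Sum.inl k) => inY p fun i => Phi0 S α₀ β₀ (Sum.inr i) k
  | Sum.inr (Sum.inr true) => inX q α₀
  | Sum.inr (Sum.inr false) => inY p β₀

lemma l2Norm_inX_comp_le (u : Fin p ⊕ Fin q → ℝ) : l2Norm (inX q (u ∘ Sum.inl)) ≤ l2Norm u := by
  have h := l2Norm_elim_sq (u ∘ Sum.inl) (u ∘ Sum.inr)
  rw [Sum.elim_comp_inl_inr] at h
  rw [inX, l2Norm_elim_zero]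
  exact le_of_sq_le_sq (by linarith [sq_nonneg (l2Norm (u ∘ Sum.inr))]) (l2Norm_nonneg u)

lemma l2Norm_inY_comp_le (u : Fin p ⊕ Fin q → ℝ) : l2Norm (inY p (u ∘ Sum.inr)) ≤ l2Norm u := by
  have h := l2Norm_elim_sq (u ∘ Sum.inl) (u ∘ Sum.inr)
  rw [Sum.elim_comp_inl_inr] at h
  rw [inY, l2Norm_zero_elim]
  exact le_of_sq_le_sq (by linarith [sq_nonneg (l2Norm (u ∘ Sum.inl))]) (l2Norm_nonneg u)

lemma l1Norm_inX_comp_le (u : Fin p ⊕ Fin q → ℝ) : l1Norm (inX q (u ∘ Sum.inl)) ≤ l1Norm u := by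
  have h := l1Norm_elim (u ∘ Sum.inl) (u ∘ Sum.inr)
  rw [Sum.elim_comp_inl_inr] at h
  rw [inX, l1Norm_elim, l1Norm_zero, h]
  linarith [l1Norm_nonneg (u ∘ Sum.inr)]

lemma l1Norm_inY_comp_le (u : Fin p ⊕ Fin q → ℝ) : l1Norm (inY p (u ∘ Sum.inr)) ≤ l1Norm u := by
  have h := l1Norm_elim (u ∘ Sum.inl) (u ∘ Sum.inr)
  rw [Sum.elim_comp_inl_inr] at h
  rw [inY, l1Norm_elim, l1Norm_zero, h]
  linarith [l1Norm_nonneg (u ∘ Sum.inl)]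

lemma IsRegularPopulation.l2Norm_direction_le {r : ℕ} {S : CovBlocks p q}
    {U : Matrix (Fin p) (Fin r) ℝ} {V : Matrix (Fin q) (Fin r) ℝ} {α₀ : Fin p → ℝ}
    {β₀ : Fin q → ℝ} {ε₀ M : ℝ} (h : IsRegularPopulation S U V α₀ β₀ ε₀ M) (hε₀ : 0 < ε₀)
    (hM : 0 < M) (d : DirIndex p q) :
    l2Norm (direction S α₀ β₀ d) ≤ 1 + M / (2 * ε₀) + M := by
  have h0 : 0 ≤ M / (2 * ε₀) := by positivity
  -- A crude common radius: `x ≤ 1 + x²` for the canonical directions, `M/(2ε₀)` for `Φ⁰`, `1` for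
  -- coordinate vectors.
  have hsq : ∀ x : ℝ, x ^ 2 ≤ M → x ≤ 1 + M / (2 * ε₀) + M := fun x hx => by
    nlinarith [sq_nonneg (x - 1)]
  rcases d with (k | k) | (k | (_ | _))
  · have : l2Norm (Pi.single k (1 : ℝ)) = 1 := by simp [l2Norm_eq_sqrt]
    rw [direction, this]
    linarith
  · have h1 := (l2Norm_inX_comp_le fun i => Phi0 S α₀ β₀ i k).trans (h.l2Phi0 k)
    exact h1.trans (by linarith)
  · have h1 := (l2Norm_inY_comp_le fun i => Phi0 S α₀ β₀ i k).trans (h.l2Phi0 k)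
    exact h1.trans (by linarith)
  · rw [direction, inY, l2Norm_zero_elim]
    exact hsq _ h.l2Y
  · rw [direction, inX, l2Norm_elim_zero]
    exact hsq _ h.l2X

end Identities

/-! ### Rates of the rescaled estimators and alignment of their signs. -/

section Estimators
variable {I : Type*} {l : Filter I} {p q : I → ℕ} {S Shat : ∀ i, CovBlocks (p i) (q i)}
  {a b lam : I → ℝ}

lemma IsTame.smul {f : ∀ i, Fin (p i) ⊕ Fin (q i) → ℝ} (hf : IsTame l S Shat lam f) {c : I → ℝ}
    (hc : ∀ i, |c i| ≤ 1) : IsTame l S Shat lam fun i => c i • f i where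
  l2 := by
    refine IsBigO.trans (IsBigO.of_bound 1 (Eventually.of_forall fun i => ?_)) hf.l2
    rw [l2Norm_smul, Real.norm_eq_abs, Real.norm_eq_abs, abs_mul, abs_abs]
    exact mul_le_mul_of_nonneg_right (hc i) (abs_nonneg _)
  entry := by
    obtain ⟨C, hC⟩ := hf.entry
    refine ⟨C, hC.mono fun i hi k => ?_⟩
    rw [map_smul, LinearMap.smul_apply, smul_eq_mul, abs_mul]
    exact (mul_le_of_le_one_left (abs_nonneg _) (hc i)).trans (hi k)

lemma IsSmall.mono {u v : ∀ i, Fin (p i) ⊕ Fin (q i) → ℝ} (hv : IsSmall l a b v)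
    (h2 : ∀ i, l2Norm (u i) ≤ l2Norm (v i)) (h1 : ∀ i, l1Norm (u i) ≤ l1Norm (v i)) :
    IsSmall l a b u where
  l2 := IsBigO.trans (IsBigO.of_bound 1 (Eventually.of_forall fun i => by
    rw [one_mul, Real.norm_of_nonneg (l2Norm_nonneg _), Real.norm_of_nonneg (l2Norm_nonneg _)]
    exact h2 i)) hv.l2
  l1 := IsBigO.trans (IsBigO.of_bound 1 (Eventually.of_forall fun i => by
    rw [one_mul, Real.norm_of_nonneg (l1Norm_nonneg _), Real.norm_of_nonneg (l1Norm_nonneg _)]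
    exact h1 i)) hv.l1

/-- Away from zero the square root is Lipschitz: multiply by the conjugate, which is at least `√c`.
-/
lemma isBigO_sqrt_sub_sqrt {x y : I → ℝ} {c : ℝ} (hc : 0 < c) (hx : ∀ i, 0 ≤ x i)
    (hy : ∀ i, c ≤ y i) (h : (fun i => x i - y i) =O[l] a) :
    (fun i => √(x i) - √(y i)) =O[l] a := by
  refine IsBigO.trans (IsBigO.of_bound (√c)⁻¹ (Eventually.of_forall fun i => ?_)) h
  have hs : 0 < √c := Real.sqrt_pos.2 hc
  have hcy : √c ≤ √(y i) := Real.sqrt_le_sqrt (hy i)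
  rw [Real.norm_eq_abs, Real.norm_eq_abs, inv_mul_eq_div, le_div_iff₀ hs]
  have e : x i - y i = (√(x i) - √(y i)) * (√(x i) + √(y i)) := by
    have h1 := Real.mul_self_sqrt (hx i)
    have h2 := Real.mul_self_sqrt (hc.le.trans (hy i))
    linear_combination h2 - h1
  rw [e, abs_mul]
  refine mul_le_mul_of_nonneg_left ?_ (abs_nonneg _)
  rw [abs_of_nonneg (by positivity)]
  linarith [Real.sqrt_nonneg (x i)]

/-- The sample canonical correlation is consistent at rate `a` (up to its sign), and the sign
convention aligns the signs of the two preliminary estimators. -/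
lemma rhoHat_consistency (hreg : IsRegime l S Shat a b lam) {ε₀ : ℝ} (hε₀ : 0 < ε₀)
    {α₀ : ∀ i, Fin (p i) → ℝ} {β₀ : ∀ i, Fin (q i) → ℝ}
    (hfeas : ∀ i, IsFeasible (S i) (α₀ i) (β₀ i))
    (hρ : ∀ i, ε₀ ≤ rho0 (S i)) (hρ1 : ∀ i, rho0 (S i) ≤ 1)
    (hαβ : ∀ i, bil (S i) (inX _ (α₀ i)) (inY _ (β₀ i)) = rho0 (S i))
    (tα : IsTame l S Shat lam fun i => inX _ (α₀ i))
    (tβ : IsTame l S Shat lam fun i => inY _ (β₀ i))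
    (eαα : (fun i => covErr (S i) (Shat i) (inX _ (α₀ i)) (inX _ (α₀ i))) =O[l] lam)
    (eββ : (fun i => covErr (S i) (Shat i) (inY _ (β₀ i)) (inY _ (β₀ i))) =O[l] lam)
    (eαβ : (fun i => covErr (S i) (Shat i) (inX _ (α₀ i)) (inY _ (β₀ i))) =O[l] lam)
    {ahat δ : ∀ i, Fin (p i) → ℝ} {bhat ε : ∀ i, Fin (q i) → ℝ} {wa wb : I → ℝ}
    (hwa : ∀ i, wa i = 1 ∨ wa i = -1) (hwb : ∀ i, wb i = 1 ∨ wb i = -1)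
    (hahat : ∀ i, ahat i = wa i • (α₀ i + δ i)) (hbhat : ∀ i, bhat i = wb i • (β₀ i + ε i))
    (hδ : IsSmall l a b fun i => inX (q i) (δ i)) (hε : IsSmall l a b fun i => inY (p i) (ε i))
    (hsign : ∀ᶠ i in l, 0 ≤ xHat (Shat i) (ahat i) (bhat i) ⬝ᵥ
      ((Shat i).xy *ᵥ yHat (Shat i) (ahat i) (bhat i))) :
    (fun i => √|rhoHat (Shat i) (ahat i) (bhat i)| - √(rho0 (S i))) =O[l] a ∧
      ∀ᶠ i in l, wb i = wa i := by
  have hsq : (fun i => a i ^ 2) =O[l] a := by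
    have := hreg.a_bounded.mul (isBigO_refl a l)
    simpa only [← sq, one_mul] using this
  have expand : ∀ {f g u v : ∀ i, Fin (p i) ⊕ Fin (q i) → ℝ}, IsTame l S Shat lam f →
      IsTame l S Shat lam g → IsSmall l a b u → IsSmall l a b v →
      (fun i => covErr (S i) (Shat i) (f i) (g i)) =O[l] lam →
      (fun i => bil (Shat i) (f i + u i) (g i + v i) - bil (S i) (f i) (g i)) =O[l] a := by
    intro f g u v hf hg hu hv hfg
    have h1 : (fun i => bil (S i) (u i) (g i)) =O[l] a :=
      (hreg.bil_tame_small hg hu).congr_left fun i => (hreg.symS i).eq _ _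
    refine (((((hreg.bil_hat_expansion hf hg hu hv).trans hsq).add (hfg.trans hreg.lam_a)).add
      (hreg.bil_tame_small hf hv)).add h1).congr_left fun i => ?_
    ring
  set A : I → ℝ := fun i => ahat i ⬝ᵥ ((Shat i).xx *ᵥ ahat i) with hA
  set B : I → ℝ := fun i => bhat i ⬝ᵥ ((Shat i).yy *ᵥ bhat i) with hB
  set N : I → ℝ := fun i => ahat i ⬝ᵥ ((Shat i).xy *ᵥ bhat i) with hN
  have w2 : ∀ {w : ℝ}, w = 1 ∨ w = -1 → w * w = 1 := by rintro w (rfl | rfl) <;> norm_num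
  have hA1 : (fun i => A i - 1) =O[l] a := by
    refine (expand tα tα hδ hδ eαα).congr_left fun i => ?_
    simp only [hA]
    rw [← inX_add, bil_inX_inX, bil_inX_inX, (hfeas i).1, hahat, Matrix.mulVec_smul,
      smul_dotProduct, dotProduct_smul, smul_eq_mul, smul_eq_mul, ← mul_assoc, w2 (hwa i), one_mul]
  have hB1 : (fun i => B i - 1) =O[l] a := by
    refine (expand tβ tβ hε hε eββ).congr_left fun i => ?_
    simp only [hB]
    rw [← inY_add, bil_inY_inY, bil_inY_inY, (hfeas i).2, hbhat, Matrix.mulVec_smul,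
      smul_dotProduct, dotProduct_smul, smul_eq_mul, smul_eq_mul, ← mul_assoc, w2 (hwb i), one_mul]
  -- Only the product of the two signs affects the numerator, and the absolute value in the scaling
  -- removes even that.
  have hN1 : (fun i => wa i * wb i * N i - rho0 (S i)) =O[l] a := by
    refine (expand tα tβ hδ hε eαβ).congr_left fun i => ?_
    simp only [hN]
    rw [hαβ, ← inX_add, ← inY_add, bil_inX_inY, hahat, hbhat, Matrix.mulVec_smul,
      smul_dotProduct, dotProduct_smul, smul_eq_mul, smul_eq_mul]
    linear_combination (-(wb i * wb i) * ((α₀ i + δ i) ⬝ᵥ ((Shat i).xy *ᵥ (β₀ i + ε i))))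
      * w2 (hwa i) - ((α₀ i + δ i) ⬝ᵥ ((Shat i).xy *ᵥ (β₀ i + ε i))) * w2 (hwb i)
  have hNabs : ∀ i, |N i| = |wa i * wb i * N i| := fun i => by
    rw [abs_mul, abs_mul]
    rcases hwa i with h | h <;> rcases hwb i with h' | h' <;> simp [h, h']
  have hN2 : (fun i => |N i| - rho0 (S i)) =O[l] a := by
    refine IsBigO.trans (IsBigO.of_bound 1 (Eventually.of_forall fun i => ?_)) hN1
    rw [one_mul, Real.norm_eq_abs, Real.norm_eq_abs, hNabs]
    have h0 : |rho0 (S i)| = rho0 (S i) := abs_of_nonneg (hε₀.le.trans (hρ i))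
    calc _ = |(|wa i * wb i * N i| - |rho0 (S i)|)| := by rw [h0]
      _ ≤ _ := abs_abs_sub_abs_le_abs_sub _ _
  have lim : ∀ {f : I → ℝ}, f =O[l] a → Tendsto f l (𝓝 0) := fun hf =>
    hf.trans_tendsto hreg.tendsto_a
  have sqrtO : ∀ {f : I → ℝ}, (fun i => f i - 1) =O[l] a → (fun i => √(f i) - 1) =O[l] a := by
    intro f hf
    have hpos : ∀ᶠ i in l, 0 ≤ f i := by
      filter_upwards [(lim hf).eventually_const_le (show (-1 : ℝ) < 0 by norm_num)] with i hi
      linarith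
    -- `f` is nonnegative only eventually; truncation makes it so everywhere without changing the
    -- germ.
    have h1 : (fun i => max (f i) 0 - 1) =O[l] a :=
      hf.congr' (hpos.mono fun i hi => by simp only [max_eq_left hi]) EventuallyEq.rfl
    have h2 := isBigO_sqrt_sub_sqrt (y := fun _ => 1) one_pos (fun i => le_max_right _ _)
      (fun _ => le_rfl) h1
    refine h2.congr' (hpos.mono fun i hi => ?_) EventuallyEq.rfl
    simp only [max_eq_left hi, Real.sqrt_one]
  have hsA := sqrtO hA1
  have hsB := sqrtO hB1
  have hsB' : (fun i => √(B i)) =O[l] fun _ => (1 : ℝ) := by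
    have := (hsB.trans hreg.a_bounded).add (isBigO_refl (fun _ => (1 : ℝ)) l)
    simpa using this
  have hD : (fun i => √(A i) * √(B i) - 1) =O[l] a := by
    have h1 : (fun i => (√(A i) - 1) * √(B i)) =O[l] a := by simpa using hsA.mul hsB'
    refine (h1.add hsB).congr_left fun i => ?_
    ring
  have hDhalf : ∀ᶠ i in l, (1 : ℝ) / 2 ≤ √(A i) * √(B i) := by
    filter_upwards [(lim hD).eventually_const_le (show (-(1 / 2) : ℝ) < 0 by norm_num)] with i hi
    linarith
  have hDinv : (fun i => (√(A i) * √(B i))⁻¹) =O[l] fun _ => (1 : ℝ) := by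
    refine IsBigO.of_bound 2 (hDhalf.mono fun i hi => ?_)
    have h0 : 0 < √(A i) * √(B i) := by linarith
    rw [Real.norm_of_nonneg (inv_nonneg.2 h0.le), norm_one, mul_one, inv_le_comm₀ h0 two_pos]
    linarith
  have hρO : (fun i => rho0 (S i)) =O[l] fun _ => (1 : ℝ) := by
    refine IsBigO.of_bound 1 (Eventually.of_forall fun i => ?_)
    rw [Real.norm_of_nonneg (hε₀.le.trans (hρ i)), norm_one, mul_one]
    exact hρ1 i
  have hrho : (fun i => |rhoHat (Shat i) (ahat i) (bhat i)| - rho0 (S i)) =O[l] a := by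
    have h1 : (fun i => rho0 (S i) * (√(A i) * √(B i) - 1)) =O[l] a := by
      simpa using hρO.mul hD
    have h2 := (hN2.sub h1).mul hDinv
    simp only [mul_one] at h2
    refine h2.congr' (hDhalf.mono fun i hi => ?_) EventuallyEq.rfl
    have h0 : 0 < √(A i) * √(B i) := by linarith
    have h3 : |rhoHat (Shat i) (ahat i) (bhat i)| = |N i| / (√(A i) * √(B i)) := by
      rw [rhoHat, abs_div, abs_of_pos h0]
    simp only [h3]
    generalize √(A i) * √(B i) = D at h0
    field_simp
    ring
  refine ⟨isBigO_sqrt_sub_sqrt hε₀ (fun i => abs_nonneg _) hρ hrho, ?_⟩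
  -- With opposite signs `N` would be close to `-ρ₀`, hence negative, while the scaling factor
  -- `|ρ̂|` is positive; this contradicts the sign convention.
  filter_upwards [hsign, (lim hN1).eventually_const_le (show (-(ε₀ / 2) : ℝ) < 0 by linarith),
    (lim hrho).eventually_const_le (show (-(ε₀ / 2) : ℝ) < 0 by linarith)] with i hs hn hr
  by_contra hne
  have hw : wa i * wb i = -1 := by
    rcases hwa i with h | h <;> rcases hwb i with h' | h' <;> simp [h, h'] at hne ⊢
  have hneg : N i < 0 := by
    rw [hw] at hn
    linarith [hρ i]
  rw [xHat, yHat, Matrix.mulVec_smul, smul_dotProduct, dotProduct_smul, smul_eq_mul, smul_eq_mul,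
    ← mul_assoc, Real.mul_self_sqrt (abs_nonneg _)] at hs
  have hpos : 0 < |rhoHat (Shat i) (ahat i) (bhat i)| := by linarith [hρ i]
  exact absurd hs (not_le.2 (mul_neg_of_pos_of_neg hpos hneg))

/-- The rescaled estimator `g (α₀ + δ)` is within `O(a)` and `O(b)` of `√ρ₀ α₀`. -/
lemma isSmall_rescaled {v δ : ∀ i, Fin (p i) ⊕ Fin (q i) → ℝ} {g ρ : I → ℝ}
    (ha : a =O[l] fun _ => (1 : ℝ)) (hρ : ρ =O[l] fun _ => (1 : ℝ))
    (hg : (fun i => g i - ρ i) =O[l] a) (hδ : IsSmall l a b δ)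
    (hv2 : (fun i => l2Norm (v i)) =O[l] fun _ => (1 : ℝ))
    (hv1 : (fun i => a i * l1Norm (v i)) =O[l] b) :
    IsSmall l a b fun i => (g i - ρ i) • v i + g i • δ i := by
  have hgO : g =O[l] fun _ => (1 : ℝ) :=
    ((hg.trans ha).add hρ).congr_left fun i => by ring
  constructor
  · have h1 : (fun i => |g i - ρ i| * l2Norm (v i)) =O[l] a := by
      simpa using hg.norm_left.mul hv2
    have h2 : (fun i => |g i| * l2Norm (δ i)) =O[l] a := by
      simpa using hgO.norm_left.mul hδ.l2
    refine IsBigO.trans (IsBigO.of_bound 1 (Eventually.of_forall fun i => ?_)) (h1.add h2)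
    rw [one_mul, Real.norm_of_nonneg (l2Norm_nonneg _)]
    refine (l2Norm_add_le _ _).trans (le_trans (le_of_eq ?_) (le_abs_self _))
    rw [l2Norm_smul, l2Norm_smul]
  · have h1 : (fun i => |g i - ρ i| * l1Norm (v i)) =O[l] b :=
      (hg.norm_left.mul (isBigO_refl _ l)).trans hv1
    have h2 : (fun i => |g i| * l1Norm (δ i)) =O[l] b := by
      simpa using hgO.norm_left.mul hδ.l1
    refine IsBigO.trans (IsBigO.of_bound 1 (Eventually.of_forall fun i => ?_)) (h1.add h2)
    rw [one_mul, Real.norm_of_nonneg (l1Norm_nonneg _)]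
    refine (l1Norm_add_le _ _).trans (le_trans (le_of_eq ?_) (le_abs_self _))
    rw [l1Norm_smul, l1Norm_smul]

end Estimators

/-! ### Expansion of one coordinate of the de-biased estimator. -/

section DebiasedExpansion
variable {I : Type*} {l : Filter I} {p q : I → ℕ} {S Shat : ∀ i, CovBlocks (p i) (q i)}
  {a b lam : I → ℝ}

/-- The remainder of a coordinate of the de-biased estimator, after factoring out the sign. -/
lemma xDebiased_sub_eq {p q : ℕ} {S Shat : CovBlocks p q} {α₀ : Fin p → ℝ} {β₀ : Fin q → ℝ}
    {Φ : Matrix (Fin p ⊕ Fin q) (Fin p ⊕ Fin q) ℝ} {x δ : Fin p → ℝ} {y ε : Fin q → ℝ} {w : ℝ}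
    (hw : w = 1 ∨ w = -1) {ahat : Fin p → ℝ} {bhat : Fin q → ℝ}
    (hx : xHat Shat ahat bhat = w • (x + δ)) (hy : yHat Shat ahat bhat = w • (y + ε))
    (hinv : hessian0 S α₀ β₀ * Phi0 S α₀ β₀ = 1) (hΦ : (Phi0 S α₀ β₀)ᵀ = Phi0 S α₀ β₀)
    (j : Fin p) (L : ℝ) :
    xDebiased Shat ahat bhat Φ j - w * (x j - L) =
      -w * ((fun k => Φ k (Sum.inl j)) ⬝ᵥ gradH Shat (x + δ) (y + ε)
        - ((fun k => Phi0 S α₀ β₀ k (Sum.inl j)) ⬝ᵥ (hessian0 S α₀ β₀ *ᵥ Sum.elim δ ε) + L)) := by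
  have hinv' : Phi0 S α₀ β₀ * hessian0 S α₀ β₀ = 1 := mul_eq_one_comm.1 hinv
  -- `Φ⁰H⁰ = 1` returns the estimation error itself, so the Newton correction removes it to first
  -- order.
  have h1 : (fun k => Phi0 S α₀ β₀ k (Sum.inl j)) ⬝ᵥ (hessian0 S α₀ β₀ *ᵥ Sum.elim δ ε) = δ j := by
    have h2 : (Phi0 S α₀ β₀ *ᵥ (hessian0 S α₀ β₀ *ᵥ Sum.elim δ ε)) (Sum.inl j) = δ j := by
      rw [Matrix.mulVec_mulVec, hinv', Matrix.one_mulVec, Sum.elim_inl]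
    rw [← h2]
    conv_rhs => rw [← hΦ]
    rfl
  rw [h1, xDebiased, debiased, hx, hy, gradH_smul _ _ _ hw]
  have h3 : (Φᵀ *ᵥ (w • gradH Shat (x + δ) (y + ε))) (Sum.inl j) =
      w * ((fun k => Φ k (Sum.inl j)) ⬝ᵥ gradH Shat (x + δ) (y + ε)) := by
    rw [Matrix.mulVec_smul]
    rfl
  rw [Pi.sub_apply, h3, Sum.elim_inl, Pi.smul_apply, Pi.add_apply, smul_eq_mul]
  ring

/-- The two gradient blocks are expanded separately and added: their linear parts are the Hessian
term and the leading term, which `xDebiased_sub_eq` has isolated. The filter and the index set are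
arbitrary, so that the bound can later be made uniform in the outcome and the coordinate. -/
theorem debiased_expansion {r : ℕ} (hreg : IsRegime l S Shat a b lam)
    {U : ∀ i, Matrix (Fin (p i)) (Fin r) ℝ} {V : ∀ i, Matrix (Fin (q i)) (Fin r) ℝ}
    {α₀ : ∀ i, Fin (p i) → ℝ} {β₀ : ∀ i, Fin (q i) → ℝ} {ε₀ M : ℝ} (hε₀ : 0 < ε₀) (hM : 0 < M)
    (hpop : ∀ i, IsRegularPopulation (S i) (U i) (V i) (α₀ i) (β₀ i) ε₀ M)
    (hE : ∃ C : ℝ, ∀ᶠ i in l, ∀ j k, |covErr (S i) (Shat i) (direction (S i) (α₀ i) (β₀ i) j)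
      (direction (S i) (α₀ i) (β₀ i) k)| ≤ C * lam i)
    {ahat : ∀ i, Fin (p i) → ℝ} {bhat : ∀ i, Fin (q i) → ℝ} {wa wb : I → ℝ}
    (hwa : ∀ i, wa i = 1 ∨ wa i = -1) (hwb : ∀ i, wb i = 1 ∨ wb i = -1)
    (ha2 : (fun i => l2Norm (wa i • ahat i - α₀ i)) =O[l] a)
    (ha1 : (fun i => l1Norm (wa i • ahat i - α₀ i)) =O[l] b)
    (hb2 : (fun i => l2Norm (wb i • bhat i - β₀ i)) =O[l] a)
    (hb1 : (fun i => l1Norm (wb i • bhat i - β₀ i)) =O[l] b)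
    (hα1 : (fun i => a i * l1Norm (α₀ i)) =O[l] b)
    (hβ1 : (fun i => a i * l1Norm (β₀ i)) =O[l] b)
    (hsign : ∀ᶠ i in l, 0 ≤ xHat (Shat i) (ahat i) (bhat i) ⬝ᵥ
      ((Shat i).xy *ᵥ yHat (Shat i) (ahat i) (bhat i)))
    {Φhat : ∀ i, Matrix (Fin (p i) ⊕ Fin (q i)) (Fin (p i) ⊕ Fin (q i)) ℝ} (j : ∀ i, Fin (p i))
    (hΦ2 : (fun i => l2Norm fun k => Φhat i k (Sum.inl (j i)) -
      Phi0 (S i) (α₀ i) (β₀ i) k (Sum.inl (j i))) =O[l] a)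
    (hΦ1 : (fun i => l1Norm fun k => Φhat i k (Sum.inl (j i)) -
      Phi0 (S i) (α₀ i) (β₀ i) k (Sum.inl (j i))) =O[l] b) :
    (fun i => xDebiased (Shat i) (ahat i) (bhat i) (Φhat i) (j i) - wa i *
      (target (S i) (α₀ i) (j i) - calL1 (S i) (Shat i) (α₀ i) (β₀ i) (j i)))
      =O[l] fun i => a i ^ 2 := by
  obtain ⟨C, hC⟩ := hE
  have hCov : ∀ d d' : ∀ i, DirIndex (p i) (q i),
      (fun i => covErr (S i) (Shat i) (direction (S i) (α₀ i) (β₀ i) (d i))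
        (direction (S i) (α₀ i) (β₀ i) (d' i))) =O[l] lam := fun d d' => by
    refine IsBigO.of_bound |C| (hC.mono fun i hi => ?_)
    rw [Real.norm_eq_abs, Real.norm_eq_abs, ← abs_mul]
    exact (hi _ _).trans (le_abs_self _)
  have hTame : ∀ d : ∀ i, DirIndex (p i) (q i),
      IsTame l S Shat lam fun i => direction (S i) (α₀ i) (β₀ i) (d i) := fun d => by
    refine ⟨IsBigO.of_bound (1 + M / (2 * ε₀) + M) (Eventually.of_forall fun i => ?_), C,
      hC.mono fun i hi k => hi (d i) (Sum.inl (Sum.inl k))⟩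
    rw [Real.norm_of_nonneg (l2Norm_nonneg _), norm_one, mul_one]
    exact (hpop i).l2Norm_direction_le hε₀ hM (d i)
  have hρpos : ∀ i, 0 < rho0 (S i) := fun i => hε₀.trans (hpop i).rho_gt
  have hsq1 : ∀ i, |√(rho0 (S i))| ≤ 1 := fun i => by
    rw [abs_of_nonneg (Real.sqrt_nonneg _)]
    exact Real.sqrt_le_one.2 (hpop i).rho_le
  have hsqrtO : (fun i => √(rho0 (S i))) =O[l] fun _ => (1 : ℝ) :=
    IsBigO.of_bound 1 (Eventually.of_forall fun i => by simpa using hsq1 i)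
  have hρO : (fun i => rho0 (S i)) =O[l] fun _ => (1 : ℝ) := by
    refine IsBigO.of_bound 1 (Eventually.of_forall fun i => ?_)
    rw [Real.norm_of_nonneg (hρpos i).le, norm_one, mul_one]
    exact (hpop i).rho_le
  have tα : IsTame l S Shat lam fun i => inX (q i) (α₀ i) :=
    hTame fun i => Sum.inr (Sum.inr true)
  have tβ : IsTame l S Shat lam fun i => inY (p i) (β₀ i) :=
    hTame fun i => Sum.inr (Sum.inr false)
  have hwsmul : ∀ {d : ℕ} {w : ℝ} (v α : Fin d → ℝ), w = 1 ∨ w = -1 →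
      v = w • (α + (w • v - α)) := by
    rintro d w v α (rfl | rfl) <;> simp
  set δα : ∀ i, Fin (p i) → ℝ := fun i => wa i • ahat i - α₀ i with hδα
  set δβ : ∀ i, Fin (q i) → ℝ := fun i => wb i • bhat i - β₀ i with hδβ
  have sα : IsSmall l a b fun i => inX (q i) (δα i) :=
    ⟨by simpa only [inX, l2Norm_elim_zero] using ha2,
      by simpa only [inX, l1Norm_elim, l1Norm_zero, add_zero] using ha1⟩
  have sβ : IsSmall l a b fun i => inY (p i) (δβ i) :=
    ⟨by simpa only [inY, l2Norm_zero_elim] using hb2,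
      by simpa only [inY, l1Norm_elim, l1Norm_zero, zero_add] using hb1⟩
  obtain ⟨hg, hw⟩ := rhoHat_consistency hreg hε₀ (fun i => (hpop i).feasible)
    (fun i => (hpop i).rho_gt.le) (fun i => (hpop i).rho_le)
    (fun i => by
      rw [bil_inX_inY, (hpop i).eigenX, dotProduct_smul, (hpop i).feasible.1, smul_eq_mul,
        mul_one])
    tα tβ (hCov (fun i => Sum.inr (Sum.inr true)) fun i => Sum.inr (Sum.inr true))
    (hCov (fun i => Sum.inr (Sum.inr false)) fun i => Sum.inr (Sum.inr false))
    (hCov (fun i => Sum.inr (Sum.inr true)) fun i => Sum.inr (Sum.inr false))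
    hwa hwb (fun i => hwsmul (ahat i) (α₀ i) (hwa i)) (fun i => hwsmul (bhat i) (β₀ i) (hwb i))
    sα sβ hsign
  set g : I → ℝ := fun i => √|rhoHat (Shat i) (ahat i) (bhat i)| with hgdef
  set δ : ∀ i, Fin (p i) → ℝ := fun i => (g i - √(rho0 (S i))) • α₀ i + g i • δα i with hδ
  set ε : ∀ i, Fin (q i) → ℝ := fun i => (g i - √(rho0 (S i))) • β₀ i + g i • δβ i with hε
  have sδ : IsSmall l a b fun i => inX (q i) (δ i) := by
    have := isSmall_rescaled hreg.a_bounded hsqrtO hg sα tα.l2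
      (by simpa only [inX, l1Norm_elim, l1Norm_zero, add_zero] using hα1)
    simpa only [hδ, inX_add, inX_smul] using this
  have sε : IsSmall l a b fun i => inY (p i) (ε i) := by
    have := isSmall_rescaled hreg.a_bounded hsqrtO hg sβ tβ.l2
      (by simpa only [inY, l1Norm_elim, l1Norm_zero, zero_add] using hβ1)
    simpa only [hε, inY_add, inY_smul] using this
  have hx : ∀ i, xHat (Shat i) (ahat i) (bhat i) = wa i • (target (S i) (α₀ i) + δ i) := by
    intro i
    have h1 : xHat (Shat i) (ahat i) (bhat i) = g i • ahat i := rfl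
    rw [h1, hwsmul (ahat i) (α₀ i) (hwa i), target]
    simp only [hδ, hδα]
    module
  have hy : ∀ i, wb i = wa i →
      yHat (Shat i) (ahat i) (bhat i) = wa i • (target (S i) (β₀ i) + ε i) := by
    intro i hi
    have h1 : yHat (Shat i) (ahat i) (bhat i) = g i • bhat i := rfl
    rw [h1, hwsmul (bhat i) (β₀ i) (hwb i), target, ← hi]
    simp only [hε, hδβ]
    module
  set φx : ∀ i, Fin (p i) → ℝ := fun i k => Phi0 (S i) (α₀ i) (β₀ i) (Sum.inl k) (Sum.inl (j i))
    with hφx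
  set φy : ∀ i, Fin (q i) → ℝ := fun i k => Phi0 (S i) (α₀ i) (β₀ i) (Sum.inr k) (Sum.inl (j i))
    with hφy
  set Δ : ∀ i, Fin (p i) ⊕ Fin (q i) → ℝ := fun i k => Φhat i k (Sum.inl (j i)) -
      Phi0 (S i) (α₀ i) (β₀ i) k (Sum.inl (j i)) with hΔ
  have sΔ : IsSmall l a b Δ := ⟨hΦ2, hΦ1⟩
  have sΔx : IsSmall l a b fun i => inX (q i) (Δ i ∘ Sum.inl) :=
    sΔ.mono (fun i => l2Norm_inX_comp_le _) fun i => l1Norm_inX_comp_le _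
  have sΔy : IsSmall l a b fun i => inY (p i) (Δ i ∘ Sum.inr) :=
    sΔ.mono (fun i => l2Norm_inY_comp_le _) fun i => l1Norm_inY_comp_le _
  have tφx : IsTame l S Shat lam fun i => inX (q i) (φx i) :=
    hTame fun i => Sum.inl (Sum.inr (Sum.inl (j i)))
  have tφy : IsTame l S Shat lam fun i => inY (p i) (φy i) :=
    hTame fun i => Sum.inr (Sum.inl (Sum.inl (j i)))
  have tx : IsTame l S Shat lam fun i => inX (q i) (target (S i) (α₀ i)) := by
    simpa only [target, inX_smul] using tα.smul hsq1
  have ty : IsTame l S Shat lam fun i => inY (p i) (target (S i) (β₀ i)) := by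
    simpa only [target, inY_smul] using tβ.smul hsq1
  have hss : ∀ i, √(rho0 (S i)) * √(rho0 (S i)) = rho0 (S i) := fun i =>
    Real.mul_self_sqrt (hρpos i).le
  have hX := hreg.gradient_block_expansion hρO tφx tx ty sΔx sδ sε
    (by
      have := hsqrtO.mul
        (hCov (fun i => Sum.inl (Sum.inr (Sum.inl (j i)))) fun i => Sum.inr (Sum.inr true))
      simp only [one_mul] at this
      refine this.congr_left fun i => ?_
      rw [target, inX_smul, map_smul]
      rfl)
    (by
      have := hρO.mul (hCov (fun i => Sum.inr (Sum.inr true)) fun i => Sum.inr (Sum.inr true))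
      simp only [one_mul] at this
      refine this.congr_left fun i => ?_
      rw [target, inX_smul, map_smul, map_smul, LinearMap.smul_apply, smul_smul, hss]
      rfl)
    (fun i => by
      rw [bil_inX_inX, target, Matrix.mulVec_smul, smul_dotProduct, dotProduct_smul,
        (hpop i).feasible.1, smul_eq_mul, smul_eq_mul, mul_one, hss])
    (fun i => by
      rw [bil_inX_inY, bil_inX_inX, target, target, Matrix.mulVec_smul, Matrix.mulVec_smul,
        (hpop i).eigenX, dotProduct_smul, dotProduct_smul, dotProduct_smul]
      simp only [smul_eq_mul]
      ring)
    (fun i => by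
      rw [bil_inX_inY, bil_inX_inX, target, target, Matrix.mulVec_smul, Matrix.mulVec_smul,
        (hpop i).eigenX, dotProduct_smul, dotProduct_smul, dotProduct_smul]
      simp only [smul_eq_mul]
      ring)
  have hY := hreg.gradient_block_expansion hρO tφy ty tx sΔy sε sδ
    (by
      have := hsqrtO.mul
        (hCov (fun i => Sum.inr (Sum.inl (Sum.inl (j i)))) fun i => Sum.inr (Sum.inr false))
      simp only [one_mul] at this
      refine this.congr_left fun i => ?_
      rw [target, inY_smul, map_smul]
      rfl)
    (by
      have := hρO.mul (hCov (fun i => Sum.inr (Sum.inr false)) fun i => Sum.inr (Sum.inr false))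
      simp only [one_mul] at this
      refine this.congr_left fun i => ?_
      rw [target, inY_smul, map_smul, map_smul, LinearMap.smul_apply, smul_smul, hss]
      rfl)
    (fun i => by
      rw [bil_inY_inY, target, Matrix.mulVec_smul, smul_dotProduct, dotProduct_smul,
        (hpop i).feasible.2, smul_eq_mul, smul_eq_mul, mul_one, hss])
    (fun i => by
      rw [bil_inY_inX, bil_inY_inY, target, target, Matrix.mulVec_smul, Matrix.mulVec_smul,
        (hpop i).eigenY, dotProduct_smul, dotProduct_smul, dotProduct_smul]
      simp only [smul_eq_mul]
      ring)
    (fun i => by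
      rw [bil_inY_inX, bil_inY_inY, target, target, Matrix.mulVec_smul, Matrix.mulVec_smul,
        (hpop i).eigenY, dotProduct_smul, dotProduct_smul, dotProduct_smul]
      simp only [smul_eq_mul]
      ring)
  have hwO : (fun i => -wa i) =O[l] fun _ => (1 : ℝ) :=
    IsBigO.of_bound 1 (Eventually.of_forall fun i => by rcases hwa i with h | h <;> simp [h])
  have hXY := hwO.mul (hX.add hY)
  simp only [one_mul] at hXY
  refine hXY.congr' ?_ EventuallyEq.rfl
  -- The signs agree only eventually, and only then does the sign of `x̂` also factor out of `ŷ`.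
  filter_upwards [hw] with i hi
  rw [xDebiased_sub_eq (hwa i) (hx i) (hy i hi) (hpop i).mul_Phi0 (hpop i).Phi0_symm (j i), calL1,
    calL_apply _ _ _ _ (hpop i).Phi0_symm]
  have e1 : (fun k => Φhat i k (Sum.inl (j i))) =
      Sum.elim (φx i + Δ i ∘ Sum.inl) (φy i + Δ i ∘ Sum.inr) := by
    ext (k | k) <;> simp [hφx, hφy, hΔ]
  have e2 : (fun k => Phi0 (S i) (α₀ i) (β₀ i) k (Sum.inl (j i))) = Sum.elim (φx i) (φy i) := by
    ext (k | k) <;> rfl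
  rw [e1, e2, dotProduct_gradH, dotProduct_hessian0_target _ _ _ (hρpos i)]
  simp only [inX_add, inY_add]
  ring

end DebiasedExpansion

/-! ### The sampling model, row sparsity and the choice of sign. -/

section Model
variable {p q : ℕ}

lemma populationCov_xx_transpose (μ : Measure ((Fin p → ℝ) × (Fin q → ℝ))) :
    (populationCov μ).xxᵀ = (populationCov μ).xx := by
  ext i j
  simp [populationCov, covariance_comm]

lemma populationCov_yy_transpose (μ : Measure ((Fin p → ℝ) × (Fin q → ℝ))) :
    (populationCov μ).yyᵀ = (populationCov μ).yy := by
  ext i j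
  simp [populationCov, covariance_comm]

lemma isSymm_bil_sampleCov {n : ℕ} (z : Fin n → (Fin p → ℝ) × (Fin q → ℝ)) :
    (bil (sampleCov z)).IsSymm :=
  isSymm_bil (by simp [sampleCov, Matrix.transpose_sum]) (by simp [sampleCov, Matrix.transpose_sum])

/-- Cauchy–Schwarz for the semidefinite form. On the diagonal, positivity at `(x, -y)` bounds the
cross terms by the block terms, which costs the factor `2`. -/
lemma abs_bil_le {S : CovBlocks p q} (hx : S.xxᵀ = S.xx) (hy : S.yyᵀ = S.yy)
    (hpsd : ∀ u, 0 ≤ bil S u u) {M : ℝ} (hM : 0 < M) (hMx : EigenvaluesBounded S.xx M)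
    (hMy : EigenvaluesBounded S.yy M) (u v : Fin p ⊕ Fin q → ℝ) :
    |bil S u v| ≤ 2 * M * (l2Norm u * l2Norm v) := by
  have hdiag : ∀ w, bil S w w ≤ 2 * M * l2Norm w ^ 2 := by
    intro w
    obtain ⟨x, y, rfl⟩ : ∃ x y, w = Sum.elim x y := ⟨_, _, (Sum.elim_comp_inl_inr w).symm⟩
    have h1 := hpsd (inX q x - inY p y)
    rw [l2Norm_elim_sq, l2Norm_sq, l2Norm_sq, elim_eq_inX_add_inY]
    simp only [map_sub, map_add, LinearMap.sub_apply, LinearMap.add_apply, bil_inX_inX,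
      bil_inY_inY] at h1 ⊢
    linarith [(hMx.quadratic_bounds hx x).2, (hMy.quadratic_bounds hy y).2]
  refine abs_le_of_sq_le_sq ?_ (by
    have := l2Norm_nonneg u
    have := l2Norm_nonneg v
    positivity)
  calc bil S u v ^ 2 ≤ bil S u u * bil S v v :=
        LinearMap.BilinForm.apply_sq_le_of_symm _ hpsd ⟨(isSymm_bil hx hy).eq⟩ u v
    _ ≤ (2 * M * l2Norm u ^ 2) * (2 * M * l2Norm v ^ 2) :=
        mul_le_mul (hdiag u) (hdiag v) (hpsd v) (by positivity)
    _ = _ := by ring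

/-- Gives `s ≥ 1`, so that powers of `s` are monotone in the exponent, and later the divergence of
the dimension. -/
lemma one_le_rowSparsity {d r : ℕ} (hr : 1 ≤ r) {A : Matrix (Fin d) (Fin d) ℝ}
    {U : Matrix (Fin d) (Fin r) ℝ} (h : Uᵀ * A * U = 1) : 1 ≤ rowSparsity U := by
  rw [rowSparsity, Nat.one_le_iff_ne_zero, Ne, Set.ncard_eq_zero (Set.toFinite _)]
  intro h0
  have hU : U = 0 := by
    funext i
    by_contra hi
    exact (h0 ▸ (show i ∈ {i | U i ≠ 0} from hi) : i ∈ (∅ : Set (Fin d)))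
  rw [hU, Matrix.mul_zero] at h
  have := congrFun (congrFun h ⟨0, hr⟩) ⟨0, hr⟩
  simp at this

/-- The sign that minimises `‖w a - α‖₂`. -/
noncomputable def l2Sign {d : ℕ} (a α : Fin d → ℝ) : ℝ :=
  open Classical in if l2Norm (a - α) ≤ l2Norm (-a - α) then 1 else -1

lemma l2Sign_eq {d : ℕ} (a α : Fin d → ℝ) : l2Sign a α = 1 ∨ l2Sign a α = -1 := by
  unfold l2Sign
  split_ifs <;> simp

lemma signDist_eq_l2Sign {d : ℕ} (a α : Fin d → ℝ) :
    signDist l2Norm a α = l2Norm (l2Sign a α • a - α) := by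
  unfold l2Sign signDist
  split_ifs with h
  · rw [min_eq_left h, one_smul]
  · rw [min_eq_right (not_le.1 h).le, neg_one_smul]

lemma measurable_l2Norm {d : ℕ} : Measurable (l2Norm : (Fin d → ℝ) → ℝ) := by
  have : (l2Norm : (Fin d → ℝ) → ℝ) = fun v => √(∑ i, v i * v i) := funext l2Norm_eq_sqrt
  rw [this]
  fun_prop

lemma measurable_l2Sign {Ω : Type*} [MeasurableSpace Ω] {d : ℕ} {f : Ω → Fin d → ℝ}
    (hf : Measurable f) (α : Fin d → ℝ) : Measurable fun ω => l2Sign (f ω) α := by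
  classical
  unfold l2Sign
  refine Measurable.ite (measurableSet_le ?_ ?_) measurable_const measurable_const
  · exact measurable_l2Norm.comp (hf.sub_const α)
  · exact measurable_l2Norm.comp (hf.neg.sub_const α)

lemma signDist_nonneg {d : ℕ} {N : (Fin d → ℝ) → ℝ} (hN : ∀ v, 0 ≤ N v) (a α : Fin d → ℝ) :
    0 ≤ signDist N a α := le_min (hN _) (hN _)

lemma le_maxColDist {ι : Type*} [Fintype ι] (N : (ι → ℝ) → ℝ) (A B : Matrix ι ι ℝ) (j : ι) :
    N (fun k => A k j - B k j) ≤ maxColDist N A B :=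
  le_ciSup (f := fun j => N fun k => A k j - B k j) (Set.finite_range _).bddAbove j

lemma l1Norm_le_of_rowSparsity {d r : ℕ} {U : Matrix (Fin d) (Fin r) ℝ} {α : Fin d → ℝ}
    (h : ∀ i, U i = 0 → α i = 0) : l1Norm α ≤ √(rowSparsity U : ℝ) * l2Norm α := by
  classical
  have := l1Norm_le_of_support (Finset.univ.filter fun i => U i ≠ 0) α
    fun i hi => h i (by simpa using hi)
  rwa [← Set.ncard_coe_finset, Finset.coe_filter_univ] at this

lemma l1Norm_l2Sign_sub_le {d r : ℕ} {U : Matrix (Fin d) (Fin r) ℝ} {α : Fin d → ℝ}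
    (h : ∀ i, U i = 0 → α i = 0) (a : Fin d → ℝ) :
    l1Norm (l2Sign a α • a - α) ≤
      3 * signDist l1Norm a α + 2 * (√(rowSparsity U : ℝ) * signDist l2Norm a α) := by
  classical
  have := l1Norm_sub_le_of_signDist (Finset.univ.filter fun i => U i ≠ 0) α a
    (fun i hi => h i (by simpa using hi)) (l2Sign_eq a α) (signDist_eq_l2Sign a α)
  rwa [← Set.ncard_coe_finset, Finset.coe_filter_univ] at this

lemma card_dirIndex_le (p q : ℕ) : Fintype.card (DirIndex p q) ≤ 6 * max p q + 2 := by
  simp only [DirIndex, Fintype.card_sum, Fintype.card_fin, Fintype.card_bool]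
  omega

end Model

/-! ### Comparison of the rates. -/

section Rates

/-- Consequences of the sparsity assumption for the rates `s^κ λ` and `s^{κ+1/2} λ`. -/
lemma rate_conditions {p q s : ℕ → ℕ} {κ : ℝ} (hκ : κ ∈ Set.Icc (1 / 2 : ℝ) 1)
    (hs : ∀ n, 1 ≤ s n) (hm : Tendsto (fun n => max (p n) (q n)) atTop atTop)
    (hsparse : (fun n => (s n : ℝ) ^ (2 * κ) * lam (p n) (q n) n ^ 2)
      =o[atTop] fun n => (n : ℝ) ^ (-(1 / 2) : ℝ))
    {a b : ℕ → ℝ} (ha : ∀ n, a n = (s n : ℝ) ^ κ * lam (p n) (q n) n)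
    (hb : ∀ n, b n = (s n : ℝ) ^ (κ + 1 / 2) * lam (p n) (q n) n) :
    (∀ n, a n ^ 2 = (s n : ℝ) ^ (2 * κ) * lam (p n) (q n) n ^ 2) ∧
    (∀ n, b n = √(s n : ℝ) * a n) ∧ (∀ n, lam (p n) (q n) n ≤ a n) ∧
    (∀ n, lam (p n) (q n) n * b n ≤ a n ^ 2) ∧
    (∀ᶠ n in atTop, lam (p n) (q n) n * b n ^ 2 ≤ a n ^ 2) ∧ Tendsto a atTop (𝓝 0) := by
  have hs1 : ∀ n, (1 : ℝ) ≤ s n := fun n => by exact_mod_cast hs n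
  have hs0 : ∀ n, (0 : ℝ) < s n := fun n => one_pos.trans_le (hs1 n)
  have hl0 : ∀ n, 0 ≤ lam (p n) (q n) n := fun n => Real.sqrt_nonneg _
  have hasq : ∀ n, a n ^ 2 = (s n : ℝ) ^ (2 * κ) * lam (p n) (q n) n ^ 2 := fun n => by
    rw [ha, mul_pow, ← Real.rpow_natCast, ← Real.rpow_mul (hs0 n).le, mul_comm κ]
    norm_num
  have hbe : ∀ n, b n = √(s n : ℝ) * a n := fun n => by
    rw [hb, ha, Real.rpow_add (hs0 n), ← Real.sqrt_eq_rpow]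
    ring
  have ha0 : ∀ n, 0 ≤ a n := fun n => by
    rw [ha]
    exact mul_nonneg (Real.rpow_nonneg (hs0 n).le _) (hl0 n)
  refine ⟨hasq, hbe, fun n => ?_, fun n => ?_, ?_, ?_⟩
  · rw [ha]
    exact le_mul_of_one_le_left (hl0 n)
      (Real.one_le_rpow (hs1 n) (le_trans (by norm_num) hκ.1))
  · rw [hasq, hb]
    -- This is where `κ ≥ 1/2` turns the `ℓ¹` rate into the square of the `ℓ²` rate.
    have : (s n : ℝ) ^ (κ + 1 / 2) ≤ (s n : ℝ) ^ (2 * κ) :=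
      Real.rpow_le_rpow_of_exponent_le (hs1 n) (by linarith [hκ.1])
    calc _ = (s n : ℝ) ^ (κ + 1 / 2) * lam (p n) (q n) n ^ 2 := by ring
      _ ≤ _ := mul_le_mul_of_nonneg_right this (sq_nonneg _)
  · filter_upwards [hsparse.bound one_pos, hm.eventually_ge_atTop 3, eventually_gt_atTop 0]
      with n h1 h2 hn
    have hn' : (0 : ℝ) < n := Nat.cast_pos.2 hn
    rw [← hasq, one_mul, Real.norm_of_nonneg (sq_nonneg _),
      Real.norm_of_nonneg (Real.rpow_nonneg hn'.le _)] at h1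
    -- The threshold `3` exceeds `e`, so `λ ≥ n^(-1/2)`.
    have hlog : 1 ≤ Real.log ((max (p n) (q n) : ℕ) : ℝ) := by
      rw [Real.le_log_iff_exp_le (Nat.cast_pos.2 (by omega))]
      have h3 : (3 : ℝ) ≤ ((max (p n) (q n) : ℕ) : ℝ) := by exact_mod_cast h2
      linarith [Real.exp_one_lt_d9]
    have hlam : (n : ℝ) ^ (-(1 / 2) : ℝ) ≤ lam (p n) (q n) n := by
      rw [Real.rpow_neg hn'.le, ← Real.sqrt_eq_rpow, ← Real.sqrt_inv, lam]
      refine Real.sqrt_le_sqrt ?_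
      rw [inv_eq_one_div]
      exact div_le_div_of_nonneg_right hlog hn'.le
    have hlpos : 0 < lam (p n) (q n) n := (Real.rpow_pos_of_pos hn' _).trans_le hlam
    -- The chain `s λ² ≤ s^(2κ) λ² ≤ n^(-1/2) ≤ λ`, divided by `λ`.
    have hsl : (s n : ℝ) * lam (p n) (q n) n ≤ 1 := by
      refine le_of_mul_le_mul_right ?_ hlpos
      have h4 : (s n : ℝ) ^ (1 : ℝ) ≤ (s n : ℝ) ^ (2 * κ) :=
        Real.rpow_le_rpow_of_exponent_le (hs1 n) (by linarith [hκ.1])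
      rw [Real.rpow_one] at h4
      calc (s n : ℝ) * lam (p n) (q n) n * lam (p n) (q n) n
          = s n * lam (p n) (q n) n ^ 2 := by ring
        _ ≤ a n ^ 2 := by rw [hasq]; exact mul_le_mul_of_nonneg_right h4 (sq_nonneg _)
        _ ≤ 1 * lam (p n) (q n) n := by rw [one_mul]; exact h1.trans hlam
    rw [hbe, mul_pow, Real.sq_sqrt (hs0 n).le]
    calc _ = (s n : ℝ) * lam (p n) (q n) n * a n ^ 2 := by ring
      _ ≤ 1 * a n ^ 2 := mul_le_mul_of_nonneg_right hsl (sq_nonneg _)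
      _ = a n ^ 2 := one_mul _
  · have h1 : Tendsto (fun n : ℕ => (n : ℝ) ^ (-(1 / 2) : ℝ)) atTop (𝓝 0) :=
      (tendsto_rpow_neg_atTop (by norm_num)).comp tendsto_natCast_atTop_atTop
    have h2 : Tendsto (fun n => a n ^ 2) atTop (𝓝 0) := by
      simp only [hasq]
      exact hsparse.isBigO.trans_tendsto h1
    have h3 := (Real.continuous_sqrt.tendsto 0).comp h2
    rw [Real.sqrt_zero] at h3
    exact h3.congr fun n => Real.sqrt_sq (ha0 n)

/-- Divergence of the dimension is a consequence of sparsity: a quantity at least `1` is negligible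
against `p`. -/
lemma tendsto_atTop_of_isLittleO {f p : ℕ → ℕ} (hf : ∀ n, 1 ≤ f n)
    (h : (fun n => (f n : ℝ)) =o[atTop] fun n => (p n : ℝ)) : Tendsto p atTop atTop := by
  rw [← tendsto_natCast_atTop_iff (R := ℝ)]
  have h1 : (fun _ : ℕ => (1 : ℝ)) =o[atTop] fun n => (p n : ℝ) := by
    refine IsBigO.trans_isLittleO (IsBigO.of_bound 1 (Eventually.of_forall fun n => ?_)) h
    simpa using hf n
  have h2 := (isLittleO_const_left_of_ne one_ne_zero).1 h1
  exact h2.congr fun n => by simp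

end Rates

/-! ### Stochastic orders through good events. -/

section StochasticOrder
variable {Ω : ℕ → Type*} [∀ n, MeasurableSpace (Ω n)] {P : ∀ n, Measure (Ω n)}
  {Z : ∀ n, Ω n → ℝ} {a b : ℕ → ℝ}

/-- Reduces a stochastic order to a deterministic bound on events of probability close to one;
events and constant may both depend on `ε`. -/
lemma isBigOInProb_of_forall_good_events (ha : ∀ n, 0 ≤ a n)
    (h : ∀ ε : ℝ, 0 < ε → ∃ G : ∀ n, Set (Ω n), (∀ᶠ n in atTop, P n (G n)ᶜ ≤ ENNReal.ofReal ε) ∧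
      ∃ C : ℝ, ∀ᶠ n in atTop, ∀ ω ∈ G n, |Z n ω| ≤ C * a n) : IsBigOInProb P Z a := by
  intro ε hε
  obtain ⟨G, hG, C, hC⟩ := h ε hε
  refine ⟨max C 1, lt_max_of_lt_right one_pos, ?_⟩
  filter_upwards [hG, hC] with n h1 h2
  refine (measure_mono fun ω hω hωG => ?_).trans h1
  have h3 : C * a n ≤ max C 1 * a n := mul_le_mul_of_nonneg_right (le_max_left _ _) (ha n)
  exact absurd (show max C 1 * a n < |Z n ω| from hω) (not_lt.2 ((h2 ω hωG).trans h3))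

lemma IsBigOInProb.isLittleOInProb (h : IsBigOInProb P Z a) (hab : a =o[atTop] b)
    (ha : ∀ n, 0 ≤ a n) (hb : ∀ n, 0 ≤ b n) : IsLittleOInProb P Z b := by
  intro ε hε
  rw [ENNReal.tendsto_nhds_zero]
  intro η hη
  obtain ⟨η', hη', hle⟩ : ∃ η' : ℝ, 0 < η' ∧ ENNReal.ofReal η' ≤ η := by
    rcases eq_or_ne η ⊤ with rfl | hne
    · exact ⟨1, one_pos, le_top⟩
    · exact ⟨η.toReal, ENNReal.toReal_pos hη.ne' hne, ENNReal.ofReal_toReal_le⟩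
  obtain ⟨C, hC, hev⟩ := h η' hη'
  filter_upwards [hev, hab.bound (div_pos hε hC)] with n h1 h2
  refine (measure_mono fun ω hω => ?_).trans (h1.trans hle)
  rw [Real.norm_of_nonneg (ha n), Real.norm_of_nonneg (hb n), div_mul_eq_mul_div,
    le_div_iff₀ hC] at h2
  exact lt_of_le_of_lt (by linarith) (show ε * b n < |Z n ω| from hω)

end StochasticOrder

end SCCA

/-! ### Assembly of the representation. -/

theorem mainTheorem1
    -- the dimensions, the probability spaces, the population laws and the i.i.d. samples
    (p q : ℕ → ℕ)
    {Ω : ℕ → Type*} [∀ n, MeasurableSpace (Ω n)]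
    (P : ∀ n, Measure (Ω n)) [∀ n, IsProbabilityMeasure (P n)]
    (μ : ∀ n, Measure ((Fin (p n) → ℝ) × (Fin (q n) → ℝ)))
    [∀ n, IsProbabilityMeasure (μ n)]
    (Z : ∀ n, Fin n → Ω n → (Fin (p n) → ℝ) × (Fin (q n) → ℝ))
    (hZ : ∀ n, IsIIDSample (P n) (μ n) (Z n))
    -- `X` and `Y` are centered sub-Gaussian, uniformly in `n`
    (K : ℝ≥0)
    (hX : ∀ n, IsSubGaussianVector ((μ n).map Prod.fst) K)
    (hY : ∀ n, IsSubGaussianVector ((μ n).map Prod.snd) K)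
    -- the population covariance and the sample covariance
    (S : ∀ n, CovBlocks (p n) (q n)) (hS : ∀ n, S n = populationCov (μ n))
    (Shat : ∀ n, Ω n → CovBlocks (p n) (q n))
    (hShat : ∀ n ω, Shat n ω = sampleCov (fun i => Z n i ω))
    -- canonical decomposition of fixed rank `r`, and the first canonical directions
    (r : ℕ) (hr : 1 ≤ r)
    (U : ∀ n, Matrix (Fin (p n)) (Fin r) ℝ) (V : ∀ n, Matrix (Fin (q n)) (Fin r) ℝ)
    (Λ : ℕ → Fin r → ℝ)
    (hUV : ∀ n, IsCanonicalDecomposition (S n) (U n) (V n) (Λ n))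
    (α₀ : ∀ n, Fin (p n) → ℝ) (β₀ : ∀ n, Fin (q n) → ℝ)
    (hαβ : ∀ n, IsLeadingPair (S n) (α₀ n) (β₀ n))
    -- eigengap assumption
    (ε₀ : ℝ) (hε₀ : 0 < ε₀) (hε₀' : ε₀ < 1)
    (hgap : ∀ n, ε₀ < rho0 (S n) - secondCorr (Λ n))
    -- bounded eigenvalue assumption
    (M : ℝ) (hM : 0 < M)
    (hMx : ∀ n, EigenvaluesBounded (S n).xx M)
    (hMy : ∀ n, EigenvaluesBounded (S n).yy M)
    -- sparsity assumption
    (κ : ℝ) (hκ : κ ∈ Set.Icc (1 / 2 : ℝ) 1)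
    (s : ℕ → ℕ) (hs : ∀ n, s n = rowSparsity (U n) + rowSparsity (V n))
    (hsU : (fun n => (rowSparsity (U n) : ℝ)) =o[atTop] fun n => (p n : ℝ))
    (hsV : (fun n => (rowSparsity (V n) : ℝ)) =o[atTop] fun n => (q n : ℝ))
    (hsparse : (fun n => (s n : ℝ) ^ (2 * κ) * lam (p n) (q n) n ^ 2)
      =o[atTop] fun n => (n : ℝ) ^ (-(1 / 2) : ℝ))
    -- preliminary estimators and their rates
    (ahat : ∀ n, Ω n → Fin (p n) → ℝ) (hahat : ∀ n, Measurable (ahat n))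
    (bhat : ∀ n, Ω n → Fin (q n) → ℝ) (hbhat : ∀ n, Measurable (bhat n))
    (hprelim2 : IsBigOInProb P
      (fun n ω => signDist l2Norm (ahat n ω) (α₀ n) + signDist l2Norm (bhat n ω) (β₀ n))
      (fun n => (s n : ℝ) ^ κ * lam (p n) (q n) n))
    (hprelim1 : IsBigOInProb P
      (fun n ω => signDist l1Norm (ahat n ω) (α₀ n) + signDist l1Norm (bhat n ω) (β₀ n))
      (fun n => (s n : ℝ) ^ (κ + 1 / 2) * lam (p n) (q n) n))
    -- sign convention `x̂ᵀ Σ̂_xy ŷ ≥ 0`, with probability tending to one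
    (hsign : Tendsto (fun n => P n {ω | xHat (Shat n ω) (ahat n ω) (bhat n ω) ⬝ᵥ
        ((Shat n ω).xy *ᵥ yHat (Shat n ω) (ahat n ω) (bhat n ω)) < 0}) atTop (𝓝 0))
    -- inverse Hessian estimator and its rates
    (Φhat : ∀ n, Ω n → Matrix (Fin (p n) ⊕ Fin (q n)) (Fin (p n) ⊕ Fin (q n)) ℝ)
    (hΦhat : ∀ n i j, Measurable fun ω => Φhat n ω i j)
    (hΦ1 : IsBigOInProb P
      (fun n ω => maxColDist l1Norm (Φhat n ω) (Phi0 (S n) (α₀ n) (β₀ n)))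
      (fun n => (s n : ℝ) ^ (κ + 1 / 2) * lam (p n) (q n) n))
    (hΦ2 : IsBigOInProb P
      (fun n ω => maxColDist l2Norm (Φhat n ω) (Phi0 (S n) (α₀ n) (β₀ n)))
      (fun n => (s n : ℝ) ^ κ * lam (p n) (q n) n)) :
    ∃ (w : ∀ n, Ω n → ℝ) (rem : ∀ n, Ω n → Fin (p n) → ℝ),
      (∀ n, Measurable (w n)) ∧ (∀ n ω, w n ω = 1 ∨ w n ω = -1) ∧
      (∀ n ω, xDebiased (Shat n ω) (ahat n ω) (bhat n ω) (Φhat n ω) =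
        w n ω • (target (S n) (α₀ n) - calL1 (S n) (Shat n ω) (α₀ n) (β₀ n)) + rem n ω) ∧
      IsBigOInProb P (fun n ω => supNorm (rem n ω))
        (fun n => (s n : ℝ) ^ (2 * κ) * lam (p n) (q n) n ^ 2) ∧
      IsLittleOInProb P (fun n ω => supNorm (rem n ω))
        (fun n => (n : ℝ) ^ (-(1 / 2) : ℝ)) := by
  obtain rfl : S = fun n => populationCov (μ n) := funext hS
  obtain rfl : Shat = fun n ω => sampleCov (fun i => Z n i ω) :=
    funext fun n => funext fun ω => hShat n ω
  have hpsd : ∀ n w, 0 ≤ bil (populationCov (μ n)) w w := fun n =>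
    bil_populationCov_self_nonneg (hX n) (hY n)
  have hpop : ∀ n, IsRegularPopulation (populationCov (μ n)) (U n) (V n) (α₀ n) (β₀ n) ε₀ M :=
    fun n => isRegularPopulation hr (populationCov_xx_transpose _) (populationCov_yy_transpose _)
      (hpsd n) (hUV n) (hαβ n) hε₀ (hgap n) hM (hMx n) (hMy n)
  have hU1 : ∀ n, 1 ≤ rowSparsity (U n) := fun n => one_le_rowSparsity hr (hUV n).orthU
  have hUs : ∀ n, rowSparsity (U n) ≤ s n := fun n => by rw [hs]; exact Nat.le_add_right _ _
  have hVs : ∀ n, rowSparsity (V n) ≤ s n := fun n => by rw [hs]; exact Nat.le_add_left _ _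
  have hm : Tendsto (fun n => max (p n) (q n)) atTop atTop :=
    tendsto_atTop_mono (fun n => le_max_left _ _) (tendsto_atTop_of_isLittleO hU1 hsU)
  obtain ⟨a, ha⟩ : ∃ a : ℕ → ℝ, ∀ n, a n = (s n : ℝ) ^ κ * lam (p n) (q n) n := ⟨_, fun _ => rfl⟩
  obtain ⟨b, hb⟩ : ∃ b : ℕ → ℝ, ∀ n, b n = (s n : ℝ) ^ (κ + 1 / 2) * lam (p n) (q n) n :=
    ⟨_, fun _ => rfl⟩
  obtain ⟨hasq, hbe, hla, hlb, hlb2, ha0⟩ := rate_conditions hκ (fun n => (hU1 n).trans (hUs n)) hm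
    hsparse ha hb
  simp only [← ha] at hprelim2 hΦ2
  simp only [← hb] at hprelim1 hΦ1
  simp only [← hasq] at hsparse ⊢
  have hl0 : ∀ n, 0 ≤ lam (p n) (q n) n := fun n => Real.sqrt_nonneg _
  have hann : ∀ n, 0 ≤ a n := fun n => (hl0 n).trans (hla n)
  have hbnn : ∀ n, 0 ≤ b n := fun n => by
    rw [hbe]
    exact mul_nonneg (Real.sqrt_nonneg _) (hann n)
  have hlam0 : Tendsto (fun n => lam (p n) (q n) n) atTop (𝓝 0) :=
    squeeze_zero hl0 hla ha0
  have hR0 : 0 < 1 + M / (2 * ε₀) + M := by positivity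
  -- There are at most `6 (p ∨ q) + 2` directions, hence the multiplier `8` once `p ∨ q ≥ 1`.
  obtain ⟨C₀, hC₀, hconc⟩ := exists_uniform_concentration hZ
    (R := ⟨1 + M / (2 * ε₀) + M, hR0.le⟩) hR0 hX hY hm hlam0 (J := fun n => DirIndex (p n) (q n)) 8
    (by
      filter_upwards [hm.eventually_ge_atTop 1] with n hn
      have := card_dirIndex_le (p n) (q n)
      omega)
    (fun n => direction (populationCov (μ n)) (α₀ n) (β₀ n))
    (fun n => (hpop n).l2Norm_direction_le hε₀ hM)
  set T : ∀ n, Ω n → Fin (p n) → ℝ := fun n ω => target (populationCov (μ n)) (α₀ n) -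
    calL1 (populationCov (μ n)) (sampleCov fun i => Z n i ω) (α₀ n) (β₀ n) with hT
  set w : ∀ n, Ω n → ℝ := fun n ω => l2Sign (ahat n ω) (α₀ n) with hw
  set rem : ∀ n, Ω n → Fin (p n) → ℝ := fun n ω =>
    xDebiased (sampleCov fun i => Z n i ω) (ahat n ω) (bhat n ω) (Φhat n ω) - w n ω • T n ω
    with hrem
  have hbig : IsBigOInProb P (fun n ω => supNorm (rem n ω)) fun n => a n ^ 2 := by
    refine isBigOInProb_of_forall_good_events (fun n => sq_nonneg _) fun ε hε => ?_
    -- Six bad events share `ε`: four estimator rates, the sign convention and the concentration of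
    -- the sample covariance.
    have hε6 : 0 < ε / 6 := by positivity
    obtain ⟨C₁, hC₁, h1⟩ := hprelim2 _ hε6
    obtain ⟨C₂, hC₂, h2⟩ := hprelim1 _ hε6
    obtain ⟨C₃, hC₃, h3⟩ := hΦ1 _ hε6
    obtain ⟨C₄, hC₄, h4⟩ := hΦ2 _ hε6
    have h5 := ENNReal.tendsto_nhds_zero.1 hsign _ (ENNReal.ofReal_pos.2 hε6)
    have h6 := ENNReal.tendsto_nhds_zero.1 hconc _ (ENNReal.ofReal_pos.2 hε6)
    set B₁ : ∀ n, Set (Ω n) := fun n => {ω | C₁ * a n <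
      |signDist l2Norm (ahat n ω) (α₀ n) + signDist l2Norm (bhat n ω) (β₀ n)|} with hB₁
    set B₂ : ∀ n, Set (Ω n) := fun n => {ω | C₂ * b n <
      |signDist l1Norm (ahat n ω) (α₀ n) + signDist l1Norm (bhat n ω) (β₀ n)|} with hB₂
    set B₃ : ∀ n, Set (Ω n) := fun n => {ω | C₃ * b n <
      |maxColDist l1Norm (Φhat n ω) (Phi0 (populationCov (μ n)) (α₀ n) (β₀ n))|} with hB₃
    set B₄ : ∀ n, Set (Ω n) := fun n => {ω | C₄ * a n <
      |maxColDist l2Norm (Φhat n ω) (Phi0 (populationCov (μ n)) (α₀ n) (β₀ n))|} with hB₄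
    set B₅ : ∀ n, Set (Ω n) := fun n =>
      {ω | xHat (sampleCov fun i => Z n i ω) (ahat n ω) (bhat n ω) ⬝ᵥ
        ((sampleCov fun i => Z n i ω).xy *ᵥ
          yHat (sampleCov fun i => Z n i ω) (ahat n ω) (bhat n ω)) < 0} with hB₅
    set B₆ : ∀ n, Set (Ω n) := fun n => {ω | ∃ j k, C₀ * lam (p n) (q n) n <
      |bil (sampleCov fun i => Z n i ω) (direction (populationCov (μ n)) (α₀ n) (β₀ n) j)
          (direction (populationCov (μ n)) (α₀ n) (β₀ n) k) -
        bil (populationCov (μ n)) (direction (populationCov (μ n)) (α₀ n) (β₀ n) j)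
          (direction (populationCov (μ n)) (α₀ n) (β₀ n) k)|} with hB₆
    set G : ∀ n, Set (Ω n) := fun n =>
      (B₁ n ∪ (B₂ n ∪ (B₃ n ∪ (B₄ n ∪ (B₅ n ∪ B₆ n)))))ᶜ with hG
    refine ⟨G, ?_, ?_⟩
    · filter_upwards [h1, h2, h3, h4, h5, h6] with n h1 h2 h3 h4 h5 h6
      have hsum : ENNReal.ofReal ε = ENNReal.ofReal (ε / 6) + (ENNReal.ofReal (ε / 6) +
          (ENNReal.ofReal (ε / 6) + (ENNReal.ofReal (ε / 6) + (ENNReal.ofReal (ε / 6) +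
            ENNReal.ofReal (ε / 6))))) := by
        repeat rw [← ENNReal.ofReal_add (by positivity) (by positivity)]
        congr 1
        ring
      rw [hG, compl_compl, hsum]
      exact (measure_union_le _ _).trans (add_le_add h1 ((measure_union_le _ _).trans
        (add_le_add h2 ((measure_union_le _ _).trans (add_le_add h3 ((measure_union_le _ _).trans
        (add_le_add h4 ((measure_union_le _ _).trans (add_le_add h5 h6)))))))))
    have hmem : ∀ n, ∀ ω ∈ G n, ω ∉ B₁ n ∧ ω ∉ B₂ n ∧ ω ∉ B₃ n ∧ ω ∉ B₄ n ∧ ω ∉ B₅ n ∧ ω ∉ B₆ n := by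
      intro n ω hω
      simpa only [hG, Set.mem_compl_iff, Set.mem_union, not_or] using hω
    -- Indices are triples (sample size, outcome, coordinate), with only `n` tending to infinity and
    -- the outcome confined to the good event. A big-O along `l` is therefore uniform in outcome and
    -- coordinate, which is what the sup norm requires.
    let l : Filter (Σ n, Ω n × Fin (p n)) :=
      comap Sigma.fst atTop ⊓ 𝓟 {x | x.2.1 ∈ G x.1}
    have hl : Tendsto (Sigma.fst : (Σ n, Ω n × Fin (p n)) → ℕ) l atTop :=
      tendsto_comap.mono_left inf_le_left
    have hlG : ∀ᶠ x in l, x.2.1 ∈ G x.1 := mem_inf_of_right (mem_principal_self _)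
    have onG : ∀ {f : (Σ n, Ω n × Fin (p n)) → ℝ} {g : ℕ → ℝ} (C : ℝ), (∀ n, 0 ≤ g n) →
        (∀ x, 0 ≤ f x) → (∀ x, x.2.1 ∈ G x.1 → f x ≤ C * g x.1) → f =O[l] fun x => g x.1 := by
      intro f g C hg hf h
      refine IsBigO.of_bound C (hlG.mono fun x hx => ?_)
      rw [Real.norm_of_nonneg (hf x), Real.norm_of_nonneg (hg x.1)]
      exact h x hx
    have onN : ∀ {f g : ℕ → ℝ}, (∀ n, 0 ≤ f n) → (∀ n, 0 ≤ g n) → (∀ᶠ n in atTop, f n ≤ g n) →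
        (fun x : Σ n, Ω n × Fin (p n) => f x.1) =O[l] fun x => g x.1 := by
      intro f g hf hg h
      refine IsBigO.comp_tendsto (IsBigO.of_bound 1 (h.mono fun n hn => ?_)) hl
      rwa [Real.norm_of_nonneg (hf n), Real.norm_of_nonneg (hg n), one_mul]
    have hd2 : ∀ n, ∀ ω ∈ G n, signDist l2Norm (ahat n ω) (α₀ n) ≤ C₁ * a n ∧
        signDist l2Norm (bhat n ω) (β₀ n) ≤ C₁ * a n := by
      intro n ω hω
      have h : signDist l2Norm (ahat n ω) (α₀ n) + signDist l2Norm (bhat n ω) (β₀ n) ≤ C₁ * a n :=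
        (le_abs_self _).trans (not_lt.1 (hmem n ω hω).1)
      have h7 := signDist_nonneg l2Norm_nonneg (ahat n ω) (α₀ n)
      have h8 := signDist_nonneg l2Norm_nonneg (bhat n ω) (β₀ n)
      exact ⟨by linarith, by linarith⟩
    have hd1 : ∀ n, ∀ ω ∈ G n, signDist l1Norm (ahat n ω) (α₀ n) ≤ C₂ * b n ∧
        signDist l1Norm (bhat n ω) (β₀ n) ≤ C₂ * b n := by
      intro n ω hω
      have h : signDist l1Norm (ahat n ω) (α₀ n) + signDist l1Norm (bhat n ω) (β₀ n) ≤ C₂ * b n :=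
        (le_abs_self _).trans (not_lt.1 (hmem n ω hω).2.1)
      have h7 := signDist_nonneg l1Norm_nonneg (ahat n ω) (α₀ n)
      have h8 := signDist_nonneg l1Norm_nonneg (bhat n ω) (β₀ n)
      exact ⟨by linarith, by linarith⟩
    have hl1 : ∀ n, ∀ ω ∈ G n,
        l1Norm (l2Sign (ahat n ω) (α₀ n) • ahat n ω - α₀ n) ≤ (3 * C₂ + 2 * C₁) * b n ∧
        l1Norm (l2Sign (bhat n ω) (β₀ n) • bhat n ω - β₀ n) ≤ (3 * C₂ + 2 * C₁) * b n := by
      intro n ω hω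
      have key : ∀ t d₁ d₂ : ℝ, 0 ≤ t → t ≤ s n → d₁ ≤ C₂ * b n → d₂ ≤ C₁ * a n → 0 ≤ d₂ →
          3 * d₁ + 2 * (√t * d₂) ≤ (3 * C₂ + 2 * C₁) * b n := by
        intro t d₁ d₂ _ ht h7 h8 h9
        have h10 : √t * d₂ ≤ √(s n : ℝ) * (C₁ * a n) :=
          mul_le_mul (Real.sqrt_le_sqrt ht) h8 h9 (Real.sqrt_nonneg _)
        have h11 := hbe n
        calc _ ≤ 3 * (C₂ * b n) + 2 * (√(s n : ℝ) * (C₁ * a n)) := by linarith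
          _ = _ := by rw [h11]; ring
      refine ⟨(l1Norm_l2Sign_sub_le (hpop n).supportX _).trans (key _ _ _ (Nat.cast_nonneg _)
        (Nat.cast_le.2 (hUs n)) (hd1 n ω hω).1 (hd2 n ω hω).1
        (signDist_nonneg l2Norm_nonneg _ _)),
        (l1Norm_l2Sign_sub_le (hpop n).supportY _).trans (key _ _ _ (Nat.cast_nonneg _)
        (Nat.cast_le.2 (hVs n)) (hd1 n ω hω).2 (hd2 n ω hω).2
        (signDist_nonneg l2Norm_nonneg _ _))⟩
    -- The error `O(a)` of the scale `√|ρ̂|` multiplies the whole direction `α₀`, whose `ℓ¹` norm is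
    -- at most `√(s M)` by sparsity; the product is again of order `b`.
    have hsp : ∀ n (t x : ℝ), t ≤ s n → 0 ≤ x → x ^ 2 ≤ M → a n * (√t * x) ≤ √M * b n := by
      intro n t x ht hx0 hxM
      have h7 : √t * x ≤ √(s n : ℝ) * √M :=
        mul_le_mul (Real.sqrt_le_sqrt ht) (Real.le_sqrt_of_sq_le hxM) hx0 (Real.sqrt_nonneg _)
      calc _ ≤ a n * (√(s n : ℝ) * √M) := mul_le_mul_of_nonneg_left h7 (hann n)
        _ = _ := by rw [hbe]; ring
    have hreg : IsRegime l (fun x => populationCov (μ x.1))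
        (fun x => sampleCov fun i => Z x.1 i x.2.1) (fun x => a x.1) (fun x => b x.1)
        (fun x => lam (p x.1) (q x.1) x.1) := by
      refine ⟨fun x => isSymm_bil (populationCov_xx_transpose _) (populationCov_yy_transpose _),
        fun x => isSymm_bil_sampleCov _, ⟨2 * M, by positivity, fun x u v =>
          abs_bil_le (populationCov_xx_transpose _) (populationCov_yy_transpose _) (hpsd x.1) hM
            (hMx x.1) (hMy x.1) u v⟩, ⟨C₀, hlG.mono fun x hx k m => ?_⟩, ha0.comp hl,
        onN hl0 hann (Eventually.of_forall hla),
        onN (f := fun n => lam (p n) (q n) n * b n) (g := fun n => a n ^ 2)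
          (fun n => mul_nonneg (hl0 n) (hbnn n)) (fun n => sq_nonneg _) (Eventually.of_forall hlb),
        onN (f := fun n => lam (p n) (q n) n * b n ^ 2) (g := fun n => a n ^ 2)
          (fun n => mul_nonneg (hl0 n) (sq_nonneg _)) (fun n => sq_nonneg _) hlb2⟩
      by_contra hcon
      exact (hmem _ _ hx).2.2.2.2.2 ⟨Sum.inl (Sum.inl k), Sum.inl (Sum.inl m), not_le.1 hcon⟩
    have hmain := debiased_expansion hreg (U := fun x => U x.1) (V := fun x => V x.1)
      (α₀ := fun x => α₀ x.1) (β₀ := fun x => β₀ x.1) hε₀ hM (fun x => hpop x.1)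
      ⟨C₀, hlG.mono fun x hx j k => not_lt.1 fun hcon => (hmem _ _ hx).2.2.2.2.2 ⟨j, k, hcon⟩⟩
      (ahat := fun x => ahat x.1 x.2.1) (bhat := fun x => bhat x.1 x.2.1)
      (wa := fun x => l2Sign (ahat x.1 x.2.1) (α₀ x.1))
      (wb := fun x => l2Sign (bhat x.1 x.2.1) (β₀ x.1))
      (fun x => l2Sign_eq _ _) (fun x => l2Sign_eq _ _)
      (onG C₁ hann (fun x => l2Norm_nonneg _) fun x hx => by
        rw [← signDist_eq_l2Sign]
        exact (hd2 _ _ hx).1)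
      (onG (3 * C₂ + 2 * C₁) hbnn (fun x => l1Norm_nonneg _) fun x hx => (hl1 _ _ hx).1)
      (onG C₁ hann (fun x => l2Norm_nonneg _) fun x hx => by
        rw [← signDist_eq_l2Sign]
        exact (hd2 _ _ hx).2)
      (onG (3 * C₂ + 2 * C₁) hbnn (fun x => l1Norm_nonneg _) fun x hx => (hl1 _ _ hx).2)
      (onG (√M) hbnn (fun x => mul_nonneg (hann _) (l1Norm_nonneg _)) fun x hx =>
        (mul_le_mul_of_nonneg_left (l1Norm_le_of_rowSparsity (hpop x.1).supportX) (hann _)).trans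
          (hsp _ _ _ (Nat.cast_le.2 (hUs _)) (l2Norm_nonneg _) (hpop x.1).l2X))
      (onG (√M) hbnn (fun x => mul_nonneg (hann _) (l1Norm_nonneg _)) fun x hx =>
        (mul_le_mul_of_nonneg_left (l1Norm_le_of_rowSparsity (hpop x.1).supportY) (hann _)).trans
          (hsp _ _ _ (Nat.cast_le.2 (hVs _)) (l2Norm_nonneg _) (hpop x.1).l2Y))
      (hlG.mono fun x hx => not_lt.1 (hmem _ _ hx).2.2.2.2.1)
      (Φhat := fun x => Φhat x.1 x.2.1) (fun x => x.2.2)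
      (onG C₄ hann (fun x => l2Norm_nonneg _) fun x hx =>
        (le_maxColDist l2Norm _ _ _).trans
          (le_of_abs_le (not_lt.1 (hmem _ _ hx).2.2.2.1)))
      (onG C₃ hbnn (fun x => l1Norm_nonneg _) fun x hx =>
        (le_maxColDist l1Norm _ _ _).trans
          (le_of_abs_le (not_lt.1 (hmem _ _ hx).2.2.1)))
    obtain ⟨C, hC, hev⟩ := hmain.exists_nonneg
    refine ⟨C, ?_⟩
    have hev' := hev.bound
    rw [eventually_inf_principal, eventually_comap] at hev'
    filter_upwards [hev'] with n hn ω hω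
    rw [supNorm, abs_of_nonneg (norm_nonneg _)]
    refine (pi_norm_le_iff_of_nonneg (mul_nonneg hC (sq_nonneg _))).2 fun j => ?_
    have h7 := hn ⟨n, ω, j⟩ rfl hω
    rwa [Real.norm_of_nonneg (sq_nonneg (a n))] at h7
  refine ⟨w, rem, fun n => measurable_l2Sign (hahat n) (α₀ n), fun n ω => l2Sign_eq _ _,
    fun n ω => ?_, hbig, hbig.isLittleOInProb hsparse (fun n => sq_nonneg _)
      fun n => Real.rpow_nonneg (Nat.cast_nonneg n) _⟩
  rw [hrem]
  exact (add_sub_cancel _ _).symm
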